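/- Let $d\ge 1$ and $\delta\in(0,1)$. There is a constant $N=N(d,\delta)$ such that the following holds for every $T\in(-\infty,\infty]$. Write $\mathbb{R}^{1+3d}_T=(-\infty,T)\times\mathbb{R}^{3d}$ with points $X=(t,x,y,z)$, $x,y,z\in\mathbb{R}^d$. Let $a^{ij}=a^{ij}(t)$, $i,j=1,\dots,d$, be bounded measurable functions of $t\in\mathbb{R}$ with $$\delta|\xi|^2\le \sum_{i,j=1}^d a^{ij}(t)\xi_i\xi_j\le\delta^{-1}|\xi|^2\qquad\text{for all }t\in\mathbb{R},\ \xi\in\mathbb{R}^d,$$ and put $$P_0u=\partial_tu-x\cdot\nabla_yu-y\cdot\nabla_zu-\sum_{i,j=1}^d a^{ij}(t)\,\partial_{x_ix_j}u .$$ Let $\lambda\ge 0$ and let $u\in S^2(\mathbb{R}^{1+3d}_T)$, that is, $u$ is a real-valued function such that $u$ and the distributional derivatives $\nabla_xu$, $\nabla_x^2u$ and $\partial_tu-x\cdot\nabla_yu-y\cdot\nabla_zu$ belong to $L^2(\mathbb{R}^{1+3d}_T)$. Then the distributions $\nabla_x(-\Delta_y)^{1/6}u$, $(-\Delta_y)^{1/3}u$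 and $(-\Delta_z)^{1/5}u$ belong to $L^2(\mathbb{R}^{1+3d}_T)$, and, with all norms taken in $L^2(\mathbb{R}^{1+3d}_T)$, $$\lambda\|u\|+\lambda^{1/2}\|\nabla_xu\|+\|\nabla_x(-\Delta_y)^{1/6}u\|+\|\nabla_x^2u\|+\|(-\Delta_y)^{1/3}u\|+\|(-\Delta_z)^{1/5}u\|+\|(\partial_t-x\cdot\nabla_y-y\cdot\nabla_z)u\|\le N\,\|P_0u+\lambda u\| .$$ Here, for $0<s<1/2$, the fractional Laplacian of a bounded Lipschitz function $f$ on $\mathbb{R}^d$ is $$(-\Delta)^sf(v)=c_{s,d}\int_{\mathbb{R}^d}\frac{f(v)-f(v-h)}{|h|^{d+2s}}\,dh,\qquad c_{s,d}=\frac{4^s\,\Gamma(\tfrac d2+s)}{\pi^{d/2}\,|\Gamma(-s)|},$$ $(-\Delta_y)^s$ and $(-\Delta_z)^s$ denote this operator acting in the variable $y$, respectively $z$, and on $u$ they act in the sense of distributions: $\langle(-\Delta_y)^su,\varphi\rangle=\langle u,(-\Delta_y)^s\varphi\rangle$, $\langle(-\Delta_z)^su,\varphi\rangle=\langle u,(-\Delta_z)^s\varphi\rangle$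 and $\langle\partial_{x_i}(-\Delta_y)^su,\varphi\rangle=-\langle u,(-\Delta_y)^s\partial_{x_i}\varphi\rangle$ for all $\varphi\in C_0^\infty(\mathbb{R}^{1+3d}_T)$. -/

import Mathlib

open MeasureTheory
open scoped ENNReal NNReal ContDiff

namespace KFP

noncomputable section

/-- Euclidean space `ℝ^d`. -/
abbrev Vec (d : ℕ) : Type := EuclideanSpace ℝ (Fin d)

/-- Points `X = (t, x, y, z)` of `ℝ^{1+3d}`. -/
abbrev Pt (d : ℕ) : Type := ℝ × Vec d × Vec d × Vec d

/-- The domain `(-∞, T) × ℝ^{3d}`, for `T` an extended real number. -/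
def slab (d : ℕ) (T : EReal) : Set (Pt d) := {X | (X.1 : EReal) < T}

/-- Lebesgue measure on `(-∞, T) × ℝ^{3d}`. -/
abbrev slabMeasure (d : ℕ) (T : EReal) : Measure (Pt d) :=
  (volume : Measure (Pt d)).restrict (slab d T)

/-- Test functions: smooth functions with compact support inside `(-∞, T) × ℝ^{3d}`. -/
structure IsTest {d : ℕ} (T : EReal) (φ : Pt d → ℝ) : Prop where
  smooth : ContDiff ℝ ∞ φ
  compact : HasCompactSupport φ
  support : tsupport φ ⊆ slab d T

/-- The classical derivative `∂_{x_i} φ`. -/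
def dx {d : ℕ} (i : Fin d) (φ : Pt d → ℝ) (X : Pt d) : ℝ :=
  fderiv ℝ φ X (0, EuclideanSpace.single i 1, 0, 0)

/-- The classical transport derivative `∂_t φ - x · ∇_y φ - y · ∇_z φ`, that is, the derivative
of `φ` at `(t, x, y, z)` in the direction `(1, 0, -x, -y)`. -/
def transport {d : ℕ} (φ : Pt d → ℝ) (X : Pt d) : ℝ :=
  fderiv ℝ φ X (1, 0, -X.2.1, -X.2.2.1)

/-- The normalizing constant `c_{s,d}` of the fractional Laplacian `(-Δ)^s` on `ℝ^d`,
`0 < s < 1`, for which `(-Δ)^s` has Fourier symbol `|ξ|^{2s}`. -/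
def fracConst (d : ℕ) (s : ℝ) : ℝ :=
  (4 : ℝ) ^ s * Real.Gamma ((d : ℝ) / 2 + s) /
    (Real.pi ^ ((d : ℝ) / 2) * |Real.Gamma (-s)|)

/-- The fractional Laplacian `(-Δ)^s f` on `ℝ^d`, pointwise; for `0 < s < 1/2` and `f` bounded and
Lipschitz the integral converges absolutely. -/
def fracLap {d : ℕ} (s : ℝ) (f : Vec d → ℝ) (v : Vec d) : ℝ :=
  fracConst d s * ∫ h : Vec d, (f v - f (v - h)) / ‖h‖ ^ ((d : ℝ) + 2 * s)

/-- `(-Δ_y)^s φ`. -/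
def fracLapY {d : ℕ} (s : ℝ) (φ : Pt d → ℝ) (X : Pt d) : ℝ :=
  fracLap s (fun y => φ (X.1, X.2.1, y, X.2.2.2)) X.2.2.1

/-- `(-Δ_z)^s φ`. -/
def fracLapZ {d : ℕ} (s : ℝ) (φ : Pt d → ℝ) (X : Pt d) : ℝ :=
  fracLap s (fun z => φ (X.1, X.2.1, X.2.2.1, z)) X.2.2.2

/-- If `Lstar` is the formal adjoint of a linear operator `L`, this says that `g` is a function
that represents the distribution `L u` on `(-∞, T) × ℝ^{3d}`:
`(u, Lstar φ) = (g, φ)` for all test functions `φ`. -/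
def Represents {d : ℕ} (T : EReal) (Lstar : (Pt d → ℝ) → Pt d → ℝ) (u g : Pt d → ℝ) : Prop :=
  LocallyIntegrableOn g (slab d T) ∧
    ∀ φ : Pt d → ℝ, IsTest T φ →
      ∫ X in slab d T, u X * Lstar φ X = ∫ X in slab d T, g X * φ X

/-- `G = ∇_x u` in the sense of distributions. -/
def IsGradX {d : ℕ} (T : EReal) (u : Pt d → ℝ) (G : Pt d → Vec d) : Prop :=
  ∀ i, Represents T (fun φ X => -dx i φ X) u (fun X => G X i)

/-- `H = ∇_x² u` in the sense of distributions. The norm of the value of `H` is the Frobenius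
norm of the Hessian matrix. -/
def IsHessX {d : ℕ} (T : EReal) (u : Pt d → ℝ)
    (H : Pt d → EuclideanSpace ℝ (Fin d × Fin d)) : Prop :=
  ∀ i j, Represents T (fun φ => dx i (dx j φ)) u (fun X => H X (i, j))

/-- `Y = ∂_t u - x · ∇_y u - y · ∇_z u` in the sense of distributions. The vector field
`(1, 0, -x, -y)` is divergence free, so the formal adjoint is the negative. -/
def IsTransport {d : ℕ} (T : EReal) (u Y : Pt d → ℝ) : Prop :=
  Represents T (fun φ X => -transport φ X) u Y

/-- `g = (-Δ_y)^s u` in the sense of distributions. -/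
def IsFracLapY {d : ℕ} (T : EReal) (s : ℝ) (u g : Pt d → ℝ) : Prop :=
  Represents T (fracLapY s) u g

/-- `g = (-Δ_z)^s u` in the sense of distributions. -/
def IsFracLapZ {d : ℕ} (T : EReal) (s : ℝ) (u g : Pt d → ℝ) : Prop :=
  Represents T (fracLapZ s) u g

/-- `G = ∇_x (-Δ_y)^s u` in the sense of distributions. -/
def IsGradXFracLapY {d : ℕ} (T : EReal) (s : ℝ) (u : Pt d → ℝ) (G : Pt d → Vec d) : Prop :=
  ∀ i, Represents T (fun φ X => -fracLapY s (dx i φ) X) u (fun X => G X i)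

/-- `u ∈ S^p((-∞, T) × ℝ^{3d})`, where `G = ∇_x u`, `H = ∇_x² u` and
`Y = ∂_t u - x · ∇_y u - y · ∇_z u` are its distributional derivatives. By uniqueness of
distributional derivatives `G`, `H`, `Y` are determined by `u` almost everywhere. -/
structure MemS {d : ℕ} (p : ℝ≥0∞) (T : EReal) (u : Pt d → ℝ) (G : Pt d → Vec d)
    (H : Pt d → EuclideanSpace ℝ (Fin d × Fin d)) (Y : Pt d → ℝ) : Prop where
  memLp : MemLp u p (slabMeasure d T)
  memLp_gradX : MemLp G p (slabMeasure d T)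
  memLp_hessX : MemLp H p (slabMeasure d T)
  memLp_transport : MemLp Y p (slabMeasure d T)
  isGradX : IsGradX T u G
  isHessX : IsHessX T u H
  isTransport : IsTransport T u Y

/-- Bounded measurable coefficients `a^{ij}(t)` that are uniformly elliptic with constant `δ`. -/
structure IsCoeff {d : ℕ} (δ : ℝ) (a : ℝ → Matrix (Fin d) (Fin d) ℝ) : Prop where
  measurable : ∀ i j, AEMeasurable (fun t => a t i j) volume
  bounded : ∃ K : ℝ, ∀ t i j, |a t i j| ≤ K
  lower : ∀ (t : ℝ) (ξ : Vec d), δ * ‖ξ‖ ^ 2 ≤ ∑ i, ∑ j, a t i j * ξ i * ξ j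
  upper : ∀ (t : ℝ) (ξ : Vec d), ∑ i, ∑ j, a t i j * ξ i * ξ j ≤ δ⁻¹ * ‖ξ‖ ^ 2

/-- `P₀ u = ∂_t u - x · ∇_y u - y · ∇_z u - ∑ a^{ij}(t) ∂_{x_i x_j} u`, in terms of
`H = ∇_x² u` and `Y = ∂_t u - x · ∇_y u - y · ∇_z u`. -/
def P₀ {d : ℕ} (a : ℝ → Matrix (Fin d) (Fin d) ℝ)
    (H : Pt d → EuclideanSpace ℝ (Fin d × Fin d)) (Y : Pt d → ℝ) (X : Pt d) : ℝ :=
  Y X - ∑ i, ∑ j, a X.1 i j * H X (i, j)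

/-- The norm of `L²((-∞, T) × ℝ^{3d})`. -/
def norm2 {d : ℕ} {F : Type*} [NormedAddCommGroup F] (T : EReal) (f : Pt d → F) : ℝ≥0∞ :=
  eLpNorm f 2 (slabMeasure d T)

end

end KFP

open MeasureTheory
open scoped ENNReal NNReal ContDiff

namespace KFP

noncomputable section

open Set Filter Topology
open scoped FourierTransform SchwartzMap

/-! ### Energy inequalities on half-lines -/

/-! In the coordinates carried along by the flow of `∂_t - x·∇_y - y·∇_z` (`shear`), which preserves
Lebesgue measure and time slices, the transport term is the plain time derivative. The coefficients
depend on `t` alone, so a Fourier transform in the three space variables turns the equation, for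
almost every frequency `(ξ, η, ζ)`, into a scalar equation `v' + b v = f` on `(-∞, T)`. Here `p(t) =
ξ + tη + t²ζ/2` and `b = 4π² ∑ a^{ij} p_i p_j + λ ≥ δ|p|² + λ`. Derivatives in `x`, `y`, `z` become,
up to constants, multiplications by `p`, `p'`, `p''`. By Plancherel the theorem reduces to `∫ (m v)²
≤ C ∫ f²` with `m = |p|² + (|p'|² + |p''|^{6/5})^{1/3}` and `C` depending only on `δ`, together with
`∫ (λ v)² ≤ ∫ f²`. Indeed `m` dominates `|p|²`, `|p'|^{2/3}`, `|p''|^{2/5}` and `|p'|^{1/3}|p|`. The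
damping controls `|p|²` only, which may vanish at some times. But `p` cannot stay small for long
while `p'` or `p''` is large, and this is made quantitative by a bounded function `g` with `2δ|p|² +
g' ≥ δ m / 4` (`exists_bounded_multiplier`), a sum of two arctangents. The energy identity for
`e^{-g} v²` then gains `m`. A second weight `M`, comparable to `m` and with `M' ≤ (δ/8) m M`
(`exists_slow_weight`), upgrades the gain to `m²`. `ode_weighted_estimate` runs the two stages in
this order, because finiteness of `∫ m v²` is what makes `M v²` small along a sequence tending to
`-∞`. The passage from distributions to the equation for almost every frequency is `pft_weak_deriv`
and `pft_weak_time_deriv`. For the fractional Laplacians the exact symbol is never computed: an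
upper bound by a multiple of `|q|^{2s}` (`norm_diffSymbol_le`) shows that the distribution is
bounded on test functions in the norm of `L²`, and Riesz representation (`exists_memLp_of_bounded`)
produces the function. -/

theorem weighted_energy_le {v F W W' k : ℝ → ℝ} {s t : ℝ} (hst : s ≤ t)
    (hF : IntervalIntegrable F volume s t)
    (hv : ∀ x ∈ Icc s t, v x = v s + ∫ τ in s..x, F τ)
    (hW : ∀ x, HasDerivAt W (W' x) x) (hW' : Continuous W')
    (hk : IntervalIntegrable k volume s t)
    (h : ∀ᵐ x, x ∈ Icc s t → W' x * v x ^ 2 + 2 * W x * v x * F x ≤ k x) :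
    W t * v t ^ 2 ≤ W s * v s ^ 2 + ∫ x in s..t, k x := by
  have hIcc : uIcc s t = Icc s t := uIcc_of_le hst
  set V : ℝ → ℝ := fun x => v s + ∫ τ in s..x, F τ with hV
  have hVac : AbsolutelyContinuousOnInterval V s t := by
    have h1 := hF.absolutelyContinuousOnInterval_intervalIntegral (c := s) (by simp)
    have h2 : AbsolutelyContinuousOnInterval (fun _ : ℝ => v s) s t :=
      (contDiff_const (n := 1)).contDiffOn.absolutelyContinuousOnInterval
    exact h2.add h1
  have hWac : AbsolutelyContinuousOnInterval W s t := by
    have : ContDiff ℝ 1 W := by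
      rw [contDiff_one_iff_deriv]
      refine ⟨fun x => (hW x).differentiableAt, ?_⟩
      have : deriv W = W' := funext fun x => (hW x).deriv
      rwa [this]
    exact this.contDiffOn.absolutelyContinuousOnInterval
  -- `v` is only absolutely continuous, so the fundamental theorem of calculus is applied to `W V²`
  -- through its almost everywhere derivative.
  have hac := hWac.fun_mul (hVac.fun_mul hVac)
  have key := hac.integral_deriv_eq_sub
  have hle : ∫ x in s..t, deriv (fun x => W x * (V x * V x)) x ≤ ∫ x in s..t, k x := by
    apply intervalIntegral.integral_mono_ae_restrict hst hac.intervalIntegrable_deriv hk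
    rw [EventuallyLE, ae_restrict_iff' measurableSet_Icc]
    filter_upwards [h, hF.ae_hasDerivAt_integral] with x hx1 hx2 hx
    have hd : HasDerivAt V (F x) x := by
      have := hx2 (hIcc ▸ hx) s (by simp)
      simpa [hV] using this.const_add (v s)
    have hd2 := (hW x).fun_mul (hd.fun_mul hd)
    rw [hd2.deriv]
    have hvx : v x = V x := hv x hx
    have := hx1 hx
    rw [hvx] at this
    linarith
  have e1 : v t = V t := hv t (right_mem_Icc.2 hst)
  have e2 : v s = V s := by simp [hV]
  rw [e1, e2]
  nlinarith [key, hle]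

/-- `J` is a countable directed union of intervals `(q - n, q]` with `q` rational in `J`, so
monotone convergence passes the bound to `J`. -/
theorem setLIntegral_le_of_forall_Ioc {J : Set ℝ} (hJo : IsOpen J)
    (hJ : ∀ t ∈ J, Iic t ⊆ J) {h : ℝ → ℝ≥0∞} {K : ℝ≥0∞}
    (hK : ∀ s ∈ J, ∀ t ∈ J, s ≤ t → ∫⁻ x in Ioc s t, h x ≤ K) :
    ∫⁻ x in J, h x ≤ K := by
  let ι := {q : ℚ // (q : ℝ) ∈ J} × ℕ
  let S : ι → Set ℝ := fun i => Ioc ((i.1.1 : ℝ) - i.2) i.1.1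
  have hU : J = ⋃ i, S i := by
    ext x
    simp only [mem_iUnion]
    constructor
    · intro hx
      obtain ⟨ε, hε, hball⟩ := Metric.isOpen_iff.1 hJo x hx
      obtain ⟨q, hq1, hq2⟩ := exists_rat_btwn (show x < x + ε by linarith)
      have hqJ : (q : ℝ) ∈ J := hball (by
        rw [Metric.mem_ball, Real.dist_eq, abs_lt]; constructor <;> linarith)
      obtain ⟨n, hn⟩ := exists_nat_gt ((q : ℝ) - x)
      exact ⟨⟨⟨q, hqJ⟩, n⟩, by simp only [S, mem_Ioc]; constructor <;> linarith⟩
    · rintro ⟨⟨⟨q, hq⟩, n⟩, hx⟩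
      exact hJ q hq hx.2
  have hdir : Directed (· ⊆ ·) S := by
    rintro ⟨⟨q, hq⟩, n⟩ ⟨⟨q', hq'⟩, n'⟩
    have hm : ((max q q' : ℚ) : ℝ) ∈ J := by
      rcases max_choice q q' with h | h <;> rw [h] <;> assumption
    obtain ⟨N, hN⟩ := exists_nat_gt (max (((max q q' : ℚ) : ℝ) - (q - n)) (((max q q' : ℚ) : ℝ) - (q' - n')))
    have h1 : (q : ℝ) ≤ ((max q q' : ℚ) : ℝ) := by exact_mod_cast le_max_left q q'
    have h2 : (q' : ℝ) ≤ ((max q q' : ℚ) : ℝ) := by exact_mod_cast le_max_right q q'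
    refine ⟨⟨⟨max q q', hm⟩, N⟩, ?_, ?_⟩
    · apply Ioc_subset_Ioc _ h1
      have := (le_max_left _ _).trans_lt hN
      linarith
    · apply Ioc_subset_Ioc _ h2
      have := (le_max_right _ _).trans_lt hN
      linarith
  rw [hU, setLIntegral_iUnion_of_directed _ hdir]
  refine iSup_le fun ⟨⟨q, hq⟩, n⟩ => ?_
  refine hK _ (hJ q hq (by simp)) _ hq (by simp)

/-- If `v' = F` on a left half-line `J`, if `(W v²)' ≤ k - h` and `W v²` comes arbitrarily close
to zero at `-∞`, then the integral of `h` is at most that of `k`. -/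
theorem lintegral_le_of_energy {J : Set ℝ} (hJo : IsOpen J) (hJ : ∀ t ∈ J, Iic t ⊆ J)
    {v F W W' h k : ℝ → ℝ}
    (hF : ∀ s ∈ J, ∀ t ∈ J, IntervalIntegrable F volume s t)
    (hv : ∀ s ∈ J, ∀ t ∈ J, v t = v s + ∫ τ in s..t, F τ)
    (hW : ∀ x, HasDerivAt W (W' x) x) (hW' : Continuous W') (hWpos : ∀ x, 0 ≤ W x)
    (hh : ContinuousOn h J) (hh0 : ∀ x ∈ J, 0 ≤ h x)
    (hk : IntegrableOn k J) (hk0 : ∀ x, 0 ≤ k x)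
    (hle : ∀ᵐ x, x ∈ J → W' x * v x ^ 2 + 2 * W x * v x * F x ≤ k x - h x)
    (hlim : ∀ s₀ ∈ J, ∀ ε > 0, ∃ s ≤ s₀, W s * v s ^ 2 ≤ ε) :
    ∫⁻ x in J, ENNReal.ofReal (h x) ≤ ∫⁻ x in J, ENNReal.ofReal (k x) := by
  apply setLIntegral_le_of_forall_Ioc hJo hJ
  intro s₀ hs₀ t ht hst
  refine ENNReal.le_of_forall_pos_le_add fun ε hε _ => ?_
  obtain ⟨s, hss, hsε⟩ := hlim s₀ hs₀ ε (by exact_mod_cast hε)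
  have hs : s ∈ J := hJ s₀ hs₀ hss
  have hst' : s ≤ t := hss.trans hst
  have hsub : Icc s t ⊆ J := fun x hx => hJ t ht hx.2
  have hkI : IntervalIntegrable k volume s t :=
    (intervalIntegrable_iff_integrableOn_Icc_of_le hst').2 (hk.mono_set hsub)
  have hhI : IntervalIntegrable h volume s t :=
    (hh.mono (by rwa [uIcc_of_le hst'])).intervalIntegrable
  have key := weighted_energy_le hst' (hF s hs t ht)
    (fun x hx => hv s hs x (hsub hx)) hW hW' (hkI.sub hhI)
    (by filter_upwards [hle] with x hx hxI using hx (hsub hxI))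
  rw [intervalIntegral.integral_sub hkI hhI] at key
  have hpos : 0 ≤ W t * v t ^ 2 := mul_nonneg (hWpos t) (sq_nonneg _)
  have key2 : ∫ x in s..t, h x ≤ ε + ∫ x in s..t, k x := by linarith
  rw [intervalIntegral.integral_of_le hst', intervalIntegral.integral_of_le hst'] at key2
  have hIoc : Ioc s t ⊆ J := Ioc_subset_Icc_self.trans hsub
  calc ∫⁻ x in Ioc s₀ t, ENNReal.ofReal (h x)
      ≤ ∫⁻ x in Ioc s t, ENNReal.ofReal (h x) :=
        lintegral_mono_set (Ioc_subset_Ioc_left hss)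
    _ = ENNReal.ofReal (∫ x in Ioc s t, h x) := by
        rw [ofReal_integral_eq_lintegral_ofReal]
        · exact hhI.1
        · rw [EventuallyLE, ae_restrict_iff' measurableSet_Ioc]
          exact Eventually.of_forall fun x hx => hh0 x (hIoc hx)
    _ ≤ ENNReal.ofReal (ε + ∫ x in Ioc s t, k x) := ENNReal.ofReal_le_ofReal key2
    _ ≤ ENNReal.ofReal (∫ x in Ioc s t, k x) + ε := by
        rw [add_comm]
        refine ENNReal.ofReal_add_le.trans ?_
        simp
    _ ≤ _ := by
        gcongr
        rw [ofReal_integral_eq_lintegral_ofReal hkI.1 (Eventually.of_forall hk0)]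
        exact lintegral_mono_set hIoc

/-- Otherwise `w > ε` on a half-line, which has infinite length. This supplies the vanishing
boundary terms at `-∞`. -/
theorem exists_le_of_integrableOn {J : Set ℝ} (hJ : ∀ t ∈ J, Iic t ⊆ J) {w : ℝ → ℝ}
    (hw : ∫⁻ x in J, ENNReal.ofReal (w x) < ⊤) {s₀ : ℝ} (hs₀ : s₀ ∈ J) {ε : ℝ} (hε : 0 < ε) :
    ∃ s ≤ s₀, w s ≤ ε := by
  by_contra! hcon
  have h1 : ∫⁻ x in Iic s₀, ENNReal.ofReal ε ≤ ∫⁻ x in J, ENNReal.ofReal (w x) :=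
    (setLIntegral_mono' measurableSet_Iic
      (fun x hx => ENNReal.ofReal_le_ofReal (hcon x hx).le)).trans (lintegral_mono_set (hJ s₀ hs₀))
  rw [setLIntegral_const, Real.volume_Iic, ENNReal.mul_top (by simpa using hε)] at h1
  exact absurd (h1.trans_lt hw) (by simp)

/-! ### Multipliers for quadratic curves -/

/-- The lower bound for the derivative of the quotient `p·p' / ρ²`. -/
theorem quotient_deriv_lower {x r s ρ A B D : ℝ} (hx : 0 ≤ x) (hs : 0 < s)
    (hρ : 0 < ρ) (hρ3 : ρ ^ 3 = r ^ 2 + s ^ 6) (hsρ : s ^ 2 ≤ ρ) (hA : |A| ≤ x * r)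
    (hB : |B| ≤ x * s ^ 5) (hD : |D| ≤ r * s ^ 5) :
    ρ - s ^ 2 - 3 * x * s ≤ (r ^ 2 + B) / ρ ^ 2 - 2 * A * (2 * D / (3 * ρ ^ 2)) / ρ ^ 3 := by
  -- Here `x = |p|`, `r = |p'|`, `s⁵ = |p''|`, `A = p·p'`, `B = p·p''`, `D = p'·p''` and `ρ' =
  -- 2D/(3ρ²)`, so the right side is the derivative of `p·p'/ρ²`. Its main term is `r²/ρ² = ρ -
  -- s⁶/ρ² ≥ ρ - s²`; the two error terms cost `x s` and `2 x s`.
  have hs2 : s ^ 4 ≤ ρ ^ 2 := by nlinarith [sq_nonneg s, sq_nonneg (s ^ 2)]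
  have h1 : ρ - s ^ 2 ≤ r ^ 2 / ρ ^ 2 := by
    rw [le_div_iff₀ (by positivity)]
    have : s ^ 6 ≤ s ^ 2 * ρ ^ 2 := by nlinarith [sq_nonneg s]
    nlinarith
  have h2 : -(x * s) ≤ B / ρ ^ 2 := by
    rw [le_div_iff₀ (by positivity)]
    have := (abs_le.1 hB).1
    have : x * s ^ 5 ≤ x * s * ρ ^ 2 := by
      have := mul_le_mul_of_nonneg_left hs2 (mul_nonneg hx hs.le)
      nlinarith
    linarith
  have h3 : 2 * A * (2 * D / (3 * ρ ^ 2)) / ρ ^ 3 ≤ 2 * x * s := by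
    have e : 2 * A * (2 * D / (3 * ρ ^ 2)) / ρ ^ 3 = (4 * (A * D)) / (3 * ρ ^ 5) := by
      field_simp; ring
    rw [e, div_le_iff₀ (by positivity)]
    have hAD : A * D ≤ x * r * (r * s ^ 5) :=
      (le_abs_self _).trans (by
        rw [abs_mul]
        exact mul_le_mul hA hD (abs_nonneg _) ((abs_nonneg _).trans hA))
    have hr : r ^ 2 ≤ ρ ^ 3 := by
      rw [hρ3]; nlinarith [pow_pos hs 6]
    have h5 : x * r * (r * s ^ 5) ≤ x * s * ρ ^ 5 := by
      have a1 : r ^ 2 * s ^ 4 ≤ ρ ^ 3 * ρ ^ 2 :=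
        mul_le_mul hr hs2 (by positivity) (by positivity)
      have := mul_le_mul_of_nonneg_left a1 (mul_nonneg hx hs.le)
      nlinarith
    have : 0 ≤ x * s * ρ ^ 5 := by positivity
    nlinarith
  rw [add_div]
  linarith

/-- The pointwise lower bound for the derivative of the bounded multiplier. -/
theorem multiplier_lower {δ x r s ρ A D Q : ℝ} (hδ : 0 < δ) (hx : 0 ≤ x) (hs : 0 < s)
    (hρ : 0 < ρ) (hρ3 : ρ ^ 3 = r ^ 2 + s ^ 6) (hA : |A| ≤ x * r) (hD : |D| ≤ r * s ^ 5)
    (hQ : ρ - s ^ 2 - 3 * x * s ≤ Q) :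
    δ / 4 * (x ^ 2 + ρ) ≤ 2 * δ * x ^ 2 + (δ * (Q / (1 + (A / ρ ^ 2) ^ 2)) +
      2048 * δ * (s ^ 2 / (1 + (D / s ^ 8) ^ 2))) := by
  -- The arctangent divides the derivative by `1 + A²/ρ⁴ ≤ 1 + x²/ρ`. The gain drops from `ρ` to
  -- `ρ²/(ρ + x²)`, a loss only where `x²` is already large; `h2` recovers `x² + ρ` with the help of
  -- the damping.
  have h1 : ρ ^ 2 / (ρ + x ^ 2) - s ^ 2 - 3 * x * s ≤ Q / (1 + (A / ρ ^ 2) ^ 2) := by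
    have hden : 1 + (A / ρ ^ 2) ^ 2 ≤ (ρ + x ^ 2) / ρ := by
      have hA2 : A ^ 2 ≤ x ^ 2 * r ^ 2 := by
        rw [← mul_pow, ← sq_abs A]; exact pow_le_pow_left₀ (abs_nonneg _) hA 2
      have : A ^ 2 ≤ x ^ 2 * ρ ^ 3 := hA2.trans (by
        rw [hρ3]; nlinarith [mul_nonneg (sq_nonneg x) (pow_pos hs 6).le])
      rw [div_pow, add_div, div_self hρ.ne']
      refine add_le_add le_rfl ?_
      rw [div_le_div_iff₀ (by positivity) hρ]
      nlinarith
    have hE : (1:ℝ) ≤ 1 + (A / ρ ^ 2) ^ 2 := by nlinarith [sq_nonneg (A / ρ ^ 2)]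
    have hE0 : (0:ℝ) < 1 + (A / ρ ^ 2) ^ 2 := by linarith
    have a1 : ρ ^ 2 / (ρ + x ^ 2) ≤ ρ / (1 + (A / ρ ^ 2) ^ 2) := by
      rw [div_le_div_iff₀ (by positivity) hE0]
      have := mul_le_mul_of_nonneg_left hden (sq_nonneg ρ)
      calc ρ ^ 2 * (1 + (A / ρ ^ 2) ^ 2) ≤ ρ ^ 2 * ((ρ + x ^ 2) / ρ) := this
        _ = ρ * (ρ + x ^ 2) := by field_simp
    have a2 : (s ^ 2 + 3 * x * s) / (1 + (A / ρ ^ 2) ^ 2) ≤ s ^ 2 + 3 * x * s :=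
      div_le_self (by positivity) hE
    have a3 : (ρ - s ^ 2 - 3 * x * s) / (1 + (A / ρ ^ 2) ^ 2) ≤ Q / (1 + (A / ρ ^ 2) ^ 2) :=
      div_le_div_of_nonneg_right hQ hE0.le
    have a4 : (ρ - s ^ 2 - 3 * x * s) / (1 + (A / ρ ^ 2) ^ 2) =
      ρ / (1 + (A / ρ ^ 2) ^ 2) - (s ^ 2 + 3 * x * s) / (1 + (A / ρ ^ 2) ^ 2) := by
      rw [← sub_div]; ring_nf
    linarith
  have h2 : (3 / 4) * (x ^ 2 + ρ) ≤ x ^ 2 + ρ ^ 2 / (ρ + x ^ 2) := by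
    have : x ^ 2 + ρ ^ 2 / (ρ + x ^ 2) = (x ^ 2 * (ρ + x ^ 2) + ρ ^ 2) / (ρ + x ^ 2) := by
      field_simp
    rw [this, le_div_iff₀ (by positivity)]
    nlinarith [sq_nonneg (x ^ 2 - ρ)]
  -- Since `(p'·p'')' = s¹⁰`, the quotient `D/s⁸` has derivative `s²`. This second arctangent gains
  -- where `p''` dominates `p'`, exactly where the error `s²` of the first is not small against `ρ`.
  have h3 : s ^ 8 / ρ ^ 3 ≤ s ^ 2 / (1 + (D / s ^ 8) ^ 2) := by
    rw [div_le_div_iff₀ (by positivity) (by positivity)]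
    have hD2 : D ^ 2 ≤ r ^ 2 * s ^ 10 := by
      have : r ^ 2 * s ^ 10 = (r * s ^ 5) ^ 2 := by ring
      rw [this, ← sq_abs D]; exact pow_le_pow_left₀ (abs_nonneg _) hD 2
    have e : s ^ 8 * (1 + (D / s ^ 8) ^ 2) = s ^ 8 + D ^ 2 / s ^ 8 := by
      field_simp
    rw [e, hρ3, mul_add, add_comm]
    have : D ^ 2 / s ^ 8 ≤ s ^ 2 * r ^ 2 := by
      rw [div_le_iff₀ (by positivity)]; nlinarith
    nlinarith
  -- The errors `s² + 3xs` amount to at most `x² + 4s²`. If `8s² ≤ ρ`, then `ρ/2` absorbs `4s²`;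
  -- otherwise `ρ³ < 8³ s⁶`, and `2048 = 4·8³` does it.
  have h4 : 4 * s ^ 2 ≤ ρ / 2 + 2048 * (s ^ 8 / ρ ^ 3) := by
    by_cases hy : 8 * s ^ 2 ≤ ρ
    · have : 0 ≤ s ^ 8 / ρ ^ 3 := by positivity
      linarith
    · push Not at hy
      have : 4 * s ^ 2 ≤ 2048 * (s ^ 8 / ρ ^ 3) := by
        rw [← mul_div_assoc, le_div_iff₀ (by positivity)]
        have h8 : ρ ^ 3 ≤ (8 * s ^ 2) ^ 3 := pow_le_pow_left₀ hρ.le hy.le 3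
        have := mul_le_mul_of_nonneg_left h8 (show 0 ≤ 4 * s ^ 2 by positivity)
        nlinarith
      linarith
  have h5 : 3 * x * s ≤ x ^ 2 + 3 * s ^ 2 := by nlinarith [sq_nonneg (x - 3 / 2 * s), sq_nonneg s]
  have h6 : δ * (ρ ^ 2 / (ρ + x ^ 2) - s ^ 2 - 3 * x * s) ≤ δ * (Q / (1 + (A / ρ ^ 2) ^ 2)) :=
    mul_le_mul_of_nonneg_left h1 hδ.le
  have h7 : δ * (s ^ 8 / ρ ^ 3) ≤ δ * (s ^ 2 / (1 + (D / s ^ 8) ^ 2)) :=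
    mul_le_mul_of_nonneg_left h3 hδ.le
  have h8 : 0 ≤ δ * (x ^ 2 + ρ ^ 2 / (ρ + x ^ 2) - (3 / 4) * (x ^ 2 + ρ)) :=
    mul_nonneg hδ.le (by linarith)
  have h9 : 0 ≤ δ * (ρ / 2 + 2048 * (s ^ 8 / ρ ^ 3) - 4 * s ^ 2) := mul_nonneg hδ.le (by linarith)
  have h10 : 0 ≤ δ * (x ^ 2 + 3 * s ^ 2 - 3 * x * s) := mul_nonneg hδ.le (by linarith)
  have h11 : 0 ≤ δ * x ^ 2 := by positivity
  nlinarith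

/-- The weight `x² + ℓ² σ` varies slowly. -/
theorem weight_deriv_le {ℓ x r s ρ σ A D : ℝ} (hℓ : 1 ≤ ℓ) (hs : 0 < s) (hρ : 0 < ρ) (hρ3 : ρ ^ 3 = r ^ 2 + s ^ 6) (hσ : 0 < σ)
    (hσ3 : σ ^ 3 = r ^ 2 + ℓ ^ 3 * s ^ 6) (hA : |A| ≤ x * r) (hD : |D| ≤ r * s ^ 5) :
    2 * A + ℓ ^ 2 * (2 * D / (3 * σ ^ 2)) ≤
      2 / ℓ * ((x ^ 2 + ρ) * (x ^ 2 + ℓ ^ 2 * σ)) := by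
  have hℓ0 : 0 < ℓ := by linarith
  have hsρ : s ^ 2 ≤ ρ := by
    refine le_of_pow_le_pow_left₀ (n := 3) (by norm_num) hρ.le ?_
    rw [hρ3]; nlinarith [sq_nonneg r]
  have hsσ : ℓ * s ^ 2 ≤ σ := by
    refine le_of_pow_le_pow_left₀ (n := 3) (by norm_num) hσ.le ?_
    rw [hσ3]; nlinarith [sq_nonneg r]
  have hρσ : ρ ≤ σ := by
    refine le_of_pow_le_pow_left₀ (n := 3) (by norm_num) hσ.le ?_
    rw [hσ3, hρ3]
    have : 1 ≤ ℓ ^ 3 := one_le_pow₀ hℓ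
    nlinarith [pow_pos hs 6]
  -- `2xr ≤ 2xρ√σ`, and `2ℓx√σ ≤ x² + ℓ²σ` by the arithmetic-geometric inequality; the factor `ℓ²`
  -- in the weight is what yields `1/ℓ`.
  have h1 : 2 * A ≤ 1 / ℓ * ((x ^ 2 + ρ) * (x ^ 2 + ℓ ^ 2 * σ)) := by
    have hA' : A ≤ x * r := (le_abs_self _).trans hA
    have hxr : (2 * (x * r)) ^ 2 ≤ (1 / ℓ * ((x ^ 2 + ρ) * (x ^ 2 + ℓ ^ 2 * σ))) ^ 2 := by
      have b1 : ρ ^ 2 ≤ (x ^ 2 + ρ) ^ 2 := by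
        apply pow_le_pow_left₀ hρ.le; nlinarith
      have b2 : 4 * ℓ ^ 2 * x ^ 2 * σ ≤ (x ^ 2 + ℓ ^ 2 * σ) ^ 2 := by
        nlinarith [sq_nonneg (x ^ 2 - ℓ ^ 2 * σ)]
      have b3 : r ^ 2 ≤ ρ ^ 2 * σ := by
        have : ρ ^ 3 ≤ ρ ^ 2 * σ := by nlinarith [sq_nonneg ρ]
        have : r ^ 2 ≤ ρ ^ 3 := by rw [hρ3]; nlinarith [pow_pos hs 6]
        linarith
      have b4 := mul_le_mul b1 b2 (by positivity) (by positivity)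
      calc (2 * (x * r)) ^ 2 = 4 * x ^ 2 * r ^ 2 := by ring
        _ ≤ 4 * x ^ 2 * (ρ ^ 2 * σ) := by gcongr
        _ = (1 / ℓ) ^ 2 * (ρ ^ 2 * (4 * ℓ ^ 2 * x ^ 2 * σ)) := by field_simp
        _ ≤ (1 / ℓ) ^ 2 * ((x ^ 2 + ρ) ^ 2 * (x ^ 2 + ℓ ^ 2 * σ) ^ 2) := by gcongr
        _ = _ := by ring
    have := le_of_pow_le_pow_left₀ (n := 2) (by norm_num) (by positivity) hxr
    linarith
  have h2 : ℓ ^ 2 * (2 * D / (3 * σ ^ 2)) ≤ 1 / ℓ * ((x ^ 2 + ρ) * (x ^ 2 + ℓ ^ 2 * σ)) := by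
    have hD' : D ≤ r * s ^ 5 := (le_abs_self _).trans hD
    have c1 : 2 * D / (3 * σ ^ 2) ≤ s ^ 4 := by
      rw [div_le_iff₀ (by positivity)]
      have : r * s ^ 5 ≤ s ^ 4 * σ ^ 2 := by
        have : r * s ≤ σ ^ 2 := by
          refine le_of_pow_le_pow_left₀ (n := 2) (by norm_num) (by positivity) ?_
          have hrσ : r ^ 2 ≤ σ ^ 3 := by rw [hσ3]; nlinarith [show 0 < ℓ ^ 3 * s ^ 6 by positivity]
          have : s ^ 2 ≤ σ := hsρ.trans hρσ
          calc (r * s) ^ 2 = r ^ 2 * s ^ 2 := by ring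
            _ ≤ σ ^ 3 * σ := by gcongr
            _ = (σ ^ 2) ^ 2 := by ring
        nlinarith [pow_pos hs 4]
      nlinarith [pow_pos hs 4, sq_nonneg σ, mul_pos (pow_pos hs 4) (pow_pos hσ 2)]
    -- The factor `ℓ³` inside `σ³` gives `ℓ s² ≤ σ`, which again yields `1/ℓ`.
    calc ℓ ^ 2 * (2 * D / (3 * σ ^ 2)) ≤ ℓ ^ 2 * s ^ 4 := by gcongr
      _ = 1 / ℓ * (s ^ 2 * (ℓ ^ 2 * (ℓ * s ^ 2))) := by field_simp
      _ ≤ 1 / ℓ * ((x ^ 2 + ρ) * (x ^ 2 + ℓ ^ 2 * σ)) := by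
        gcongr
        · nlinarith
        · nlinarith [mul_le_mul_of_nonneg_left hsσ (sq_nonneg ℓ)]
  have : 2 / ℓ * ((x ^ 2 + ρ) * (x ^ 2 + ℓ ^ 2 * σ)) =
    1 / ℓ * ((x ^ 2 + ρ) * (x ^ 2 + ℓ ^ 2 * σ)) + 1 / ℓ * ((x ^ 2 + ρ) * (x ^ 2 + ℓ ^ 2 * σ)) := by
    ring
  linarith

/-- The quadratic curve `ξ + t η + t²/2 ζ`. -/
def curve {V : Type*} [AddCommGroup V] [Module ℝ V] (ξ η ζ : V) (t : ℝ) : V :=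
  ξ + t • η + (t ^ 2 / 2) • ζ

/-- The velocity `η + t ζ` of the quadratic curve. -/
def velocity {V : Type*} [AddCommGroup V] [Module ℝ V] (η ζ : V) (t : ℝ) : V := η + t • ζ

/-- `ρ = (‖p'‖² + ‖p''‖^{6/5})^{1/3}` along the quadratic curve `p`. -/
def curveRho {V : Type*} [NormedAddCommGroup V] [NormedSpace ℝ V] (η ζ : V) (t : ℝ) : ℝ :=
  (‖velocity η ζ t‖ ^ 2 + (‖ζ‖ ^ (1 / 5 : ℝ)) ^ 6) ^ (1 / 3 : ℝ)

/-- The weight `‖p‖² + ρ` along the quadratic curve `p`. -/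
def curveWeight {V : Type*} [NormedAddCommGroup V] [NormedSpace ℝ V] (ξ η ζ : V) (t : ℝ) : ℝ :=
  ‖curve ξ η ζ t‖ ^ 2 + curveRho η ζ t

/-! ### Bounded multiplier, slowly varying weight and ODE estimates along a quadratic curve. -/

section

variable {V : Type*} [NormedAddCommGroup V] [InnerProductSpace ℝ V]

theorem hasDerivAt_curve (ξ η ζ : V) (t : ℝ) :
    HasDerivAt (curve ξ η ζ) (velocity η ζ t) t := by
  have h1 : HasDerivAt (fun t : ℝ => t • η) ((1 : ℝ) • η) t := (hasDerivAt_id t).smul_const η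
  have h2 : HasDerivAt (fun t : ℝ => (t ^ 2 / 2) • ζ) (t • ζ) t := by
    have h3 := ((hasDerivAt_pow 2 t).div_const 2).smul_const ζ
    convert h3 using 2
    simp
  have h4 := (h1.const_add ξ).add h2
  rw [one_smul] at h4
  exact h4

theorem hasDerivAt_velocity (η ζ : V) (t : ℝ) : HasDerivAt (velocity η ζ) ζ t := by
  have h1 : HasDerivAt (fun t : ℝ => t • ζ) ((1 : ℝ) • ζ) t := (hasDerivAt_id t).smul_const ζ
  have := h1.const_add η
  rw [one_smul] at this
  exact this

theorem continuous_curve (ξ η ζ : V) : Continuous (curve ξ η ζ) := by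
  unfold curve; fun_prop

theorem continuous_velocity (η ζ : V) : Continuous (velocity η ζ) := by
  unfold velocity; fun_prop

theorem cbrt_pow {X : ℝ} (hX : 0 ≤ X) : (X ^ (1 / 3 : ℝ)) ^ 3 = X := by
  rw [← Real.rpow_natCast, ← Real.rpow_mul hX]; norm_num

theorem hasDerivAt_cbrt {X : ℝ → ℝ} {X' t : ℝ} (hX : HasDerivAt X X' t) (h0 : 0 < X t) :
    HasDerivAt (fun τ => X τ ^ (1 / 3 : ℝ)) (X' / (3 * (X t ^ (1 / 3 : ℝ)) ^ 2)) t := by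
  have h := hX.rpow_const (p := 1 / 3) (Or.inl h0.ne')
  convert h using 1
  have e : (X t ^ (1 / 3 : ℝ)) ^ 2 = (X t) ^ (2 / 3 : ℝ) := by
    rw [← Real.rpow_natCast, ← Real.rpow_mul h0.le]; norm_num
  rw [e, show (1 / 3 - 1 : ℝ) = -(2 / 3) by norm_num, Real.rpow_neg h0.le]
  have : (X t) ^ (2 / 3 : ℝ) ≠ 0 := (Real.rpow_pos_of_pos h0 _).ne'
  field_simp

theorem hasDerivAt_normSq_velocity (η ζ : V) (t : ℝ) :
    HasDerivAt (fun τ => ‖velocity η ζ τ‖ ^ 2) (2 * inner ℝ (velocity η ζ t) ζ) t :=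
  (hasDerivAt_velocity η ζ t).norm_sq

theorem curveRho_pos (η : V) {ζ : V} (hζ : ζ ≠ 0) (t : ℝ) : 0 < curveRho η ζ t := by
  have : 0 < ‖ζ‖ := norm_pos_iff.2 hζ
  unfold curveRho; positivity

theorem curveRho_pow (η ζ : V) (t : ℝ) :
    curveRho η ζ t ^ 3 = ‖velocity η ζ t‖ ^ 2 + (‖ζ‖ ^ (1 / 5 : ℝ)) ^ 6 :=
  cbrt_pow (by positivity)

theorem continuous_curveRho (η ζ : V) : Continuous (curveRho η ζ) := by
  unfold curveRho
  have := continuous_velocity η ζ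
  exact (by fun_prop : Continuous fun t => ‖velocity η ζ t‖ ^ 2 + (‖ζ‖ ^ (1 / 5 : ℝ)) ^ 6).rpow_const
    (fun _ => Or.inr (by norm_num))

theorem continuous_curveWeight (ξ η ζ : V) : Continuous (curveWeight ξ η ζ) := by
  have h1 := continuous_curveRho η ζ
  have h2 := continuous_curve ξ η ζ
  unfold curveWeight; fun_prop

/-- The choice is `g = δ arctan(p·p'/ρ²) + 2048 δ arctan(p'·p''/s⁸)` with `s = |p''|^{1/5}`. The
quotients are invariant under the parabolic scaling in which `p`, `p'`, `p''` have weights 1, 3, 5,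
and `arctan` makes them bounded, so `e^{-g}` is harmless as a weight. The condition `ζ ≠ 0` keeps
both denominators positive. -/
theorem exists_bounded_multiplier {δ : ℝ} (hδ : 0 < δ) (hδ' : δ < 1) (ξ η : V) {ζ : V}
    (hζ : ζ ≠ 0) :
    ∃ g g' : ℝ → ℝ, (∀ t, HasDerivAt g (g' t) t) ∧ Continuous g' ∧ (∀ t, |g t| ≤ 4098) ∧
      ∀ t, δ / 4 * curveWeight ξ η ζ t ≤ 2 * δ * ‖curve ξ η ζ t‖ ^ 2 + g' t := by
  set s := ‖ζ‖ ^ (1 / 5 : ℝ) with hs_def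
  have hζ0 : 0 < ‖ζ‖ := norm_pos_iff.2 hζ
  have hs : 0 < s := by positivity
  have hs5 : s ^ 5 = ‖ζ‖ := by
    rw [hs_def, ← Real.rpow_natCast, ← Real.rpow_mul hζ0.le]; norm_num
  set p := curve ξ η ζ with hp
  set p1 := velocity η ζ with hp1
  set ρ := curveRho η ζ with hρd
  have hρpos : ∀ t, 0 < ρ t := curveRho_pos η hζ
  have hρ3 : ∀ t, ρ t ^ 3 = ‖p1 t‖ ^ 2 + s ^ 6 := curveRho_pow η ζ
  have hpc : Continuous p := continuous_curve ξ η ζ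
  have hp1c : Continuous p1 := continuous_velocity η ζ
  have hρc : Continuous ρ := continuous_curveRho η ζ
  have hρ' : ∀ t, HasDerivAt ρ (2 * inner ℝ (p1 t) ζ / (3 * ρ t ^ 2)) t := fun t =>
    hasDerivAt_cbrt ((hasDerivAt_normSq_velocity η ζ t).add_const _) (by positivity)
  let A : ℝ → ℝ := fun t => inner ℝ (p t) (p1 t)
  let D : ℝ → ℝ := fun t => inner ℝ (p1 t) ζ
  let B : ℝ → ℝ := fun t => inner ℝ (p t) ζ
  have hAd : ∀ t, HasDerivAt A (B t + ‖p1 t‖ ^ 2) t := fun t => by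
    have := (hasDerivAt_curve ξ η ζ t).inner ℝ (hasDerivAt_velocity η ζ t)
    rw [real_inner_self_eq_norm_sq] at this
    exact this
  have hDd : ∀ t, HasDerivAt D (s ^ 10) t := fun t => by
    have := (hasDerivAt_velocity η ζ t).inner ℝ (hasDerivAt_const t ζ)
    have e : s ^ 10 = inner ℝ ζ ζ := by
      rw [real_inner_self_eq_norm_sq, ← hs5]; ring
    rw [e]
    simpa using this
  let Q : ℝ → ℝ := fun t =>
    (‖p1 t‖ ^ 2 + B t) / ρ t ^ 2 - 2 * A t * (2 * D t / (3 * ρ t ^ 2)) / ρ t ^ 3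
  have hQd : ∀ t, HasDerivAt (fun t => A t / ρ t ^ 2) (Q t) t := fun t => by
    have h := (hAd t).fun_div ((hρ' t).fun_pow 2) (by have := hρpos t; positivity)
    refine h.congr_deriv ?_
    have := (hρpos t).ne'
    change _ = (‖p1 t‖ ^ 2 + B t) / ρ t ^ 2 - 2 * A t * (2 * D t / (3 * ρ t ^ 2)) / ρ t ^ 3
    change ((B t + ‖p1 t‖ ^ 2) * ρ t ^ 2 - A t * ((2 : ℕ) * ρ t ^ (2 - 1) * (2 * D t / (3 * ρ t ^ 2)))) /
      (ρ t ^ 2) ^ 2 = _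
    field_simp
    push_cast
    ring
  have hQ2 : ∀ t, HasDerivAt (fun t => D t / s ^ 8) (s ^ 2) t := fun t => by
    have h := (hDd t).div_const (s ^ 8)
    refine h.congr_deriv ?_
    field_simp
  have hAc : Continuous A := by simp only [A]; fun_prop
  have hBc : Continuous B := by simp only [B]; fun_prop
  have hDc : Continuous D := by simp only [D]; fun_prop
  have hQc : Continuous Q := by
    simp only [Q]
    have h1 : ∀ t, ρ t ≠ 0 := fun t => (hρpos t).ne'
    have h2 : ∀ t, ρ t ^ 2 ≠ 0 := fun t => pow_ne_zero _ (h1 t)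
    have h3 : ∀ t, ρ t ^ 3 ≠ 0 := fun t => pow_ne_zero _ (h1 t)
    have h4 : ∀ t, 3 * ρ t ^ 2 ≠ 0 := fun t => mul_ne_zero three_ne_zero (h2 t)
    fun_prop (disch := assumption)
  refine ⟨fun t => δ * Real.arctan (A t / ρ t ^ 2) + 2048 * δ * Real.arctan (D t / s ^ 8),
    fun t => δ * (Q t / (1 + (A t / ρ t ^ 2) ^ 2)) +
      2048 * δ * (s ^ 2 / (1 + (D t / s ^ 8) ^ 2)), ?_, ?_, ?_, ?_⟩
  · intro t
    have h1 := ((hQd t).arctan).const_mul δ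
    have h2 := ((hQ2 t).arctan).const_mul (2048 * δ)
    exact (h1.fun_add h2).congr_deriv (by ring)
  · have h1 : ∀ t, (1 + (A t / ρ t ^ 2) ^ 2) ≠ 0 := fun t => by positivity
    have h2 : ∀ t, (1 + (D t / s ^ 8) ^ 2) ≠ 0 := fun t => by positivity
    have h3 : ∀ t, ρ t ^ 2 ≠ 0 := fun t => pow_ne_zero _ (hρpos t).ne'
    have h4 : s ^ 8 ≠ 0 := by positivity
    fun_prop (disch := assumption)
  · intro t
    -- With `δ < 1` the sum of the two terms is at most `2 + 2·2048 = 4098`.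
    have hb : ∀ y, |Real.arctan y| ≤ 2 := fun y => by
      rw [abs_le]
      have h1 := Real.neg_pi_div_two_lt_arctan y
      have h2 := Real.arctan_lt_pi_div_two y
      have := Real.pi_le_four
      constructor <;> linarith
    have b1 := abs_le.1 (hb (A t / ρ t ^ 2))
    have b2 := abs_le.1 (hb (D t / s ^ 8))
    rw [abs_le]
    constructor <;> nlinarith
  · intro t
    have hA : |A t| ≤ ‖p t‖ * ‖p1 t‖ := abs_real_inner_le_norm _ _
    have hD : |D t| ≤ ‖p1 t‖ * s ^ 5 := by rw [hs5]; exact abs_real_inner_le_norm _ _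
    have hB : |B t| ≤ ‖p t‖ * s ^ 5 := by rw [hs5]; exact abs_real_inner_le_norm _ _
    have hsρ : s ^ 2 ≤ ρ t := by
      refine le_of_pow_le_pow_left₀ (n := 3) (by norm_num) (hρpos t).le ?_
      rw [hρ3]; nlinarith [sq_nonneg ‖p1 t‖]
    exact multiplier_lower hδ (norm_nonneg _) hs (hρpos t) (hρ3 t) hA hD
      (quotient_deriv_lower (norm_nonneg _) hs (hρpos t) (hρ3 t) hsρ hA hB hD)

/-- The weight `‖p‖² + ρ` itself may vary too fast. Replacing `ρ` by `ℓ²σ` with `σ³ = ‖p'‖² + ℓ³s⁶`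
lowers the logarithmic derivative to `(2/ℓ) m`, at the price of the factor `ℓ³` in the comparison.
The value `ℓ = 16/δ` makes `2/ℓ = δ/8`, half of the gain `δ/4` of the bounded multiplier. -/
theorem exists_slow_weight {δ : ℝ} (hδ : 0 < δ) (hδ' : δ < 1) (ξ η : V) {ζ : V} (hζ : ζ ≠ 0) :
    ∃ M M' : ℝ → ℝ, (∀ t, HasDerivAt M (M' t) t) ∧ Continuous M' ∧
      (∀ t, curveWeight ξ η ζ t ≤ M t) ∧ (∀ t, M t ≤ (16 / δ) ^ 3 * curveWeight ξ η ζ t) ∧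
      ∀ t, M' t ≤ δ / 8 * (curveWeight ξ η ζ t * M t) := by
  set s := ‖ζ‖ ^ (1 / 5 : ℝ) with hs_def
  have hζ0 : 0 < ‖ζ‖ := norm_pos_iff.2 hζ
  have hs : 0 < s := by positivity
  have hs5 : s ^ 5 = ‖ζ‖ := by
    rw [hs_def, ← Real.rpow_natCast, ← Real.rpow_mul hζ0.le]; norm_num
  set ℓ := 16 / δ with hℓd
  have hℓ : 1 ≤ ℓ := by rw [hℓd, le_div_iff₀ hδ]; linarith
  set p := curve ξ η ζ with hp
  set p1 := velocity η ζ with hp1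
  set ρ := curveRho η ζ with hρd
  have hρpos : ∀ t, 0 < ρ t := curveRho_pos η hζ
  have hρ3 : ∀ t, ρ t ^ 3 = ‖p1 t‖ ^ 2 + s ^ 6 := curveRho_pow η ζ
  have hpc : Continuous p := continuous_curve ξ η ζ
  have hp1c : Continuous p1 := continuous_velocity η ζ
  let σ : ℝ → ℝ := fun t => (‖p1 t‖ ^ 2 + ℓ ^ 3 * s ^ 6) ^ (1 / 3 : ℝ)
  have hσpos : ∀ t, 0 < σ t := fun t => by positivity
  have hσ3 : ∀ t, σ t ^ 3 = ‖p1 t‖ ^ 2 + ℓ ^ 3 * s ^ 6 := fun t => cbrt_pow (by positivity)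
  have hσ' : ∀ t, HasDerivAt σ (2 * inner ℝ (p1 t) ζ / (3 * σ t ^ 2)) t := fun t =>
    hasDerivAt_cbrt ((hasDerivAt_normSq_velocity η ζ t).add_const _) (by positivity)
  have hσc : Continuous σ := by
    rw [continuous_iff_continuousAt]; exact fun t => (hσ' t).continuousAt
  have hρσ : ∀ t, ρ t ≤ σ t := fun t => by
    refine le_of_pow_le_pow_left₀ (n := 3) (by norm_num) (hσpos t).le ?_
    rw [hσ3, hρ3]
    have : 1 ≤ ℓ ^ 3 := one_le_pow₀ hℓ
    nlinarith [pow_pos hs 6]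
  have hσρ : ∀ t, σ t ≤ ℓ * ρ t := fun t => by
    have := hρpos t
    refine le_of_pow_le_pow_left₀ (n := 3) (by norm_num) (by positivity) ?_
    rw [hσ3, mul_pow, hρ3]
    have : 1 ≤ ℓ ^ 3 := one_le_pow₀ hℓ
    nlinarith [sq_nonneg ‖p1 t‖]
  refine ⟨fun t => ‖p t‖ ^ 2 + ℓ ^ 2 * σ t,
    fun t => 2 * inner ℝ (p t) (p1 t) + ℓ ^ 2 * (2 * inner ℝ (p1 t) ζ / (3 * σ t ^ 2)),
    ?_, ?_, ?_, ?_, ?_⟩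
  · intro t
    exact ((hasDerivAt_curve ξ η ζ t).norm_sq).fun_add ((hσ' t).const_mul _)
  · have h3 : ∀ t, 3 * σ t ^ 2 ≠ 0 := fun t => mul_ne_zero three_ne_zero
      (pow_ne_zero _ (hσpos t).ne')
    fun_prop (disch := assumption)
  · intro t
    have h2 : 1 ≤ ℓ ^ 2 := one_le_pow₀ hℓ
    have := hρσ t
    have := hσpos t
    change ‖p t‖ ^ 2 + ρ t ≤ _
    nlinarith
  · intro t
    change _ ≤ ℓ ^ 3 * (‖p t‖ ^ 2 + ρ t)
    have h2 : 1 ≤ ℓ ^ 3 := one_le_pow₀ hℓ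
    have := mul_le_mul_of_nonneg_left (hσρ t) (sq_nonneg ℓ)
    nlinarith [sq_nonneg ‖p t‖]
  · intro t
    have hA : |inner ℝ (p t) (p1 t)| ≤ ‖p t‖ * ‖p1 t‖ := abs_real_inner_le_norm _ _
    have hD : |inner ℝ (p1 t) ζ| ≤ ‖p1 t‖ * s ^ 5 := by rw [hs5]; exact abs_real_inner_le_norm _ _
    have h := weight_deriv_le hℓ hs (hρpos t) (hρ3 t) (hσpos t) (hσ3 t) hA hD
    have e : 2 / ℓ = δ / 8 := by rw [hℓd]; field_simp; norm_num
    rw [e] at h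
    exact h

/-- The constant of the weighted estimate along curves. -/
def odeConst (δ : ℝ) : ℝ := 512 * (16 / δ) ^ 3 * Real.exp 8196 / δ ^ 2

/-- The weighted estimate for `v' + b v = f` on a left half-line, where `b` dominates the squared
length of a quadratic curve. -/
theorem ode_weighted_estimate {δ : ℝ} (hδ : 0 < δ) (hδ' : δ < 1) (ξ η : V) {ζ : V} (hζ : ζ ≠ 0)
    {J : Set ℝ} (hJo : IsOpen J) (hJ : ∀ t ∈ J, Iic t ⊆ J) {v F f b : ℝ → ℝ}
    (hF : ∀ s ∈ J, ∀ t ∈ J, IntervalIntegrable F volume s t)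
    (hv : ∀ s ∈ J, ∀ t ∈ J, v t = v s + ∫ τ in s..t, F τ) (hvc : ContinuousOn v J)
    (hv2 : IntegrableOn (fun t => v t ^ 2) J) (hf2 : IntegrableOn (fun t => f t ^ 2) J)
    (hb : ∀ t ∈ J, δ * ‖curve ξ η ζ t‖ ^ 2 ≤ b t)
    (heq : ∀ᵐ t, t ∈ J → F t = f t - b t * v t) :
    ∫⁻ t in J, ENNReal.ofReal ((curveWeight ξ η ζ t * v t) ^ 2) ≤
      ENNReal.ofReal (odeConst δ) * ∫⁻ t in J, ENNReal.ofReal (f t ^ 2) := by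
  obtain ⟨g, g', hg, hg'c, hgb, hgl⟩ := exists_bounded_multiplier hδ hδ' ξ η hζ
  obtain ⟨M, M', hM, hM'c, hmM, hMm, hM'⟩ := exists_slow_weight hδ hδ' ξ η hζ
  set m := curveWeight ξ η ζ with hm
  set P : ℝ → ℝ := fun t => ‖curve ξ η ζ t‖ ^ 2 with hP
  have hmc : Continuous m := continuous_curveWeight ξ η ζ
  have hgc : Continuous g := continuous_iff_continuousAt.2 fun t => (hg t).continuousAt
  have hMc : Continuous M := continuous_iff_continuousAt.2 fun t => (hM t).continuousAt
  have hmpos : ∀ t, 0 < m t := fun t => by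
    have := curveRho_pos η hζ t
    simp only [hm, curveWeight]; positivity
  have hMpos : ∀ t, 0 < M t := fun t => (hmpos t).trans_le (hmM t)
  set C : ℝ := Real.exp 4098 with hC
  have hCpos : 0 < C := Real.exp_pos _
  have hgu : ∀ t, Real.exp (-g t) ≤ C := fun t =>
    Real.exp_le_exp.2 (by linarith [(abs_le.1 (hgb t)).1])
  have hgl' : ∀ t, C⁻¹ ≤ Real.exp (-g t) := fun t => by
    rw [hC, ← Real.exp_neg]
    exact Real.exp_le_exp.2 (by linarith [(abs_le.1 (hgb t)).2])
  have hexp : ∀ t, HasDerivAt (fun τ => Real.exp (-g τ)) (Real.exp (-g t) * (-g' t)) t :=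
    fun t => (hg t).fun_neg.exp
  -- Energy with weight `e^{-g}`. The right side still contains `v²`, so only the finiteness of `∫ m
  -- v²` is drawn from this; it is needed for the boundary term in `step1`.
  have step0 : ∫⁻ t in J, ENNReal.ofReal (C⁻¹ * (δ / 4) * (m t * v t ^ 2)) ≤
      ∫⁻ t in J, ENNReal.ofReal (C * (f t ^ 2 + v t ^ 2)) := by
    refine lintegral_le_of_energy hJo hJ hF hv hexp (by fun_prop) (fun t => (Real.exp_pos _).le)
      (by fun_prop) ?_ ((hf2.add hv2).const_mul C) (fun t => by positivity) ?_ ?_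
    · intro t _
      have := hmpos t
      positivity
    · filter_upwards [heq] with t ht htJ
      rw [ht htJ]
      have h1 := hgl t
      have h2 := hb t htJ
      have hE := Real.exp_pos (-g t)
      have h3 : C⁻¹ * (δ / 4) * (m t * v t ^ 2) ≤ Real.exp (-g t) * ((δ / 4) * (m t * v t ^ 2)) := by
        rw [mul_assoc]
        refine mul_le_mul_of_nonneg_right (hgl' t) ?_
        have := hmpos t
        positivity
      have h4 : Real.exp (-g t) * (f t ^ 2 + v t ^ 2) ≤ C * (f t ^ 2 + v t ^ 2) :=
        mul_le_mul_of_nonneg_right (hgu t) (by positivity)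
      have h5 : 2 * v t * f t ≤ f t ^ 2 + v t ^ 2 := by nlinarith [sq_nonneg (v t - f t)]
      have h6 : 0 ≤ (2 * b t + g' t - δ / 4 * m t) * v t ^ 2 :=
        mul_nonneg (by simp only [hP] at *; linarith) (sq_nonneg _)
      have h7 := mul_le_mul_of_nonneg_left h5 hE.le
      have h8 := mul_nonneg hE.le h6
      nlinarith
    · intro s₀ hs₀ ε hε
      have hfin : ∫⁻ t in J, ENNReal.ofReal (v t ^ 2) < ⊤ := hv2.lintegral_lt_top
      obtain ⟨s, hs, hle⟩ := exists_le_of_integrableOn hJ hfin hs₀ (div_pos hε hCpos)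
      refine ⟨s, hs, ?_⟩
      have := mul_le_mul (hgu s) hle (sq_nonneg _) hCpos.le
      rwa [mul_div_cancel₀ _ hCpos.ne'] at this
  have hmv : ∫⁻ t in J, ENNReal.ofReal (m t * v t ^ 2) < ⊤ := by
    have hfin : ∫⁻ t in J, ENNReal.ofReal (C * (f t ^ 2 + v t ^ 2)) < ⊤ :=
      ((hf2.add hv2).const_mul C).lintegral_lt_top
    have h1 := step0.trans_lt hfin
    have hc : 0 < C⁻¹ * (δ / 4) := by positivity
    simp_rw [ENNReal.ofReal_mul hc.le] at h1
    rw [lintegral_const_mul' _ _ ENNReal.ofReal_ne_top] at h1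
    exact (ENNReal.mul_lt_top_iff.1 h1).elim (fun h => h.2) fun h => by
      rcases h with h | h
      · exact absurd h (by simpa using hc)
      · rw [h]; exact ENNReal.zero_lt_top
  set ℓ := 16 / δ with hℓ
  have hℓpos : 0 < ℓ := by positivity
  -- Energy with weight `M e^{-g}`. Of the gain `δ/4`, the derivative of `M` takes `δ/8`, Young's
  -- inequality takes `δ/16`, and `δ/16` is left. Dividing by `m` in Young's inequality cancels the
  -- `m` coming from `M`, so the source enters without weight.
  have step1 : ∫⁻ t in J, ENNReal.ofReal (C⁻¹ * (δ / 16) * (m t * v t) ^ 2) ≤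
      ∫⁻ t in J, ENNReal.ofReal (ℓ ^ 3 * C * (16 / δ) * f t ^ 2) := by
    refine lintegral_le_of_energy hJo hJ hF hv (fun t => (hM t).fun_mul (hexp t)) (by fun_prop)
      (fun t => (mul_pos (hMpos t) (Real.exp_pos _)).le)
      (by fun_prop) ?_ (hf2.const_mul _) (fun t => by positivity) ?_ ?_
    · intro t _
      positivity
    · filter_upwards [heq] with t ht htJ
      rw [ht htJ]
      have h1 := hgl t
      have h2 := hb t htJ
      have hE := Real.exp_pos (-g t)
      have hmt := hmpos t
      have hMt := hMpos t
      set e := Real.exp (-g t)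
      have h6 : 0 ≤ (2 * b t + g' t - δ / 4 * m t) * v t ^ 2 :=
        mul_nonneg (by simp only [hP] at *; linarith) (sq_nonneg _)
      have h7 := mul_nonneg (mul_pos hMt hE).le h6
      have h8 : 0 ≤ e * v t ^ 2 * (δ / 8 * (m t * M t) - M' t) :=
        mul_nonneg (by positivity) (by linarith [hM' t])
      -- Young's inequality for the source term
      have h9 : 2 * (v t * f t) ≤ δ / 16 * m t * v t ^ 2 + 16 / δ / m t * f t ^ 2 := by
        have e1 : δ / 16 * m t * v t ^ 2 + 16 / δ / m t * f t ^ 2 - 2 * (v t * f t) =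
          δ / 16 * m t * (v t - 16 / δ / m t * f t) ^ 2 := by
          field_simp; ring
        have : 0 ≤ δ / 16 * m t * (v t - 16 / δ / m t * f t) ^ 2 := by positivity
        linarith
      have h10 := mul_le_mul_of_nonneg_left h9 (mul_pos hMt hE).le
      have h11 : M t * e * (16 / δ / m t * f t ^ 2) ≤ ℓ ^ 3 * C * (16 / δ) * f t ^ 2 := by
        have : M t * e ≤ ℓ ^ 3 * m t * C :=
          mul_le_mul (hMm t) (hgu t) hE.le (by positivity)
        calc M t * e * (16 / δ / m t * f t ^ 2) ≤ ℓ ^ 3 * m t * C * (16 / δ / m t * f t ^ 2) := by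
              gcongr
          _ = _ := by field_simp
      have h12 : C⁻¹ * (δ / 16) * (m t * v t) ^ 2 ≤ M t * e * (δ / 16 * m t * v t ^ 2) := by
        have : m t * C⁻¹ ≤ M t * e := mul_le_mul (hmM t) (hgl' t) (by positivity) hMt.le
        calc C⁻¹ * (δ / 16) * (m t * v t) ^ 2 = m t * C⁻¹ * (δ / 16 * m t * v t ^ 2) := by ring
          _ ≤ _ := by gcongr
      nlinarith
    · intro s₀ hs₀ ε hε
      have hcpos : 0 < ℓ ^ 3 * C := by positivity
      obtain ⟨s, hs, hle⟩ := exists_le_of_integrableOn hJ hmv hs₀ (div_pos hε hcpos)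
      refine ⟨s, hs, ?_⟩
      have h1 : M s * Real.exp (-g s) ≤ ℓ ^ 3 * m s * C :=
        mul_le_mul (hMm s) (hgu s) (Real.exp_pos _).le (by have := hmpos s; positivity)
      calc M s * Real.exp (-g s) * v s ^ 2 ≤ ℓ ^ 3 * m s * C * v s ^ 2 := by gcongr
        _ = ℓ ^ 3 * C * (m s * v s ^ 2) := by ring
        _ ≤ ℓ ^ 3 * C * (ε / (ℓ ^ 3 * C)) := by gcongr
        _ = ε := mul_div_cancel₀ _ hcpos.ne'
  have hc1 : 0 < C⁻¹ * (δ / 16) := by positivity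
  have hc2 : 0 < ℓ ^ 3 * C * (16 / δ) := by positivity
  simp_rw [ENNReal.ofReal_mul hc1.le, ENNReal.ofReal_mul hc2.le] at step1
  rw [lintegral_const_mul' _ _ ENNReal.ofReal_ne_top,
    lintegral_const_mul' _ _ ENNReal.ofReal_ne_top] at step1
  have h3 : ENNReal.ofReal (C * (16 / δ)) * ENNReal.ofReal (C⁻¹ * (δ / 16)) = 1 := by
    rw [← ENNReal.ofReal_mul (by positivity)]
    have : C * (16 / δ) * (C⁻¹ * (δ / 16)) = 1 := by field_simp
    rw [this, ENNReal.ofReal_one]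
  calc ∫⁻ t in J, ENNReal.ofReal ((m t * v t) ^ 2)
      = ENNReal.ofReal (C * (16 / δ)) * (ENNReal.ofReal (C⁻¹ * (δ / 16)) *
          ∫⁻ t in J, ENNReal.ofReal ((m t * v t) ^ 2)) := by rw [← mul_assoc, h3, one_mul]
    _ ≤ ENNReal.ofReal (C * (16 / δ)) * (ENNReal.ofReal (ℓ ^ 3 * C * (16 / δ)) *
          ∫⁻ t in J, ENNReal.ofReal (f t ^ 2)) := by gcongr
    _ ≤ _ := by
      rw [← mul_assoc, ← ENNReal.ofReal_mul (by positivity)]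
      gcongr
      have hCC : C * C = Real.exp 8196 := by rw [hC, ← Real.exp_add]; norm_num
      rw [odeConst, ← hCC]
      have : C * (16 / δ) * (ℓ ^ 3 * C * (16 / δ)) = 256 * ℓ ^ 3 * (C * C) / δ ^ 2 := by
        field_simp; ring
      rw [this]
      gcongr
      norm_num

/-- The estimate of the zero order term for `v' + b v = f` on a left half-line. -/
theorem ode_zero_order_estimate {lam : ℝ} (hlam : 0 ≤ lam)
    {J : Set ℝ} (hJo : IsOpen J) (hJ : ∀ t ∈ J, Iic t ⊆ J) {v F f b : ℝ → ℝ}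
    (hF : ∀ s ∈ J, ∀ t ∈ J, IntervalIntegrable F volume s t)
    (hv : ∀ s ∈ J, ∀ t ∈ J, v t = v s + ∫ τ in s..t, F τ) (hvc : ContinuousOn v J)
    (hv2 : IntegrableOn (fun t => v t ^ 2) J) (hf2 : IntegrableOn (fun t => f t ^ 2) J)
    (hb : ∀ t ∈ J, lam ≤ b t)
    (heq : ∀ᵐ t, t ∈ J → F t = f t - b t * v t) :
    ∫⁻ t in J, ENNReal.ofReal ((lam * v t) ^ 2) ≤ ∫⁻ t in J, ENNReal.ofReal (f t ^ 2) := by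
  refine lintegral_le_of_energy (W := fun _ => lam) (W' := fun _ => 0) hJo hJ hF hv
    (fun t => hasDerivAt_const _ _) continuous_const (fun _ => hlam) (by fun_prop)
    (fun t _ => sq_nonneg _) hf2 (fun t => sq_nonneg _) ?_ ?_
  · filter_upwards [heq] with t ht htJ
    rw [ht htJ]
    have h1 := hb t htJ
    have h2 : 0 ≤ lam * (b t - lam) * v t ^ 2 :=
      mul_nonneg (mul_nonneg hlam (by linarith)) (sq_nonneg _)
    nlinarith [sq_nonneg (lam * v t - f t)]
  · intro s₀ hs₀ ε hε
    obtain ⟨s, hs, hle⟩ := exists_le_of_integrableOn hJ (w := fun t => v t ^ 2)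
      hv2.lintegral_lt_top hs₀ (ε := ε / (lam + 1)) (by positivity)
    refine ⟨s, hs, ?_⟩
    have h1 : (lam + 1) * v s ^ 2 ≤ ε := by
      rw [le_div_iff₀ (by positivity)] at hle
      linarith
    nlinarith [sq_nonneg (v s)]

end

/-! ### The Fourier transform of square integrable functions, in terms of representatives -/

section FourierL2

variable {E : Type*} [NormedAddCommGroup E] [InnerProductSpace ℝ E] [FiniteDimensional ℝ E]
  [MeasurableSpace E] [BorelSpace E]

/-- `g` represents the `L²` Fourier transform of the square integrable function `f`. -/
def IsFT (f g : E → ℂ) : Prop :=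
  ∃ (hf : MemLp f 2 volume) (hg : MemLp g 2 volume), 𝓕 (hf.toLp f) = hg.toLp g

namespace IsFT

variable {f f' g g' : E → ℂ}

theorem eLpNorm_eq (h : IsFT f g) : eLpNorm g 2 volume = eLpNorm f 2 volume := by
  obtain ⟨hf, hg, e⟩ := h
  have h1 : ‖hg.toLp g‖ = ‖hf.toLp f‖ := by rw [← e]; exact Lp.norm_fourier_eq _
  rw [Lp.norm_toLp, Lp.norm_toLp] at h1
  exact (ENNReal.toReal_eq_toReal_iff' hg.2.ne hf.2.ne).1 h1

theorem add (h : IsFT f g) (h' : IsFT f' g') : IsFT (f + f') (g + g') := by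
  obtain ⟨hf, hg, e⟩ := h
  obtain ⟨hf', hg', e'⟩ := h'
  refine ⟨hf.add hf', hg.add hg', ?_⟩
  rw [MemLp.toLp_add hf hf', MemLp.toLp_add hg hg', ← e, ← e']
  exact (Lp.fourierTransformₗᵢ E ℂ).map_add _ _

theorem sub (h : IsFT f g) (h' : IsFT f' g') : IsFT (f - f') (g - g') := by
  obtain ⟨hf, hg, e⟩ := h
  obtain ⟨hf', hg', e'⟩ := h'
  refine ⟨hf.sub hf', hg.sub hg', ?_⟩
  rw [MemLp.toLp_sub hf hf', MemLp.toLp_sub hg hg', ← e, ← e']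
  exact (Lp.fourierTransformₗᵢ E ℂ).map_sub _ _

theorem const_smul (h : IsFT f g) (c : ℂ) : IsFT (c • f) (c • g) := by
  obtain ⟨hf, hg, e⟩ := h
  refine ⟨hf.const_smul c, hg.const_smul c, ?_⟩
  rw [MemLp.toLp_const_smul c hf, MemLp.toLp_const_smul c hg, ← e]
  exact (Lp.fourierTransformₗᵢ E ℂ).map_smul _ _

theorem congr (h : IsFT f g) (hf' : f =ᵐ[volume] f') (hg' : g =ᵐ[volume] g') : IsFT f' g' := by
  obtain ⟨hf, hg, e⟩ := h
  refine ⟨hf.ae_eq hf', hg.ae_eq hg', ?_⟩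
  rw [← MemLp.toLp_congr hf (hf.ae_eq hf') hf', ← MemLp.toLp_congr hg (hg.ae_eq hg') hg', e]

theorem unique (h : IsFT f g) (h' : IsFT f g') : g =ᵐ[volume] g' := by
  obtain ⟨hf, hg, e⟩ := h
  obtain ⟨hf', hg', e'⟩ := h'
  exact (MemLp.toLp_eq_toLp_iff hg hg').1 (e.symm.trans e')

theorem exists_of_memLp (hf : MemLp f 2 volume) : ∃ g, IsFT f g :=
  ⟨_, hf, Lp.memLp (𝓕 (hf.toLp f)), (Lp.toLp_coeFn _ _).symm⟩

theorem integral_mul_schwartz (h : IsFT f g) (σ : 𝓢(E, ℂ)) :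
    ∫ k, g k * σ k = ∫ x, f x * (𝓕 σ) x := by
  obtain ⟨hf, hg, e⟩ := h
  have h1 := congrArg (fun T => T σ) (Lp.fourier_toTemperedDistribution_eq (hf.toLp f))
  simp only [TemperedDistribution.fourier_apply, Lp.toTemperedDistribution_apply, e] at h1
  have h2 : ∫ x, (𝓕 σ) x • (hf.toLp f) x = ∫ x, f x * (𝓕 σ) x := by
    refine integral_congr_ae ?_
    filter_upwards [hf.coeFn_toLp] with x hx
    rw [hx, smul_eq_mul, mul_comm]
  have h3 : ∫ x, σ x • (hg.toLp g) x = ∫ k, g k * σ k := by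
    refine integral_congr_ae ?_
    filter_upwards [hg.coeFn_toLp] with x hx
    rw [hx, smul_eq_mul, mul_comm]
  rw [← h2, ← h3]
  exact h1.symm

theorem integral_conj_mul (h : IsFT f g) (h' : IsFT f' g') :
    ∫ k, (starRingEnd ℂ) (g k) * g' k = ∫ x, (starRingEnd ℂ) (f x) * f' x := by
  obtain ⟨hf, hg, e⟩ := h
  obtain ⟨hf', hg', e'⟩ := h'
  have h1 : inner ℂ (hg.toLp g) (hg'.toLp g') = inner ℂ (hf.toLp f) (hf'.toLp f') := by
    rw [← e, ← e']; exact Lp.inner_fourier_eq _ _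
  rw [L2.inner_def, L2.inner_def] at h1
  have h2 : ∫ a, inner ℂ ((hg.toLp g) a) ((hg'.toLp g') a) =
      ∫ k, (starRingEnd ℂ) (g k) * g' k := by
    refine integral_congr_ae ?_
    filter_upwards [hg.coeFn_toLp, hg'.coeFn_toLp] with x hx hx'
    rw [hx, hx', RCLike.inner_apply, mul_comm]
  have h3 : ∫ a, inner ℂ ((hf.toLp f) a) ((hf'.toLp f') a) =
      ∫ k, (starRingEnd ℂ) (f k) * f' k := by
    refine integral_congr_ae ?_
    filter_upwards [hf.coeFn_toLp, hf'.coeFn_toLp] with x hx hx'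
    rw [hx, hx', RCLike.inner_apply, mul_comm]
  rw [← h2, ← h3, h1]

/-- The `L²` transform is characterised by duality with Schwartz functions, the integral transform
by Fubini. Both give the same integrals against test functions, so they agree almost everywhere. -/
theorem of_integrable (hf1 : Integrable f volume) (hf : MemLp f 2 volume) : IsFT f (𝓕 f) := by
  obtain ⟨g, hg⟩ := exists_of_memLp hf
  have hc : Continuous (𝓕 f) := by
    have := VectorFourier.fourierIntegral_continuous Real.continuous_fourierChar
      (L := innerₗ E) (by exact continuous_inner) hf1
    exact this
  refine hg.congr EventuallyEq.rfl ?_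
  obtain ⟨-, hg2, -⟩ := id hg
  refine ae_eq_of_integral_contDiff_smul_eq (hg2.locallyIntegrable (by norm_num))
    hc.locallyIntegrable ?_
  intro φ hφ hφc
  have hφ₁ : HasCompactSupport (Complex.ofRealCLM ∘ φ) := hφc.comp_left rfl
  have hφ₂ : ContDiff ℝ ∞ (Complex.ofRealCLM ∘ φ) := by fun_prop
  set σ : 𝓢(E, ℂ) := hφ₁.toSchwartzMap hφ₂ with hσ
  have hσx : ∀ x, σ x = (φ x : ℂ) := fun x => rfl
  have h1 := hg.integral_mul_schwartz σ
  have h2 := VectorFourier.integral_fourierIntegral_smul_eq_flip (e := Real.fourierChar)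
    (L := innerₗ E) (μ := volume) (ν := volume) Real.continuous_fourierChar
    (by exact continuous_inner) hf1 (σ.integrable (μ := volume))
  calc ∫ x, φ x • g x = ∫ k, g k * σ k := by
        refine integral_congr_ae (Eventually.of_forall fun x => ?_)
        simp [hσx, mul_comm]
    _ = ∫ x, f x * (𝓕 σ) x := h1
    _ = ∫ x, f x • (VectorFourier.fourierIntegral Real.fourierChar volume (innerₗ E).flip σ x) := by
        refine integral_congr_ae (Eventually.of_forall fun x => ?_)
        simp only [smul_eq_mul]
        congr 1
        rw [SchwartzMap.fourier_coe, flip_innerₗ]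
        rfl
    _ = _ := h2.symm
    _ = _ := by
        refine integral_congr_ae (Eventually.of_forall fun x => ?_)
        simp only [hσx, smul_eq_mul, Complex.real_smul]
        rw [mul_comm]
        rfl

/-- Serves to identify a pointwise limit of transforms as the transform of the `L²` limit: by
Plancherel the transforms also converge in `L²`, and a further subsequence converges almost
everywhere. -/
theorem of_tendsto {fn gn : ℕ → E → ℂ} (h : ∀ n, IsFT (fn n) (gn n)) (hf : MemLp f 2 volume)
    (hfn : Tendsto (fun n => eLpNorm (fn n - f) 2 volume) atTop (𝓝 0))
    (hg : ∃ ns : ℕ → ℕ, StrictMono ns ∧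
      ∀ᵐ x, Tendsto (fun i => gn (ns i) x) atTop (𝓝 (g x))) : IsFT f g := by
  obtain ⟨g₀, hg₀⟩ := exists_of_memLp hf
  obtain ⟨ns, hns, hlim⟩ := hg
  have h1 : Tendsto (fun n => eLpNorm (gn (ns n) - g₀) 2 volume) atTop (𝓝 0) := by
    refine (hfn.comp hns.tendsto_atTop).congr fun n => ?_
    exact ((h (ns n)).sub hg₀).eLpNorm_eq.symm
  have h2 := tendstoInMeasure_of_tendsto_eLpNorm two_ne_zero
    (fun n => (h (ns n)).choose_spec.choose.1) hg₀.choose_spec.choose.1 h1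
  obtain ⟨ms, hms, hlim2⟩ := h2.exists_seq_tendsto_ae
  refine hg₀.congr EventuallyEq.rfl ?_
  filter_upwards [hlim, hlim2] with x hx1 hx2
  exact tendsto_nhds_unique hx2 (hx1.comp hms.tendsto_atTop)

end IsFT

/-! ### The partial Fourier transform -/

variable {α : Type*} [MeasurableSpace α]

theorem eLpNorm_two_sq {β : Type*} [MeasurableSpace β] (ν : Measure β) {F : Type*}
    [NormedAddCommGroup F] (f : β → F) : eLpNorm f 2 ν ^ 2 = ∫⁻ x, ‖f x‖ₑ ^ 2 ∂ν := by
  rw [eLpNorm_eq_lintegral_rpow_enorm_toReal two_ne_zero ENNReal.ofNat_ne_top]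
  simp only [ENNReal.toReal_ofNat, one_div]
  rw [← ENNReal.rpow_natCast, ← ENNReal.rpow_mul]
  norm_num

theorem eLpNorm_two_sq_prod {μ : Measure α} [SFinite μ] {β : Type*} [MeasurableSpace β]
    {ν : Measure β} [SFinite ν] {F : Type*} [NormedAddCommGroup F] {f : α × β → F}
    (hf : AEStronglyMeasurable f (μ.prod ν)) :
    eLpNorm f 2 (μ.prod ν) ^ 2 = ∫⁻ t, eLpNorm (fun x => f (t, x)) 2 ν ^ 2 ∂μ := by
  simp_rw [eLpNorm_two_sq]
  exact lintegral_prod _ (hf.enorm.pow_const 2)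

theorem ae_memLp_slice {μ : Measure α} [SFinite μ] {β : Type*} [MeasurableSpace β]
    {ν : Measure β} [SFinite ν] {F : Type*} [NormedAddCommGroup F] {f : α × β → F}
    (hf : MemLp f 2 (μ.prod ν)) : ∀ᵐ t ∂μ, MemLp (fun x => f (t, x)) 2 ν := by
  have h1 : ∫⁻ t, eLpNorm (fun x => f (t, x)) 2 ν ^ 2 ∂μ < ⊤ := by
    rw [← eLpNorm_two_sq_prod hf.1]
    exact ENNReal.pow_lt_top hf.2
  have hm : AEMeasurable (fun t => eLpNorm (fun x => f (t, x)) 2 ν ^ 2) μ := by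
    simp_rw [eLpNorm_two_sq]
    exact (hf.1.enorm.pow_const 2).lintegral_prod_right'
  filter_upwards [ae_lt_top' hm h1.ne, hf.1.prodMk_left] with t ht ht2
  refine ⟨ht2, ?_⟩
  by_contra hcon
  rw [not_lt, top_le_iff] at hcon
  simp [hcon] at ht

theorem tendsto_eLpNorm_indicator {β : Type*} [MeasurableSpace β] {ν : Measure β}
    {F : Type*} [NormedAddCommGroup F] {f : β → F} (hf : MemLp f 2 ν) {S : ℕ → Set β}
    (hS : ∀ n, MeasurableSet (S n)) (hcov : ∀ x, ∀ᶠ n in atTop, x ∈ S n) :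
    Tendsto (fun n => eLpNorm ((S n).indicator f - f) 2 ν) atTop (𝓝 0) := by
  have h1 : Tendsto (fun n => ∫⁻ x, ‖((S n).indicator f - f) x‖ₑ ^ 2 ∂ν) atTop
      (𝓝 (∫⁻ x, 0 ∂ν)) := by
    refine tendsto_lintegral_of_dominated_convergence' (fun x => ‖f x‖ₑ ^ 2) (fun n => ?_)
      (fun n => Eventually.of_forall fun x => ?_) ?_ (Eventually.of_forall fun x => ?_)
    · exact (((hf.1.indicator (hS n)).sub hf.1).enorm.pow_const 2)
    · by_cases hx : x ∈ S n <;> simp [hx]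
    · rw [← eLpNorm_two_sq]; exact (ENNReal.pow_lt_top hf.2).ne
    · refine tendsto_const_nhds.congr' ?_
      filter_upwards [hcov x] with n hn
      simp [hn]
  simp only [lintegral_zero] at h1
  simp_rw [← eLpNorm_two_sq] at h1
  have h2 := (ENNReal.continuous_rpow_const (y := (1 / 2 : ℝ))).tendsto 0 |>.comp h1
  simp only [Function.comp_def] at h2
  have e : ∀ y : ℝ≥0∞, (y ^ 2) ^ (1 / 2 : ℝ) = y := fun y => by
    rw [← ENNReal.rpow_natCast, ← ENNReal.rpow_mul]; norm_num
  simp_rw [e] at h2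
  simpa using h2

/-- `U` is the Fourier transform of the square integrable function `u` in the second variable. -/
structure IsPFT (μ : Measure α) (u U : α × E → ℂ) : Prop where
  memLp : MemLp u 2 (μ.prod volume)
  memLp' : MemLp U 2 (μ.prod volume)
  slice : ∀ᵐ t ∂μ, IsFT (fun x => u (t, x)) (fun k => U (t, k))

namespace IsPFT

variable {μ : Measure α} {u u' U U' : α × E → ℂ}

theorem eLpNorm_eq [SFinite μ] (h : IsPFT μ u U) :
    eLpNorm U 2 (μ.prod volume) = eLpNorm u 2 (μ.prod volume) := by
  have h1 : eLpNorm U 2 (μ.prod volume) ^ 2 = eLpNorm u 2 (μ.prod volume) ^ 2 := by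
    rw [eLpNorm_two_sq_prod h.memLp.1, eLpNorm_two_sq_prod h.memLp'.1]
    refine lintegral_congr_ae ?_
    filter_upwards [h.slice] with t ht
    rw [ht.eLpNorm_eq]
  exact (ENNReal.pow_right_strictMono two_ne_zero).injective h1

theorem add (h : IsPFT μ u U) (h' : IsPFT μ u' U') : IsPFT μ (u + u') (U + U') :=
  ⟨h.memLp.add h'.memLp, h.memLp'.add h'.memLp', by
    filter_upwards [h.slice, h'.slice] with t ht ht' using ht.add ht'⟩

theorem sub (h : IsPFT μ u U) (h' : IsPFT μ u' U') : IsPFT μ (u - u') (U - U') :=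
  ⟨h.memLp.sub h'.memLp, h.memLp'.sub h'.memLp', by
    filter_upwards [h.slice, h'.slice] with t ht ht' using ht.sub ht'⟩

/-- A factor depending on the first variable alone is a constant on each slice. This is where it
matters that the coefficients do not depend on `(x, y, z)`. -/
theorem mul_left {a : α → ℂ} {K : ℝ} (ha : AEStronglyMeasurable a μ) (hK : ∀ t, ‖a t‖ ≤ K)
    (h : IsPFT μ u U) : IsPFT μ (fun X => a X.1 * u X) (fun X => a X.1 * U X) := by
  have ha' : AEStronglyMeasurable (fun X : α × E => a X.1) (μ.prod volume) := ha.comp_fst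
  have hb : ∀ w : α × E → ℂ, MemLp w 2 (μ.prod volume) →
      MemLp (fun X => a X.1 * w X) 2 (μ.prod volume) := fun w hw => by
    refine (hw.norm.const_mul K).mono (ha'.mul hw.1) (Eventually.of_forall fun X => ?_)
    rw [norm_mul, norm_mul, norm_norm]
    exact mul_le_mul_of_nonneg_right ((hK _).trans (le_abs_self K)) (norm_nonneg _)
  refine ⟨hb u h.memLp, hb U h.memLp', ?_⟩
  filter_upwards [h.slice] with t ht using ht.const_smul (a t)

theorem zero : IsPFT μ (0 : α × E → ℂ) 0 := by
  refine ⟨MemLp.zero, MemLp.zero, Eventually.of_forall fun t => ⟨MemLp.zero, MemLp.zero, ?_⟩⟩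
  change (Lp.fourierTransformₗᵢ E ℂ) (MemLp.toLp 0 _) = MemLp.toLp 0 _
  rw [MemLp.toLp_zero]
  exact map_zero _

theorem sum {ι : Type*} (s : Finset ι) {u U : ι → α × E → ℂ} (h : ∀ i ∈ s, IsPFT μ (u i) (U i)) :
    IsPFT μ (∑ i ∈ s, u i) (∑ i ∈ s, U i) := by
  classical
  induction s using Finset.induction_on with
  | empty => simpa using zero
  | insert i s hi ih =>
    rw [Finset.sum_insert hi, Finset.sum_insert hi]
    exact (h i (Finset.mem_insert_self _ _)).add
      (ih fun j hj => h j (Finset.mem_insert_of_mem hj))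

theorem congr (h : IsPFT μ u U) (hu : u =ᵐ[μ.prod volume] u') (hU : U =ᵐ[μ.prod volume] U') :
    IsPFT μ u' U' := by
  refine ⟨h.memLp.ae_eq hu, h.memLp'.ae_eq hU, ?_⟩
  filter_upwards [h.slice, Measure.ae_ae_of_ae_prod hu, Measure.ae_ae_of_ae_prod hU]
    with t ht ht1 ht2 using ht.congr ht1 ht2

theorem integral_conj_mul [SFinite μ] (h : IsPFT μ u U) (h' : IsPFT μ u' U') :
    ∫ X, (starRingEnd ℂ) (U X) * U' X ∂μ.prod volume =
      ∫ X, (starRingEnd ℂ) (u X) * u' X ∂μ.prod volume := by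
  have hi : ∀ {w w' : α × E → ℂ}, MemLp w 2 (μ.prod volume) → MemLp w' 2 (μ.prod volume) →
      Integrable (fun X => (starRingEnd ℂ) (w X) * w' X) (μ.prod volume) := fun hw hw' =>
    MemLp.integrable_mul hw.star hw'
  rw [integral_prod _ (hi h.memLp' h'.memLp'), integral_prod _ (hi h.memLp h'.memLp)]
  refine integral_congr_ae ?_
  filter_upwards [h.slice, h'.slice] with t ht ht'
  exact ht.integral_conj_mul ht'

/-- Transforming each slice separately would not give a jointly measurable function. Truncation to
balls makes almost every slice integrable, so its transform is a parameter integral and jointly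
measurable. By Plancherel these transforms form a Cauchy sequence in `L²` of the product, and the
slices of the limit are identified along an almost everywhere convergent subsequence. -/
theorem exists_of_memLp [SFinite μ] (hu : MemLp u 2 (μ.prod volume)) : ∃ U, IsPFT μ u U := by
  wlog hum : StronglyMeasurable u generalizing u
  · obtain ⟨U, hU⟩ := this (hu.ae_eq hu.1.ae_eq_mk) hu.1.stronglyMeasurable_mk
    exact ⟨U, hU.congr hu.1.ae_eq_mk.symm EventuallyEq.rfl⟩
  let B : ℕ → Set E := fun n => Metric.ball 0 n
  let S : ℕ → Set (α × E) := fun n => univ ×ˢ B n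
  have hB : ∀ n, MeasurableSet (B n) := fun n => measurableSet_ball
  have hS : ∀ n, MeasurableSet (S n) := fun n => MeasurableSet.univ.prod (hB n)
  have hBcov : ∀ x : E, ∀ᶠ n in atTop, x ∈ B n := fun x => by
    filter_upwards [eventually_gt_atTop ⌈‖x‖⌉₊] with n hn
    simp only [B, mem_ball_zero_iff]
    exact (Nat.le_ceil _).trans_lt (by exact_mod_cast hn)
  have hScov : ∀ X : α × E, ∀ᶠ n in atTop, X ∈ S n := fun X => by
    filter_upwards [hBcov X.2] with n hn using ⟨mem_univ _, hn⟩
  let un : ℕ → α × E → ℂ := fun n => (S n).indicator u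
  have hun : ∀ n, StronglyMeasurable (un n) := fun n => hum.indicator (hS n)
  have hslice : ∀ n t, (fun x => un n (t, x)) = (B n).indicator (fun x => u (t, x)) := fun n t => by
    ext x
    by_cases hx : x ∈ B n <;> simp [un, S, hx]
  let Un : ℕ → α × E → ℂ := fun n X => 𝓕 (fun x => un n (X.1, x)) X.2
  have hUn : ∀ n, StronglyMeasurable (Un n) := fun n => by
    have : Un n = fun X : α × E => ∫ x, Real.fourierChar (-inner ℝ x X.2) • un n (X.1, x) := by
      ext X; rfl
    rw [this]
    apply StronglyMeasurable.integral_prod_right' (f := fun q : (α × E) × E =>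
      Real.fourierChar (-inner ℝ q.2 q.1.2) • un n (q.1.1, q.2))
    have h1 : StronglyMeasurable fun q : (α × E) × E => un n (q.1.1, q.2) :=
      (hun n).comp_measurable (by fun_prop)
    have h2 : Measurable fun q : (α × E) × E => -inner ℝ q.2 q.1.2 := by fun_prop
    have h3 : StronglyMeasurable fun q : (α × E) × E => (Real.fourierChar (-inner ℝ q.2 q.1.2) : ℂ) :=
      ((continuous_subtype_val.comp Real.continuous_fourierChar).measurable.comp h2).stronglyMeasurable
    exact h3.mul h1
  have hmem := ae_memLp_slice hu
  have hFT : ∀ n, ∀ᵐ t ∂μ, IsFT (fun x => un n (t, x)) (fun k => Un n (t, k)) := fun n => by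
    filter_upwards [hmem] with t ht
    have h2 : MemLp (fun x => un n (t, x)) 2 volume := by
      rw [hslice]; exact ht.indicator (hB n)
    refine IsFT.of_integrable ?_ h2
    rw [hslice, integrable_indicator_iff (hB n)]
    have : IsFiniteMeasure (volume.restrict (B n)) := ⟨by
      rw [Measure.restrict_apply_univ]; exact measure_ball_lt_top⟩
    exact (ht.restrict (B n)).integrable (by norm_num)
  have hunL : ∀ n, MemLp (un n) 2 (μ.prod volume) := fun n => hu.indicator (hS n)
  have hUnL : ∀ n, MemLp (Un n) 2 (μ.prod volume) := fun n => by
    refine ⟨(hUn n).aestronglyMeasurable, ?_⟩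
    have : eLpNorm (Un n) 2 (μ.prod volume) ^ 2 = eLpNorm (un n) 2 (μ.prod volume) ^ 2 := by
      rw [eLpNorm_two_sq_prod (hUn n).aestronglyMeasurable, eLpNorm_two_sq_prod (hunL n).1]
      refine lintegral_congr_ae ?_
      filter_upwards [hFT n] with t ht
      rw [ht.eLpNorm_eq]
    rw [(ENNReal.pow_right_strictMono two_ne_zero).injective this]
    exact (hunL n).2
  have hP : ∀ n, IsPFT μ (un n) (Un n) := fun n => ⟨hunL n, hUnL n, hFT n⟩
  have hconv : Tendsto (fun n => (hunL n).toLp (un n)) atTop (𝓝 (hu.toLp u)) := by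
    rw [Lp.tendsto_Lp_iff_tendsto_eLpNorm'']
    exact tendsto_eLpNorm_indicator hu hS hScov
  have hCau : CauchySeq (fun n => (hUnL n).toLp (Un n)) := by
    have h1 := hconv.cauchySeq
    rw [Metric.cauchySeq_iff] at h1 ⊢
    intro ε hε
    obtain ⟨N, hN⟩ := h1 ε hε
    refine ⟨N, fun m hm n hn => ?_⟩
    have h2 := hN m hm n hn
    rw [dist_eq_norm, ← MemLp.toLp_sub, Lp.norm_toLp] at h2 ⊢
    rwa [((hP m).sub (hP n)).eLpNorm_eq]
  obtain ⟨U, hU⟩ := cauchySeq_tendsto_of_complete hCau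
  refine ⟨U, hu, Lp.memLp U, ?_⟩
  rw [Lp.tendsto_Lp_iff_tendsto_eLpNorm'] at hU
  have hU' : Tendsto (fun n => eLpNorm (Un n - ⇑U) 2 (μ.prod volume)) atTop (𝓝 0) :=
    hU.congr fun n => eLpNorm_congr_ae ((hUnL n).coeFn_toLp.sub EventuallyEq.rfl)
  obtain ⟨ns, hns, hlim⟩ := (tendstoInMeasure_of_tendsto_eLpNorm two_ne_zero
    (fun n => (hUnL n).1) (Lp.memLp U).1 hU').exists_seq_tendsto_ae
  filter_upwards [hmem, ae_all_iff.2 hFT, Measure.ae_ae_of_ae_prod hlim] with t ht1 ht2 ht3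
  refine IsFT.of_tendsto ht2 ht1 ?_ ⟨ns, hns, ht3⟩
  simp_rw [hslice]
  exact tendsto_eLpNorm_indicator ht1 hB hBcov

end IsPFT

end FourierL2

/-! ### Functions that are orthogonal to all products of test functions -/

section Rectangles

/-- Rectangles form a π-system generating the product σ-algebra, and the sets of zero integral are
closed under complements and disjoint unions. -/
theorem ae_eq_zero_of_setIntegral_rectangle_eq_zero {α β : Type*} [MeasurableSpace α]
    [MeasurableSpace β] {μ : Measure α} {ν : Measure β} {K : α × β → ℂ}
    (hK : Integrable K (μ.prod ν))
    (h : ∀ A B, MeasurableSet A → MeasurableSet B → ∫ X in A ×ˢ B, K X ∂μ.prod ν = 0) :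
    K =ᵐ[μ.prod ν] 0 := by
  have huniv : ∫ X, K X ∂μ.prod ν = 0 := by
    have := h univ univ MeasurableSet.univ MeasurableSet.univ
    rwa [univ_prod_univ, setIntegral_univ] at this
  have all : ∀ s, MeasurableSet s → ∫ X in s, K X ∂μ.prod ν = 0 := by
    intro s hs
    induction s, hs using MeasurableSpace.induction_on_inter generateFrom_prod.symm
      isPiSystem_prod with
    | empty => simp
    | basic t ht =>
      obtain ⟨A, hA, B, hB, rfl⟩ := ht
      exact h A B hA hB
    | compl t ht ih =>
      have h1 := integral_add_compl ht hK
      rwa [ih, zero_add, huniv] at h1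
    | iUnion f hd hm ih =>
      rw [integral_iUnion hm hd hK.integrableOn]
      simp [ih]
  exact hK.ae_eq_zero_of_forall_setIntegral_eq_zero fun s hs _ => all s hs

variable {E : Type*} [NormedAddCommGroup E] [MeasurableSpace E] [BorelSpace E] {ν : Measure E}

/-- Smooth functions with compact support in an open set. -/
structure IsBump {E : Type*} [NormedAddCommGroup E] [NormedSpace ℝ E] (U : Set E) (φ : E → ℝ) :
    Prop where
  smooth : ContDiff ℝ ∞ φ
  compact : HasCompactSupport φ
  support : tsupport φ ⊆ U

theorem integrable_prod_bump {J : Set ℝ} {K : ℝ × E → ℂ}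
    (hK : ∀ A B, IsCompact A → A ⊆ J → IsCompact B → IntegrableOn K (A ×ˢ B) (volume.prod ν))
    {a : ℝ → ℝ} {b : E → ℝ} (ha : Measurable a) (hb : Measurable b) {Ca Cb : ℝ}
    (haC : ∀ t, |a t| ≤ Ca) (hbC : ∀ x, |b x| ≤ Cb) {A : Set ℝ} {B : Set E}
    (hA : IsCompact A) (hAJ : A ⊆ J) (hB : IsCompact B)
    (ha0 : ∀ t ∉ A, a t = 0) (hb0 : ∀ x ∉ B, b x = 0) :
    Integrable (fun X => (a X.1 * b X.2) • K X) (volume.prod ν) := by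
  have h1 : Integrable ((A ×ˢ B).indicator K) (volume.prod ν) := by
    rw [integrable_indicator_iff (hA.measurableSet.prod hB.measurableSet)]
    exact hK A B hA hAJ hB
  have h2 : Integrable (fun X : ℝ × E => (a X.1 * b X.2) • (A ×ˢ B).indicator K X)
      (volume.prod ν) := by
    have hm : Measurable fun X : ℝ × E => a X.1 * b X.2 := by fun_prop
    refine h1.bdd_smul (Ca * Cb) hm.aestronglyMeasurable
      (Eventually.of_forall fun X => ?_)
    rw [Real.norm_eq_abs, abs_mul]
    exact mul_le_mul (haC _) (hbC _) (abs_nonneg _) ((abs_nonneg _).trans (haC X.1))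
  refine h2.congr (Eventually.of_forall fun X => ?_)
  by_cases hX : X ∈ A ×ˢ B
  · simp [hX]
  · rw [mem_prod, not_and_or] at hX
    rcases hX with hX | hX
    · simp [ha0 _ hX]
    · simp [hb0 _ hX]

theorem IsBump.exists_bound {E : Type*} [NormedAddCommGroup E] [NormedSpace ℝ E] {U : Set E}
    {φ : E → ℝ} (h : IsBump U φ) : ∃ C, ∀ x, |φ x| ≤ C :=
  h.smooth.continuous.bounded_above_of_compact_support h.compact

theorem abs_indicator_one_le {γ : Type*} (B : Set γ) (x : γ) :
    |B.indicator (1 : γ → ℝ) x| ≤ 1 := by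
  by_cases hx : x ∈ B <;> simp [hx]

/-- The fundamental lemma of the calculus of variations, used once in each variable, shows that
integrals over compact rectangles vanish. Only product test functions are required, which is the
form in which a transform in one group of variables can be tested. -/
theorem ae_eq_zero_of_integral_prod_bump_eq_zero [NormedSpace ℝ E] [FiniteDimensional ℝ E]
    [SFinite ν] {J : Set ℝ} (hJ : IsOpen J) {K : ℝ × E → ℂ}
    (hK : ∀ A B, IsCompact A → A ⊆ J → IsCompact B → IntegrableOn K (A ×ˢ B) (volume.prod ν))
    (h : ∀ ψ σ, IsBump J ψ → IsBump univ σ →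
      ∫ X, (ψ X.1 * σ X.2) • K X ∂volume.prod ν = 0) :
    ∀ᵐ X ∂volume.prod ν, X.1 ∈ J → K X = 0 := by
  -- integrating out the first variable
  have step1 : ∀ ψ, IsBump J ψ → ∀ᵐ k ∂ν, ∫ t, ψ t • K (t, k) = 0 := by
    intro ψ hψ
    obtain ⟨Cψ, hCψ⟩ := hψ.exists_bound
    have hψm : Measurable ψ := hψ.smooth.continuous.measurable
    refine ae_eq_zero_of_integral_contDiff_smul_eq_zero ?_ ?_
    · refine (locallyIntegrable_iff).2 fun B hB => ?_
      have h1 := integrable_prod_bump hK hψm (measurable_one.indicator hB.measurableSet) hCψ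
        (abs_indicator_one_le B) hψ.compact hψ.support hB (fun _ hx => image_eq_zero_of_notMem_tsupport hx)
        (fun x hx => indicator_of_notMem hx _)
      have h2 := h1.integral_prod_right
      rw [← integrable_indicator_iff hB.measurableSet]
      refine h2.congr (Eventually.of_forall fun k => ?_)
      by_cases hk : k ∈ B <;> simp [hk]
    · intro σ hσ hσc
      have hσb : IsBump univ σ := ⟨hσ, hσc, subset_univ _⟩
      obtain ⟨Cσ, hCσ⟩ := hσb.exists_bound
      have h1 := integrable_prod_bump hK hψm hσ.continuous.measurable hCψ hCσ
        hψ.compact hψ.support hσc (fun _ hx => image_eq_zero_of_notMem_tsupport hx) (fun _ hx => image_eq_zero_of_notMem_tsupport hx)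
      have h2 := h ψ σ hψ hσb
      rw [integral_prod_symm _ h1] at h2
      rw [← h2]
      refine integral_congr_ae (Eventually.of_forall fun k => ?_)
      simp only [← integral_smul, smul_smul]
      simp_rw [mul_comm]
  -- integrating out the second variable
  have step2 : ∀ B₀ B, IsCompact B₀ → MeasurableSet B → B ⊆ B₀ →
      ∀ᵐ t, t ∈ J → ∫ k in B, K (t, k) ∂ν = 0 := by
    intro B₀ B hB₀ hB hBB
    have hBm : Measurable (B.indicator (1 : E → ℝ)) := measurable_one.indicator hB
    have hB0 : ∀ x ∉ B₀, B.indicator (1 : E → ℝ) x = 0 := fun x hx =>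
      indicator_of_notMem (fun hx' => hx (hBB hx')) _
    have e : ∀ t, ∫ k, (B.indicator (1 : E → ℝ) k) • K (t, k) ∂ν = ∫ k in B, K (t, k) ∂ν := by
      intro t
      rw [← integral_indicator hB]
      refine integral_congr_ae (Eventually.of_forall fun k => ?_)
      by_cases hk : k ∈ B <;> simp [hk]
    refine IsOpen.ae_eq_zero_of_integral_contDiff_smul_eq_zero hJ ?_ ?_
    · refine (locallyIntegrableOn_iff hJ.isLocallyClosed).2 fun A hAJ hA => ?_
      have h1 := integrable_prod_bump hK (measurable_one.indicator hA.measurableSet) hBm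
        (abs_indicator_one_le A) (abs_indicator_one_le B) hA hAJ hB₀ (fun x hx => indicator_of_notMem hx _) hB0
      have h2 := h1.integral_prod_left
      rw [← integrable_indicator_iff hA.measurableSet]
      refine h2.congr (Eventually.of_forall fun t => ?_)
      by_cases ht : t ∈ A
      · simp only [ht, indicator_of_mem, Pi.one_apply, one_mul, e]
      · simp [ht]
    · intro ψ hψ hψc hψs
      have hψb : IsBump J ψ := ⟨hψ, hψc, hψs⟩
      obtain ⟨Cψ, hCψ⟩ := hψb.exists_bound
      have h1 := integrable_prod_bump hK hψ.continuous.measurable hBm hCψ (abs_indicator_one_le B)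
        hψc hψs hB₀ (fun _ hx => image_eq_zero_of_notMem_tsupport hx) hB0
      calc ∫ t, ψ t • ∫ k in B, K (t, k) ∂ν
          = ∫ t, ∫ k, (ψ t * B.indicator 1 k) • K (t, k) ∂ν := by
            refine integral_congr_ae (Eventually.of_forall fun t => ?_)
            simp only [← e, ← integral_smul, smul_smul]
        _ = ∫ k, ∫ t, (ψ t * B.indicator 1 k) • K (t, k) ∂volume ∂ν := integral_integral_swap h1
        _ = 0 := by
            refine integral_eq_zero_of_ae ?_
            filter_upwards [step1 ψ hψb] with k hk
            simp_rw [mul_comm (ψ _), mul_smul, integral_smul, hk, smul_zero, Pi.zero_apply]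
  have step3 : ∀ A₀ B₀, IsCompact A₀ → A₀ ⊆ J → IsCompact B₀ →
      ∀ᵐ X ∂volume.prod ν, X ∈ A₀ ×ˢ B₀ → K X = 0 := by
    intro A₀ B₀ hA hAJ hB
    have hm : MeasurableSet (A₀ ×ˢ B₀) := hA.measurableSet.prod hB.measurableSet
    rw [← ae_restrict_iff' hm, ← Measure.prod_restrict]
    have hint : IntegrableOn K (A₀ ×ˢ B₀) (volume.prod ν) := hK A₀ B₀ hA hAJ hB
    refine ae_eq_zero_of_setIntegral_rectangle_eq_zero
      (by rw [Measure.prod_restrict]; exact hint) ?_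
    intro A B hAm hBm
    rw [Measure.prod_restrict, Measure.restrict_restrict (hAm.prod hBm), prod_inter_prod]
    rw [setIntegral_prod _ (hint.mono_set
      (prod_mono inter_subset_right inter_subset_right))]
    refine setIntegral_eq_zero_of_ae_eq_zero ?_
    filter_upwards [step2 B₀ (B ∩ B₀) hB (hBm.inter hB.measurableSet) inter_subset_right]
      with t ht htA using ht (hAJ htA.2)
  have hJsig : IsSigmaCompact J := by
    have := hJ.locallyCompactSpace
    exact isSigmaCompact_iff_sigmaCompactSpace.2 inferInstance
  obtain ⟨S, hS, hSJ⟩ := hJsig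
  have hall : ∀ᵐ X ∂volume.prod ν, ∀ n : ℕ × ℕ,
      X ∈ S n.1 ×ˢ Metric.closedBall (0 : E) n.2 → K X = 0 :=
    ae_all_iff.2 fun n => step3 _ _ (hS n.1) (hSJ ▸ subset_iUnion S n.1)
      (isCompact_closedBall _ _)
  filter_upwards [hall] with X hX hXJ
  rw [← hSJ, mem_iUnion] at hXJ
  obtain ⟨n, hn⟩ := hXJ
  exact hX (n, ⌈‖X.2‖⌉₊) ⟨hn, by simpa using Nat.le_ceil _⟩

end Rectangles

/-! ### Weak derivatives and the partial Fourier transform -/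

section WeakDerivative

theorem memLp_tensor {α β R : Type*} [MeasurableSpace α] [MeasurableSpace β] [NormedField R]
    {μ : Measure α} {ν : Measure β} [SFinite μ] [SFinite ν] {a : α → R} {b : β → R}
    (ha : MemLp a 2 μ) (hb : MemLp b 2 ν) :
    MemLp (fun X : α × β => a X.1 * b X.2) 2 (μ.prod ν) := by
  have hm : AEStronglyMeasurable (fun X : α × β => a X.1 * b X.2) (μ.prod ν) :=
    ha.1.comp_fst.mul hb.1.comp_snd
  refine ⟨hm, ?_⟩
  have h : eLpNorm (fun X : α × β => a X.1 * b X.2) 2 (μ.prod ν) ^ 2 < ⊤ := by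
    rw [eLpNorm_two_sq]
    simp_rw [enorm_mul, mul_pow]
    rw [lintegral_prod_mul (f := fun t => ‖a t‖ₑ ^ 2) (g := fun x => ‖b x‖ₑ ^ 2)
      (ha.1.enorm.pow_const 2) (hb.1.enorm.pow_const 2), ← eLpNorm_two_sq, ← eLpNorm_two_sq]
    exact ENNReal.mul_lt_top (ENNReal.pow_lt_top ha.2) (ENNReal.pow_lt_top hb.2)
  by_contra hcon
  rw [not_lt, top_le_iff] at hcon
  simp [hcon] at h

variable {E : Type*} [NormedAddCommGroup E] [InnerProductSpace ℝ E] [FiniteDimensional ℝ E]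
  [MeasurableSpace E] [BorelSpace E]

/-- The cutoffs are dilations `b(x/(n+1))` of one bump. Dilation by a factor at least 1 does not
increase the gradient, hence the uniform bound. -/
theorem exists_cutoff_seq (E : Type*) [NormedAddCommGroup E] [InnerProductSpace ℝ E]
    [FiniteDimensional ℝ E] :
    ∃ (χ : ℕ → E → ℝ) (C : ℝ), (∀ n, ContDiff ℝ ∞ (χ n)) ∧ (∀ n, HasCompactSupport (χ n)) ∧
      (∀ n x, |χ n x| ≤ 1) ∧ (∀ n x, ‖fderiv ℝ (χ n) x‖ ≤ C) ∧
      ∀ x, ∀ᶠ n in atTop, χ n =ᶠ[𝓝 x] 1 := by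
  let b : ContDiffBump (0 : E) := ⟨1, 2, by norm_num, by norm_num⟩
  have hbs : ContDiff ℝ ∞ b := b.contDiff
  have hbc : HasCompactSupport b := b.hasCompactSupport
  obtain ⟨C, hC⟩ := (hbs.continuous_fderiv (by simp)).bounded_above_of_compact_support
    (hbc.fderiv ℝ)
  have hcpos : ∀ n : ℕ, (0 : ℝ) < ((n : ℝ) + 1)⁻¹ := fun n => by positivity
  have hcle : ∀ n : ℕ, ((n : ℝ) + 1)⁻¹ ≤ 1 := fun n => inv_le_one_of_one_le₀ (by
    have : (0 : ℝ) ≤ n := Nat.cast_nonneg n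
    linarith)
  refine ⟨fun n x => b (((n : ℝ) + 1)⁻¹ • x), C, fun n => ?_, fun n => ?_, fun n x => ?_,
    fun n x => ?_, fun x => ?_⟩
  · exact hbs.comp (contDiff_const_smul _)
  · exact hbc.comp_smul (hcpos n).ne'
  · rw [abs_of_nonneg b.nonneg]; exact b.le_one
  · have hd : HasFDerivAt (fun x : E => b (((n : ℝ) + 1)⁻¹ • x))
        ((fderiv ℝ b (((n : ℝ) + 1)⁻¹ • x)).comp
          (((n : ℝ) + 1)⁻¹ • ContinuousLinearMap.id ℝ E)) x := by
      have h1 : HasFDerivAt b (fderiv ℝ b (((n : ℝ) + 1)⁻¹ • x)) (((n : ℝ) + 1)⁻¹ • x) :=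
        (hbs.differentiable (by simp)).differentiableAt.hasFDerivAt
      exact h1.comp x ((hasFDerivAt_id x).const_smul _)
    rw [hd.fderiv, ContinuousLinearMap.comp_smul, ContinuousLinearMap.comp_id, norm_smul,
      Real.norm_of_nonneg (hcpos n).le]
    calc ((n : ℝ) + 1)⁻¹ * ‖fderiv ℝ b (((n : ℝ) + 1)⁻¹ • x)‖ ≤ 1 * C :=
          mul_le_mul (hcle n) (hC _) (norm_nonneg _) zero_le_one
      _ = C := one_mul C
  · filter_upwards [eventually_gt_atTop ⌈‖x‖⌉₊] with n hn
    have hx : ‖x‖ < n := (Nat.le_ceil _).trans_lt (by exact_mod_cast hn)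
    have hopen : ∀ᶠ y in 𝓝 x, ‖y‖ < n := (continuous_norm.tendsto x).eventually_lt_const hx
    filter_upwards [hopen] with y hy
    refine b.one_of_mem_closedBall ?_
    rw [mem_closedBall_zero_iff, norm_smul, Real.norm_of_nonneg (hcpos n).le]
    rw [inv_mul_le_iff₀ (by positivity)]
    change ‖y‖ ≤ ((n : ℝ) + 1) * 1
    linarith

/-- The Fourier transform of a bump is not compactly supported, so the class of test functions has
to be enlarged. Cutoffs with bounded gradients and dominated convergence do this for smooth `R` that
is square integrable along with its gradient. -/
theorem weak_deriv_of_memLp {μ : Measure ℝ} [SFinite μ] [IsFiniteMeasureOnCompacts μ]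
    {u g : ℝ × E → ℝ} (hu : MemLp u 2 (μ.prod volume)) (hg : MemLp g 2 (μ.prod volume))
    {e : ℝ → E} (he : Continuous e) {ψ : ℝ → ℝ} (hψ : Continuous ψ) (hψc : HasCompactSupport ψ)
    (hweak : ∀ θ, IsBump univ θ →
      ∫ X, u X * (ψ X.1 * fderiv ℝ θ X.2 (e X.1)) ∂μ.prod volume =
        -∫ X, g X * (ψ X.1 * θ X.2) ∂μ.prod volume)
    {R : E → ℝ} (hR : ContDiff ℝ ∞ R) (hR2 : MemLp R 2 volume)
    (hR2' : MemLp (fun x => ‖fderiv ℝ R x‖) 2 volume) :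
    ∫ X, u X * (ψ X.1 * fderiv ℝ R X.2 (e X.1)) ∂μ.prod volume =
        -∫ X, g X * (ψ X.1 * R X.2) ∂μ.prod volume := by
  obtain ⟨χ, C, hχs, hχc, hχ1, hχC, hχe⟩ := exists_cutoff_seq E
  have hC : 0 ≤ C := (norm_nonneg _).trans (hχC 0 0)
  have hθ : ∀ n, IsBump univ (fun x => χ n x * R x) := fun n =>
    ⟨(hχs n).mul hR, (hχc n).mul_right, subset_univ _⟩
  have hRd : Differentiable ℝ R := hR.differentiable (by simp)
  have hχd : ∀ n, Differentiable ℝ (χ n) := fun n => (hχs n).differentiable (by simp)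
  have hψ2 : MemLp ψ 2 μ := hψ.memLp_of_hasCompactSupport hψc
  have hψe : MemLp (fun t => |ψ t| * ‖e t‖) 2 μ :=
    Continuous.memLp_of_hasCompactSupport (by fun_prop) (hψc.abs.mul_right)
  have lim1 : Tendsto (fun n => ∫ X, u X * (ψ X.1 * fderiv ℝ (fun x => χ n x * R x) X.2 (e X.1))
      ∂μ.prod volume) atTop (𝓝 (∫ X, u X * (ψ X.1 * fderiv ℝ R X.2 (e X.1)) ∂μ.prod volume)) := by
    have hb : MemLp (fun x => ‖fderiv ℝ R x‖ + C * |R x|) 2 volume := hR2'.add (hR2.abs.const_mul C)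
    refine tendsto_integral_of_dominated_convergence
      (fun X => ‖u X‖ * ((|ψ X.1| * ‖e X.1‖) * (‖fderiv ℝ R X.2‖ + C * |R X.2|))) (fun n => ?_)
      (MemLp.integrable_mul hu.norm (memLp_tensor hψe hb)) (fun n => ?_) ?_
    · refine hu.1.mul (Continuous.aestronglyMeasurable ?_)
      have h1 : Continuous fun X : ℝ × E => fderiv ℝ (fun x => χ n x * R x) X.2 :=
        ((hθ n).smooth.continuous_fderiv (by simp)).comp continuous_snd
      have h2 : Continuous fun X : ℝ × E => e X.1 := he.comp continuous_fst
      exact (hψ.comp continuous_fst).mul (h1.clm_apply h2)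
    · refine Eventually.of_forall fun X => ?_
      rw [norm_mul]
      refine mul_le_mul_of_nonneg_left ?_ (norm_nonneg _)
      rw [norm_mul, Real.norm_eq_abs, mul_assoc]
      refine mul_le_mul_of_nonneg_left ?_ (abs_nonneg _)
      refine (ContinuousLinearMap.le_opNorm _ _).trans ?_
      rw [mul_comm]
      refine mul_le_mul_of_nonneg_left ?_ (norm_nonneg _)
      have hd : fderiv ℝ (fun x => χ n x * R x) X.2 =
          χ n X.2 • fderiv ℝ R X.2 + R X.2 • fderiv ℝ (χ n) X.2 :=
        fderiv_fun_mul (hχd n).differentiableAt hRd.differentiableAt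
      rw [hd]
      refine (norm_add_le _ _).trans (add_le_add ?_ ?_)
      · rw [norm_smul, Real.norm_eq_abs]
        exact mul_le_of_le_one_left (norm_nonneg _) (hχ1 n _)
      · rw [norm_smul, Real.norm_eq_abs, mul_comm]
        exact mul_le_mul_of_nonneg_right (hχC n _) (abs_nonneg _)
    · refine Eventually.of_forall fun X => tendsto_const_nhds.congr' ?_
      filter_upwards [hχe X.2] with n hn
      have : (fun x => χ n x * R x) =ᶠ[𝓝 X.2] R := by
        filter_upwards [hn] with x hx
        rw [hx, Pi.one_apply, one_mul]
      rw [this.fderiv_eq]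
  have lim2 : Tendsto (fun n => -∫ X, g X * (ψ X.1 * (χ n X.2 * R X.2)) ∂μ.prod volume) atTop
      (𝓝 (-∫ X, g X * (ψ X.1 * R X.2) ∂μ.prod volume)) := by
    refine (tendsto_integral_of_dominated_convergence
      (fun X => ‖g X‖ * ‖ψ X.1 * R X.2‖) (fun n => ?_)
      (MemLp.integrable_mul hg.norm (memLp_tensor hψ2 hR2).norm) (fun n => ?_) ?_).neg
    · refine hg.1.mul (Continuous.aestronglyMeasurable ?_)
      have := (hχs n).continuous
      have := hR.continuous
      fun_prop
    · refine Eventually.of_forall fun X => ?_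
      rw [norm_mul]
      refine mul_le_mul_of_nonneg_left ?_ (norm_nonneg _)
      rw [norm_mul, norm_mul, norm_mul]
      refine mul_le_mul_of_nonneg_left ?_ (norm_nonneg _)
      exact mul_le_of_le_one_left (norm_nonneg _) (hχ1 n _)
    · refine Eventually.of_forall fun X => tendsto_const_nhds.congr' ?_
      filter_upwards [hχe X.2] with n hn
      rw [hn.self_of_nhds, Pi.one_apply, one_mul]
  exact tendsto_nhds_unique (lim1.congr fun n => hweak _ (hθ n)) lim2

theorem integrable_mul_fderiv_schwartz {μ : Measure ℝ} [SFinite μ] [IsFiniteMeasureOnCompacts μ]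
    {u : ℝ × E → ℝ} (hu : MemLp u 2 (μ.prod volume))
    {e : ℝ → E} (he : Continuous e) {ψ : ℝ → ℝ} (hψ : Continuous ψ) (hψc : HasCompactSupport ψ)
    (Θ : 𝓢(E, ℂ)) :
    Integrable (fun X => (u X : ℂ) * (ψ X.1 * fderiv ℝ Θ X.2 (e X.1))) (μ.prod volume) := by
  have hΘ : ContDiff ℝ ∞ Θ := Θ.smooth ⊤
  have hΘ2' : MemLp (fderiv ℝ Θ) 2 volume := (SchwartzMap.fderivCLM ℝ E ℂ Θ).memLp 2 volume
  have h1 : MemLp (fun t => |ψ t| * ‖e t‖) 2 μ :=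
    Continuous.memLp_of_hasCompactSupport (by fun_prop) (hψc.abs.mul_right)
  refine (MemLp.integrable_mul hu.norm (memLp_tensor h1 hΘ2'.norm)).mono' ?_
    (Eventually.of_forall fun X => ?_)
  · refine hu.ofReal.1.mul (Continuous.aestronglyMeasurable ?_)
    have h1 : Continuous fun X : ℝ × E => fderiv ℝ Θ X.2 :=
      (hΘ.continuous_fderiv (by simp)).comp continuous_snd
    have h2 : Continuous fun X : ℝ × E => e X.1 := he.comp continuous_fst
    have h3 : Continuous fun X : ℝ × E => ((ψ X.1 : ℝ) : ℂ) := by fun_prop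
    exact h3.mul (h1.clm_apply h2)
  · rw [norm_mul, norm_mul, Complex.norm_real, Complex.norm_real]
    change _ ≤ ‖u X‖ * (|ψ X.1| * ‖e X.1‖ * ‖fderiv ℝ Θ X.2‖)
    rw [mul_assoc, Real.norm_eq_abs (ψ X.1)]
    gcongr
    rw [mul_comm]
    exact ContinuousLinearMap.le_opNorm _ _

theorem weak_deriv_schwartz {μ : Measure ℝ} [SFinite μ] [IsFiniteMeasureOnCompacts μ]
    {u g : ℝ × E → ℝ} (hu : MemLp u 2 (μ.prod volume)) (hg : MemLp g 2 (μ.prod volume))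
    {e : ℝ → E} (he : Continuous e) {ψ : ℝ → ℝ} (hψ : Continuous ψ) (hψc : HasCompactSupport ψ)
    (hweak : ∀ θ, IsBump univ θ →
      ∫ X, u X * (ψ X.1 * fderiv ℝ θ X.2 (e X.1)) ∂μ.prod volume =
        -∫ X, g X * (ψ X.1 * θ X.2) ∂μ.prod volume) (Θ : 𝓢(E, ℂ)) :
    ∫ X, (u X : ℂ) * (ψ X.1 * fderiv ℝ Θ X.2 (e X.1)) ∂μ.prod volume =
        -∫ X, (g X : ℂ) * (ψ X.1 * Θ X.2) ∂μ.prod volume := by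
  have hΘ : ContDiff ℝ ∞ Θ := Θ.smooth ⊤
  have hΘd : Differentiable ℝ Θ := Θ.differentiable
  have hΘ2 : MemLp Θ 2 volume := Θ.memLp 2 volume
  have hΘ2' : MemLp (fderiv ℝ Θ) 2 volume := (SchwartzMap.fderivCLM ℝ E ℂ Θ).memLp 2 volume
  have hψ2 : MemLp (fun t => (ψ t : ℂ)) 2 μ := (hψ.memLp_of_hasCompactSupport hψc).ofReal
  have part : ∀ L : ℂ →L[ℝ] ℝ, (∀ w, |L w| ≤ ‖w‖) →
      ∫ X, u X * (ψ X.1 * L (fderiv ℝ Θ X.2 (e X.1))) ∂μ.prod volume =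
        -∫ X, g X * (ψ X.1 * L (Θ X.2)) ∂μ.prod volume := by
    intro L hL
    have hLf : ∀ x, fderiv ℝ (fun y => L (Θ y)) x = L.comp (fderiv ℝ Θ x) := fun x =>
      (L.hasFDerivAt.comp x hΘd.differentiableAt.hasFDerivAt).fderiv
    have hs : ContDiff ℝ ∞ (fun y => L (Θ y)) := L.contDiff.comp hΘ
    have h := weak_deriv_of_memLp hu hg he hψ hψc hweak (R := fun y => L (Θ y)) hs
      (hΘ2.mono hs.continuous.aestronglyMeasurable (Eventually.of_forall fun x => hL _))
      (hΘ2'.mono (hs.continuous_fderiv (by simp)).norm.aestronglyMeasurable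
        (Eventually.of_forall fun x => by
          rw [norm_norm, hLf]
          refine ContinuousLinearMap.opNorm_le_bound _ (norm_nonneg _) fun y => ?_
          exact (hL _).trans (ContinuousLinearMap.le_opNorm _ _)))
    simp_rw [hLf] at h
    exact h
  have i1 := integrable_mul_fderiv_schwartz hu he hψ hψc Θ
  have i2 : Integrable (fun X => (g X : ℂ) * (ψ X.1 * Θ X.2)) (μ.prod volume) :=
    MemLp.integrable_mul hg.ofReal (memLp_tensor hψ2 hΘ2)
  have re_part := part Complex.reCLM Complex.abs_re_le_norm
  have im_part := part Complex.imCLM Complex.abs_im_le_norm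
  apply Complex.ext
  · rw [Complex.neg_re]
    have e1 := Complex.reCLM.integral_comp_comm i1
    have e2 := Complex.reCLM.integral_comp_comm i2
    simp only [Complex.reCLM_apply, Complex.re_ofReal_mul] at e1 e2 re_part
    rw [← e1, ← e2]
    exact re_part
  · rw [Complex.neg_im]
    have e1 := Complex.imCLM.integral_comp_comm i1
    have e2 := Complex.imCLM.integral_comp_comm i2
    simp only [Complex.imCLM_apply, Complex.im_ofReal_mul] at e1 e2 im_part
    rw [← e1, ← e2]
    exact im_part

theorem prod_restrict_univ {α β : Type*} [MeasurableSpace α] [MeasurableSpace β] (μ : Measure α)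
    (ν : Measure β) [SFinite μ] [SFinite ν] (J : Set α) :
    (μ.restrict J).prod ν = (μ.prod ν).restrict (J ×ˢ univ) := by
  rw [← Measure.prod_restrict, Measure.restrict_univ]

theorem integrableOn_of_memLp_restrict {J : Set ℝ} {U : ℝ × E → ℂ}
    (hU : MemLp U 2 ((volume.restrict J).prod volume)) {A : Set ℝ} {B : Set E}
    (hA : IsCompact A) (hAJ : A ⊆ J) (hB : IsCompact B) :
    IntegrableOn U (A ×ˢ B) (volume.prod volume) := by
  rw [prod_restrict_univ] at hU
  have h1 : MemLp U 2 ((volume.prod volume).restrict (A ×ˢ B)) := by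
    have := hU.restrict (A ×ˢ B)
    rwa [Measure.restrict_restrict (hA.measurableSet.prod hB.measurableSet),
      inter_eq_left.2 (prod_mono hAJ (subset_univ B))] at this
  have : IsFiniteMeasure ((volume.prod volume).restrict (A ×ˢ B)) := ⟨by
    rw [Measure.restrict_apply_univ, Measure.prod_prod]
    exact ENNReal.mul_lt_top hA.measure_lt_top hB.measure_lt_top⟩
  exact h1.integrable (by norm_num)

theorem integral_restrict_eq_of_support {J : Set ℝ} {ψ : ℝ → ℝ} (hψ : tsupport ψ ⊆ J)
    (K : ℝ × E → ℂ) (h : ∀ X, ψ X.1 = 0 → K X = 0) :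
    ∫ X, K X ∂(volume.restrict J).prod volume = ∫ X, K X ∂volume.prod volume := by
  rw [prod_restrict_univ]
  refine setIntegral_eq_integral_of_forall_compl_eq_zero fun X hX => h X ?_
  exact image_eq_zero_of_notMem_tsupport fun hX' => hX ⟨hψ hX', mem_univ _⟩

theorem IsPFT.integral_mul_schwartz {α : Type*} [MeasurableSpace α] {μ : Measure α} [SFinite μ]
    {u U : α × E → ℂ} (h : IsPFT μ u U) (S : α → 𝓢(E, ℂ)) (a : α → ℂ)
    (i1 : Integrable (fun X => u X * (a X.1 * (𝓕 (S X.1)) X.2)) (μ.prod volume))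
    (i2 : Integrable (fun X => U X * (a X.1 * (S X.1) X.2)) (μ.prod volume)) :
    ∫ X, U X * (a X.1 * (S X.1) X.2) ∂μ.prod volume =
      ∫ X, u X * (a X.1 * (𝓕 (S X.1)) X.2) ∂μ.prod volume := by
  rw [integral_prod _ i1, integral_prod _ i2]
  refine integral_congr_ae ?_
  filter_upwards [h.slice] with t ht
  have := ht.integral_mul_schwartz (S t)
  simp_rw [mul_left_comm _ (a t), integral_const_mul, this]

theorem IsBump.exists_schwartz {E : Type*} [NormedAddCommGroup E] [NormedSpace ℝ E]
    {σ : E → ℝ} (hσ : IsBump univ σ) :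
    ∃ S : 𝓢(E, ℂ), ∀ x, S x = (σ x : ℂ) := by
  have h₁ : HasCompactSupport (Complex.ofRealCLM ∘ σ) := hσ.compact.comp_left rfl
  have h₂ : ContDiff ℝ ∞ (Complex.ofRealCLM ∘ σ) := Complex.ofRealCLM.contDiff.comp hσ.smooth
  exact ⟨h₁.toSchwartzMap h₂, fun x => rfl⟩

/-- If `g` is the weak derivative of `u` in the direction `e(t)`, then its partial Fourier
transform is that of `u` multiplied by `2πi ⟨k, e(t)⟩`. -/
theorem pft_weak_deriv {J : Set ℝ} (hJ : IsOpen J) {u g : ℝ × E → ℝ} {U G : ℝ × E → ℂ}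
    (hU : IsPFT (volume.restrict J) (fun X => (u X : ℂ)) U)
    (hG : IsPFT (volume.restrict J) (fun X => (g X : ℂ)) G)
    {e : ℝ → E} (he : Continuous e)
    (hweak : ∀ ψ θ, IsBump J ψ → IsBump univ θ →
      ∫ X, u X * (ψ X.1 * fderiv ℝ θ X.2 (e X.1)) ∂(volume.restrict J).prod volume =
        -∫ X, g X * (ψ X.1 * θ X.2) ∂(volume.restrict J).prod volume) :
    ∀ᵐ X ∂(volume.restrict J).prod volume,
      G X = 2 * Real.pi * Complex.I * (inner ℝ X.2 (e X.1) : ℝ) * U X := by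
  have hu : MemLp u 2 ((volume.restrict J).prod volume) := by simpa using hU.memLp.re
  have hg : MemLp g 2 ((volume.restrict J).prod volume) := by simpa using hG.memLp.re
  set K : ℝ × E → ℂ := fun X => G X - 2 * Real.pi * Complex.I * (inner ℝ X.2 (e X.1) : ℝ) * U X
    with hKdef
  have hmc : Continuous fun X : ℝ × E =>
      2 * Real.pi * Complex.I * ((inner ℝ X.2 (e X.1) : ℝ) : ℂ) := by fun_prop
  have hK : ∀ A B, IsCompact A → A ⊆ J → IsCompact B → IntegrableOn K (A ×ˢ B)
      (volume.prod volume) := fun A B hA hAJ hB =>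
    (integrableOn_of_memLp_restrict hG.memLp' hA hAJ hB).sub
      ((integrableOn_of_memLp_restrict hU.memLp' hA hAJ hB).continuousOn_mul hmc.continuousOn
        (hA.prod hB))
  have key : ∀ᵐ X ∂(volume : Measure ℝ).prod (volume : Measure E), X.1 ∈ J → K X = 0 := by
    refine ae_eq_zero_of_integral_prod_bump_eq_zero hJ hK fun ψ σ hψ hσ => ?_
    obtain ⟨S, hS⟩ := hσ.exists_schwartz
    have hψc := hψ.smooth.continuous
    have hinner : ∀ v : E, (fun k : E => (inner ℝ k v : ℝ)).HasTemperateGrowth := by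
      intro v; fun_prop
    have hψ2 : MemLp (fun t => (ψ t : ℂ)) 2 (volume.restrict J) :=
      (hψc.memLp_of_hasCompactSupport hψ.compact).ofReal
    -- The chain is `∫ G ψ σ = ∫ g ψ 𝓕σ = -∫ u ψ ∂_e 𝓕σ`. The derivative `∂_e 𝓕σ` is the transform
    -- of `-2πi⟨k, e(t)⟩ σ`, which is `S'`, and moving the transform back onto `u` turns the last
    -- integral into one of `U`.
    let S' : ℝ → 𝓢(E, ℂ) := fun t =>
      -(2 * Real.pi * Complex.I) • SchwartzMap.smulLeftCLM ℂ (fun k : E => (inner ℝ k (e t) : ℝ)) S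
    have hS' : ∀ t k, S' t k = -(2 * Real.pi * Complex.I) * ((inner ℝ k (e t) : ℝ) * σ k) := by
      intro t k
      simp [S', SchwartzMap.smulLeftCLM_apply_apply (hinner (e t)), hS]
    have hd : ∀ t x, fderiv ℝ (𝓕 S : 𝓢(E, ℂ)) x (e t) = (𝓕 (S' t)) x := by
      intro t x
      rw [← SchwartzMap.lineDerivOp_apply_eq_fderiv, SchwartzMap.lineDerivOp_fourier_eq]
    have h1 := weak_deriv_schwartz hu hg he hψc hψ.compact (fun θ hθ => hweak ψ θ hψ hθ) (𝓕 S)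
    have i1 := integrable_mul_fderiv_schwartz hu he hψc hψ.compact (𝓕 S)
    simp_rw [hd] at h1 i1
    have i2 : Integrable (fun X => U X * (ψ X.1 * (S' X.1) X.2))
        ((volume.restrict J).prod volume) := by
      have := hσ.smooth.continuous
      have hc : Continuous fun X : ℝ × E => (ψ X.1 : ℂ) * (S' X.1) X.2 := by
        simp_rw [hS']
        fun_prop
      have hbd : MemLp (fun X : ℝ × E => (|ψ X.1| * ‖e X.1‖) * (2 * Real.pi * (‖X.2‖ * |σ X.2|))) 2
          ((volume.restrict J).prod volume) := by
        refine memLp_tensor (a := fun t => |ψ t| * ‖e t‖)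
          (b := fun k => 2 * Real.pi * (‖k‖ * |σ k|)) ?_ ?_
        · exact Continuous.memLp_of_hasCompactSupport (by fun_prop) (hψ.compact.abs.mul_right)
        · exact Continuous.memLp_of_hasCompactSupport (by fun_prop)
            (hσ.compact.abs.mul_left.mul_left)
      refine MemLp.integrable_mul hU.memLp'
        (hbd.mono hc.aestronglyMeasurable (Eventually.of_forall fun X => ?_))
      rw [hS', norm_mul, norm_mul, norm_mul, norm_neg, Complex.norm_real, Complex.norm_real,
        Complex.norm_real]
      have hpi : ‖(2 * Real.pi * Complex.I : ℂ)‖ = 2 * Real.pi := by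
        simp [abs_of_pos Real.pi_pos]
      rw [hpi]
      refine le_trans ?_ (le_abs_self _)
      have := abs_real_inner_le_norm X.2 (e X.1)
      have hp := Real.pi_pos
      simp only [Real.norm_eq_abs]
      calc |ψ X.1| * (2 * Real.pi * (|inner ℝ X.2 (e X.1)| * |σ X.2|))
          ≤ |ψ X.1| * (2 * Real.pi * ((‖X.2‖ * ‖e X.1‖) * |σ X.2|)) := by gcongr
        _ = _ := by ring
    have h2 := hU.integral_mul_schwartz S' (fun t => (ψ t : ℂ)) i1 i2
    have i3 : Integrable (fun X => G X * (ψ X.1 * S X.2)) ((volume.restrict J).prod volume) :=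
      MemLp.integrable_mul hG.memLp' (memLp_tensor hψ2 (S.memLp 2 volume))
    have i4 : Integrable (fun X => (g X : ℂ) * (ψ X.1 * (𝓕 S) X.2))
        ((volume.restrict J).prod volume) :=
      MemLp.integrable_mul hG.memLp (memLp_tensor hψ2 ((𝓕 S).memLp 2 volume))
    have h3 := hG.integral_mul_schwartz (fun _ => S) (fun t => (ψ t : ℂ)) i4 i3
    have h4 : ∫ X, (ψ X.1 * σ X.2) • K X ∂(volume.restrict J).prod volume =
        ∫ X, (G X * (ψ X.1 * S X.2) + U X * (ψ X.1 * (S' X.1) X.2))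
          ∂(volume.restrict J).prod volume := by
      refine integral_congr_ae (Eventually.of_forall fun X => ?_)
      simp only [hKdef, hS, hS', Complex.real_smul, Complex.ofReal_mul]
      ring
    rw [← integral_restrict_eq_of_support hψ.support _ (fun X hX => by simp [hX]), h4,
      integral_add i3 i2, h2, h3, h1]
    ring
  rw [prod_restrict_univ]
  filter_upwards [ae_restrict_of_ae key, ae_restrict_mem (hJ.measurableSet.prod MeasurableSet.univ)]
    with X hX hXJ
  exact sub_eq_zero.1 (hX hXJ.1)

end WeakDerivative

/-! ### Weak time derivatives and the partial Fourier transform -/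

section TimeDerivative

theorem exists_Icc_of_compact {J : Set ℝ} (hJ : ∀ t ∈ J, Iic t ⊆ J) {A : Set ℝ} (hA : IsCompact A)
    (hAJ : A ⊆ J) {t₀ : ℝ} (ht₀ : t₀ ∈ J) :
    ∃ a b, a ≤ t₀ ∧ t₀ ≤ b ∧ A ⊆ Icc a b ∧ Icc a b ⊆ J := by
  have hA' : IsCompact (insert t₀ A) := hA.insert t₀
  have hne : (insert t₀ A).Nonempty := insert_nonempty _ _
  obtain ⟨b, hb, hbm⟩ := hA'.exists_isGreatest hne
  obtain ⟨a, ha, ham⟩ := hA'.exists_isLeast hne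
  have hbJ : b ∈ J := insert_subset ht₀ hAJ hb
  exact ⟨a, b, ham (mem_insert _ _), hbm (mem_insert _ _),
    fun x hx => ⟨ham (mem_insert_of_mem _ hx), hbm (mem_insert_of_mem _ hx)⟩,
    fun x hx => hJ b hbJ hx.2⟩

/-- A bump function of integral zero on a left half-line is the derivative of a bump function. -/
theorem IsBump.exists_deriv_eq {J : Set ℝ} (hJ : ∀ t ∈ J, Iic t ⊆ J) (hJne : J.Nonempty)
    {h : ℝ → ℝ} (hh : IsBump J h) (h0 : ∫ t, h t = 0) : ∃ ψ, IsBump J ψ ∧ deriv ψ = h := by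
  obtain ⟨t₀, ht₀⟩ := hJne
  obtain ⟨a, b, hat, htb, hsub, hIJ⟩ := exists_Icc_of_compact hJ hh.compact hh.support ht₀
  have hab : a ≤ b := hat.trans htb
  have hc : Continuous h := hh.smooth.continuous
  have hz : ∀ t, t ∉ Icc a b → h t = 0 := fun t ht =>
    image_eq_zero_of_notMem_tsupport fun h' => ht (hsub h')
  let ψ : ℝ → ℝ := fun t => ∫ τ in a..t, h τ
  have hd : ∀ t, HasDerivAt ψ (h t) t := fun t => hc.integral_hasStrictDerivAt a t |>.hasDerivAt
  have hderiv : deriv ψ = h := funext fun t => (hd t).deriv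
  have hψz : ∀ t, t ∉ Icc a b → ψ t = 0 := by
    intro t ht
    rw [mem_Icc, not_and_or, not_le, not_le] at ht
    rcases ht with ht | ht
    · refine intervalIntegral.integral_zero_ae (Eventually.of_forall fun x hx => ?_)
      rw [uIoc_of_ge ht.le] at hx
      -- For `t < a` the integration interval is `(t, a]` and contains `a`, which lies in the
      -- supporting interval. There `h` vanishes as a limit from the left.
      by_cases hxa : x = a
      · have : h =ᶠ[𝓝[<] a] 0 := by
          filter_upwards [self_mem_nhdsWithin] with y hy
          exact hz y fun h' => absurd h'.1 (not_le.2 hy)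
        rw [hxa]
        have h1 : Tendsto h (𝓝[<] a) (𝓝 (h a)) := hc.continuousAt.mono_left nhdsWithin_le_nhds
        exact tendsto_nhds_unique h1 (tendsto_const_nhds.congr' this.symm)
      · exact hz x fun h' => hxa (le_antisymm hx.2 h'.1)
    · have h1 : ∫ τ in a..t, h τ = ∫ τ, h τ := by
        rw [intervalIntegral.integral_of_le (hab.trans ht.le), ← integral_Icc_eq_integral_Ioc]
        refine setIntegral_eq_integral_of_forall_compl_eq_zero fun x hx => hz x fun h' => hx ?_
        exact ⟨h'.1, h'.2.trans ht.le⟩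
      change ∫ τ in a..t, h τ = 0
      rw [h1, h0]
  have hts : tsupport ψ ⊆ Icc a b := by
    refine closure_minimal (fun x hx => ?_) isClosed_Icc
    by_contra hcon
    exact hx (hψz x hcon)
  refine ⟨ψ, ⟨?_, ?_, hts.trans hIJ⟩, hderiv⟩
  · rw [contDiff_infty_iff_deriv, hderiv]
    exact ⟨fun t => (hd t).differentiableAt, hh.smooth⟩
  · exact isCompact_Icc.of_isClosed_subset (isClosed_tsupport _) hts

/-- Integration by parts for absolutely continuous functions; the primitive of a locally integrable
`f` need not be differentiable everywhere. -/
theorem integral_deriv_mul_primitive {f : ℝ → ℝ} (hf : ∀ a b, IntervalIntegrable f volume a b)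
    {ψ : ℝ → ℝ} (hψ : IsBump univ ψ) (t₀ : ℝ) :
    ∫ t, deriv ψ t * ∫ τ in t₀..t, f τ = -∫ t, ψ t * f t := by
  obtain ⟨a, b, hat, htb, hsub, -⟩ := exists_Icc_of_compact (fun _ _ => subset_univ _)
    hψ.compact (subset_univ _) (mem_univ t₀)
  -- a slightly larger interval, so that `ψ` vanishes at the end points
  have hab : a - 1 ≤ b + 1 := by linarith
  have hz : ∀ t, t ∉ Icc a b → ψ t = 0 := fun t ht =>
    image_eq_zero_of_notMem_tsupport fun h' => ht (hsub h')
  have hz' : ∀ t, t ∉ Icc a b → deriv ψ t = 0 := fun t ht =>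
    image_eq_zero_of_notMem_tsupport fun h' => ht (hsub (tsupport_deriv_subset h'))
  have hII : Icc a b ⊆ Ioc (a - 1) (b + 1) := fun x hx => ⟨by linarith [hx.1], by linarith [hx.2]⟩
  have hu : uIcc (a - 1) (b + 1) = Icc (a - 1) (b + 1) := uIcc_of_le hab
  have hF : AbsolutelyContinuousOnInterval (fun t => ∫ τ in t₀..t, f τ) (a - 1) (b + 1) :=
    (hf _ _).absolutelyContinuousOnInterval_intervalIntegral (by
      rw [hu]; constructor <;> linarith)
  have hψac : AbsolutelyContinuousOnInterval ψ (a - 1) (b + 1) :=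
    ((hψ.smooth.of_le (by simp)).contDiffOn (n := 1)).absolutelyContinuousOnInterval
  have key := hF.integral_mul_deriv_eq_deriv_mul hψac
  rw [hz (a - 1) (fun h => by linarith [h.1]), hz (b + 1) (fun h => by linarith [h.2])] at key
  have e1 : ∫ t, deriv ψ t * ∫ τ in t₀..t, f τ =
      ∫ t in (a - 1)..(b + 1), (∫ τ in t₀..t, f τ) * deriv ψ t := by
    rw [intervalIntegral.integral_of_le hab]
    rw [← setIntegral_eq_integral_of_forall_compl_eq_zero (s := Ioc (a - 1) (b + 1))]
    · simp_rw [mul_comm]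
    · intro t ht
      rw [hz' t fun h => ht (hII h), zero_mul]
  have e2 : ∫ t, ψ t * f t =
      ∫ t in (a - 1)..(b + 1), deriv (fun t => ∫ τ in t₀..t, f τ) t * ψ t := by
    rw [← setIntegral_eq_integral_of_forall_compl_eq_zero (s := Ioc (a - 1) (b + 1)),
      ← intervalIntegral.integral_of_le hab]
    · refine intervalIntegral.integral_congr_ae ?_
      filter_upwards [(hf (a - 1) (b + 1)).ae_hasDerivAt_integral] with t ht htI
      have := ht (uIoc_subset_uIcc htI) t₀ (by rw [hu]; constructor <;> linarith)
      rw [this.deriv, mul_comm]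
    · intro t ht
      rw [hz t fun h => ht (hII h), zero_mul]
  rw [e1, e2, key]
  ring

theorem integral_deriv_smul_primitive {f : ℝ → ℂ} (hf : ∀ a b, IntervalIntegrable f volume a b)
    {ψ : ℝ → ℝ} (hψ : IsBump univ ψ) (t₀ : ℝ) :
    ∫ t, deriv ψ t • ∫ τ in t₀..t, f τ = -∫ t, ψ t • f t := by
  have hli : LocallyIntegrable f volume := by
    rw [locallyIntegrable_iff]
    intro A hA
    obtain ⟨a, b, hat, htb, hsub, -⟩ := exists_Icc_of_compact (fun _ _ => subset_univ _)
      hA (subset_univ _) (mem_univ 0)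
    exact ((intervalIntegrable_iff_integrableOn_Icc_of_le (hat.trans htb)).1 (hf a b)).mono_set hsub
  have hcont : Continuous fun t => ∫ τ in t₀..t, f τ :=
    intervalIntegral.continuous_primitive hf t₀
  have hψ' : Continuous (deriv ψ) := hψ.smooth.continuous_deriv (by simp)
  have i1 : Integrable fun t => deriv ψ t • ∫ τ in t₀..t, f τ :=
    Continuous.integrable_of_hasCompactSupport (by fun_prop) hψ.compact.deriv.smul_right
  have i2 : Integrable fun t => ψ t • f t :=
    hli.integrable_smul_left_of_hasCompactSupport hψ.smooth.continuous hψ.compact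
  have hre := integral_deriv_mul_primitive (f := fun t => (f t).re)
    (fun a b => ⟨(hf a b).1.re, (hf a b).2.re⟩) hψ t₀
  have him := integral_deriv_mul_primitive (f := fun t => (f t).im)
    (fun a b => ⟨(hf a b).1.im, (hf a b).2.im⟩) hψ t₀
  have cre : ∀ t, ∫ τ in t₀..t, (f τ).re = (∫ τ in t₀..t, f τ).re := fun t =>
    Complex.reCLM.intervalIntegral_comp_comm (hf t₀ t)
  have cim : ∀ t, ∫ τ in t₀..t, (f τ).im = (∫ τ in t₀..t, f τ).im := fun t =>
    Complex.imCLM.intervalIntegral_comp_comm (hf t₀ t)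
  simp_rw [cre] at hre
  simp_rw [cim] at him
  apply Complex.ext
  · rw [Complex.neg_re]
    have e1 := Complex.reCLM.integral_comp_comm i1
    have e2 := Complex.reCLM.integral_comp_comm i2
    simp only [Complex.reCLM_apply, Complex.smul_re, smul_eq_mul] at e1 e2
    rw [← e1, ← e2]
    exact hre
  · rw [Complex.neg_im]
    have e1 := Complex.imCLM.integral_comp_comm i1
    have e2 := Complex.imCLM.integral_comp_comm i2
    simp only [Complex.imCLM_apply, Complex.smul_im, smul_eq_mul] at e1 e2
    rw [← e1, ← e2]
    exact him

variable {E : Type*} [NormedAddCommGroup E] [InnerProductSpace ℝ E] [FiniteDimensional ℝ E]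
  [MeasurableSpace E] [BorelSpace E]

theorem integrable_mul_tensor {α β R : Type*} [MeasurableSpace α] [MeasurableSpace β]
    [NormedField R] {μ : Measure α} {ν : Measure β} [SFinite μ] [SFinite ν] {u : α × β → R}
    {a : α → R} {b : β → R} (hu : MemLp u 2 (μ.prod ν)) (ha : MemLp a 2 μ) (hb : MemLp b 2 ν) :
    Integrable (fun X => u X * (a X.1 * b X.2)) (μ.prod ν) :=
  MemLp.integrable_mul hu (memLp_tensor ha hb)

theorem memLp_ofReal {α : Type*} [MeasurableSpace α] {μ : Measure α} {p : ℝ≥0∞} {f : α → ℝ}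
    (hf : MemLp f p μ) : MemLp (fun x => (f x : ℂ)) p μ :=
  Complex.ofRealCLM.comp_memLp' hf

theorem integrable_ofReal_mul_tensor {α β : Type*} [MeasurableSpace α] [MeasurableSpace β]
    {μ : Measure α} {ν : Measure β} [SFinite μ] [SFinite ν] {u : α × β → ℂ}
    {a : α → ℝ} {b : β → ℂ} (hu : MemLp u 2 (μ.prod ν)) (ha : MemLp a 2 μ) (hb : MemLp b 2 ν) :
    Integrable (fun X => u X * ((a X.1 : ℂ) * b X.2)) (μ.prod ν) := by
  have ha' : MemLp (fun t => (a t : ℂ)) 2 μ := memLp_ofReal ha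
  exact integrable_mul_tensor (R := ℂ) (a := fun t => (a t : ℂ)) hu ha' hb

theorem ae_integral_eq_zero_of_weak {μ : Measure ℝ} [SFinite μ]
    {k : ℝ × E → ℝ}
    (hi : ∀ b : E → ℝ, MemLp b 2 volume → Integrable (fun X => k X * b X.2) (μ.prod volume))
    (hweak : ∀ θ : E → ℝ, IsBump univ θ → ∫ X, k X * θ X.2 ∂μ.prod volume = 0) :
    ∀ᵐ x : E, ∫ t, k (t, x) ∂μ = 0 := by
  refine ae_eq_zero_of_integral_contDiff_smul_eq_zero ?_ fun θ hθ hθc => ?_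
  · refine (locallyIntegrable_iff).2 fun B hB => ?_
    have hb : MemLp (B.indicator (1 : E → ℝ)) 2 volume :=
      memLp_indicator_const 2 hB.measurableSet 1 (Or.inr hB.measure_lt_top.ne)
    have h2 := (hi _ hb).integral_prod_right
    rw [← integrable_indicator_iff hB.measurableSet]
    refine h2.congr (Eventually.of_forall fun x => ?_)
    by_cases hx : x ∈ B <;> simp [hx]
  · have hb : MemLp θ 2 (volume : Measure E) :=
      hθ.continuous.memLp_of_hasCompactSupport hθc
    have h3 := hweak θ ⟨hθ, hθc, subset_univ _⟩
    rw [integral_prod_symm _ (hi θ hb)] at h3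
    rw [← h3]
    refine integral_congr_ae (Eventually.of_forall fun x => ?_)
    simp only [smul_eq_mul]
    rw [integral_mul_const, mul_comm]

/-- No derivative falls on the spatial factor, so no cutoff is needed. Testing with all `θ` shows
that `∫ (u ψ' + y ψ) dt = 0` for almost every point in space, and this may be integrated against any
square integrable `Θ`. -/
theorem weak_time_deriv_schwartz {μ : Measure ℝ} [SFinite μ]
    {u y : ℝ × E → ℝ} (hu : MemLp u 2 (μ.prod volume)) (hy : MemLp y 2 (μ.prod volume))
    {ψ ψ' : ℝ → ℝ} (hψ : MemLp ψ 2 μ) (hψ' : MemLp ψ' 2 μ)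
    (hweak : ∀ θ, IsBump univ θ →
      ∫ X, u X * (ψ' X.1 * θ X.2) ∂μ.prod volume =
        -∫ X, y X * (ψ X.1 * θ X.2) ∂μ.prod volume) (Θ : 𝓢(E, ℂ)) :
    ∫ X, (u X : ℂ) * (ψ' X.1 * Θ X.2) ∂μ.prod volume =
        -∫ X, (y X : ℂ) * (ψ X.1 * Θ X.2) ∂μ.prod volume := by
  obtain ⟨k, hk⟩ : ∃ k : ℝ × E → ℝ, ∀ X, k X = u X * ψ' X.1 + y X * ψ X.1 := ⟨_, fun _ => rfl⟩
  have hzero : ∀ᵐ x : E, ∫ t, k (t, x) ∂μ = 0 := by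
    have e : ∀ (b : E → ℝ) (X : ℝ × E),
        k X * b X.2 = u X * (ψ' X.1 * b X.2) + y X * (ψ X.1 * b X.2) :=
      fun b X => by rw [hk]; ring
    refine ae_integral_eq_zero_of_weak (fun b hb => ?_) fun θ hθ => ?_
    · simp_rw [e]
      exact (integrable_mul_tensor hu hψ' hb).add (integrable_mul_tensor hy hψ hb)
    · have hb : MemLp θ 2 (volume : Measure E) :=
        hθ.smooth.continuous.memLp_of_hasCompactSupport hθ.compact
      simp_rw [e]
      rw [integral_add (integrable_mul_tensor hu hψ' hb)
        (integrable_mul_tensor hy hψ hb), hweak θ hθ, neg_add_cancel]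
  have hΘ2 : MemLp Θ 2 volume := Θ.memLp 2 volume
  have hu' : MemLp (fun X => (u X : ℂ)) 2 (μ.prod volume) := memLp_ofReal hu
  have hy' : MemLp (fun X => (y X : ℂ)) 2 (μ.prod volume) := memLp_ofReal hy
  have i1 := integrable_ofReal_mul_tensor hu' hψ' hΘ2
  have i2 := integrable_ofReal_mul_tensor hy' hψ hΘ2
  rw [eq_neg_iff_add_eq_zero, ← integral_add i1 i2]
  have e : ∀ X : ℝ × E, (u X : ℂ) * (ψ' X.1 * Θ X.2) + (y X : ℂ) * (ψ X.1 * Θ X.2) =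
      (k X : ℂ) * Θ X.2 := fun X => by rw [hk]; push_cast; ring
  have i12 : Integrable (fun X : ℝ × E => (k X : ℂ) * Θ X.2) (μ.prod volume) :=
    (i1.add i2).congr (Eventually.of_forall e)
  simp_rw [e]
  rw [integral_prod_symm _ i12]
  refine integral_eq_zero_of_ae ?_
  filter_upwards [hzero] with x hx
  have h0 : ∫ t, (k (t, x) : ℂ) ∂μ = 0 := by
    rw [integral_complex_ofReal, hx, Complex.ofReal_zero]
  rw [integral_mul_const, h0, zero_mul, Pi.zero_apply]

/-- An integral with a variable end point is a difference of integrals of indicators of jointly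
measurable sets. -/
theorem stronglyMeasurable_primitive {E : Type*} [MeasurableSpace E] {Y : ℝ × E → ℂ} (hY : StronglyMeasurable Y) (t₀ : ℝ) :
    StronglyMeasurable fun X : ℝ × E => ∫ τ in t₀..X.1, Y (τ, X.2) := by
  have h : ∀ S : Set ((ℝ × E) × ℝ), MeasurableSet S →
      StronglyMeasurable fun X : ℝ × E => ∫ τ, S.indicator (fun q => Y (q.2, q.1.2)) (X, τ) :=
    fun S hS => ((hY.comp_measurable (by fun_prop)).indicator hS).integral_prod_right'
  have m1 : MeasurableSet {q : (ℝ × E) × ℝ | t₀ < q.2 ∧ q.2 ≤ q.1.1} :=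
    (measurableSet_lt measurable_const measurable_snd).inter
      (measurableSet_le measurable_snd measurable_fst.fst)
  have m2 : MeasurableSet {q : (ℝ × E) × ℝ | q.1.1 < q.2 ∧ q.2 ≤ t₀} :=
    (measurableSet_lt measurable_fst.fst measurable_snd).inter
      (measurableSet_le measurable_snd measurable_const)
  have e : (fun X : ℝ × E => ∫ τ in t₀..X.1, Y (τ, X.2)) = fun X =>
      (∫ τ, {q : (ℝ × E) × ℝ | t₀ < q.2 ∧ q.2 ≤ q.1.1}.indicator (fun q => Y (q.2, q.1.2)) (X, τ)) -
      ∫ τ, {q : (ℝ × E) × ℝ | q.1.1 < q.2 ∧ q.2 ≤ t₀}.indicator (fun q => Y (q.2, q.1.2)) (X, τ) := by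
    ext X
    rw [intervalIntegral, ← integral_indicator measurableSet_Ioc,
      ← integral_indicator measurableSet_Ioc]
    rfl
  rw [e]
  exact (h _ m1).sub (h _ m2)

theorem ae_intervalIntegrable_slice {Y : ℝ × E → ℂ} (hY : MemLp Y 2 (volume.prod volume)) :
    ∀ᵐ k : E, ∀ a b, IntervalIntegrable (fun t => Y (t, k)) volume a b := by
  have h1 : MemLp (fun X : E × ℝ => Y X.swap) 2 (volume.prod volume) :=
    hY.comp_measurePreserving Measure.measurePreserving_swap
  filter_upwards [ae_memLp_slice h1] with k hk a b
  have hl : LocallyIntegrable (fun t => Y (t, k)) volume := hk.locallyIntegrable (by norm_num)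
  exact ((locallyIntegrable_iff.1 hl) _ isCompact_uIcc).intervalIntegrable

theorem integrableOn_primitive {Y : ℝ × E → ℂ} (hYm : StronglyMeasurable Y)
    (hY : MemLp Y 2 (volume.prod volume)) (t₀ : ℝ) {A : Set ℝ} {B : Set E} (hA : IsCompact A)
    (hB : IsCompact B) :
    IntegrableOn (fun X : ℝ × E => ∫ τ in t₀..X.1, Y (τ, X.2)) (A ×ˢ B) (volume.prod volume) := by
  obtain ⟨a, b, hat, htb, hsub, -⟩ := exists_Icc_of_compact (fun _ _ => subset_univ _)
    hA (subset_univ _) (mem_univ t₀)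
  have hYi : Integrable Y (((volume : Measure ℝ).restrict (Icc a b)).prod
      ((volume : Measure E).restrict B)) := by
    rw [Measure.prod_restrict]
    refine integrableOn_of_memLp_restrict (J := univ) ?_ isCompact_Icc (subset_univ _) hB
    rwa [Measure.restrict_univ]
  have hw : Integrable (fun k => ∫ τ in Icc a b, ‖Y (τ, k)‖) (volume.restrict B) :=
    hYi.norm.integral_prod_right
  have : IsFiniteMeasure ((volume : Measure ℝ).restrict A) := ⟨by
    rw [Measure.restrict_apply_univ]; exact hA.measure_lt_top⟩
  have hw2 : Integrable (fun X : ℝ × E => ∫ τ in Icc a b, ‖Y (τ, X.2)‖)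
      ((volume.prod volume).restrict (A ×ˢ B)) := by
    rw [← Measure.prod_restrict]
    exact hw.comp_snd _
  refine hw2.mono' (stronglyMeasurable_primitive hYm t₀).aestronglyMeasurable ?_
  rw [ae_restrict_iff' (hA.measurableSet.prod hB.measurableSet)]
  have hsl : ∀ᵐ X ∂(volume : Measure ℝ).prod (volume : Measure E),
      ∀ a b, IntervalIntegrable (fun t => Y (t, X.2)) volume a b :=
    Measure.quasiMeasurePreserving_snd.ae (ae_intervalIntegrable_slice hY)
  filter_upwards [hsl] with X hX hXA
  have hXI := hsub hXA.1
  refine intervalIntegral.norm_integral_le_integral_norm_uIoc.trans ?_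
  refine setIntegral_mono_set ?_ (Eventually.of_forall fun _ => norm_nonneg _)
    (LE.le.eventuallyLE ?_)
  · exact ((intervalIntegrable_iff_integrableOn_Icc_of_le (hat.trans htb)).1 (hX a b)).norm
  · exact uIoc_subset_uIcc.trans (uIcc_subset_Icc ⟨hat, htb⟩ hXI)

theorem IsPFT.integral_mul_tensor_schwartz {α : Type*} [MeasurableSpace α] {μ : Measure α}
    [SFinite μ] {u U : α × E → ℂ} (h : IsPFT μ u U) {a : α → ℝ} (ha : MemLp a 2 μ) (S : 𝓢(E, ℂ)) :
    ∫ X, U X * (a X.1 * S X.2) ∂μ.prod volume =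
      ∫ X, u X * (a X.1 * (𝓕 S) X.2) ∂μ.prod volume := by
  have hS : MemLp S 2 (volume : Measure E) := S.memLp 2 volume
  have hFS : MemLp (𝓕 S : 𝓢(E, ℂ)) 2 (volume : Measure E) := (𝓕 S).memLp 2 volume
  have i1 := integrable_ofReal_mul_tensor h.memLp ha hFS
  have i2 := integrable_ofReal_mul_tensor h.memLp' ha hS
  exact h.integral_mul_schwartz (fun _ => S) (fun t => (a t : ℂ)) i1 i2

theorem pft_weak_time_deriv_bump {μ : Measure ℝ} [SFinite μ] [IsFiniteMeasureOnCompacts μ]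
    {u y : ℝ × E → ℝ} {U Y : ℝ × E → ℂ}
    (hU : IsPFT μ (fun X => (u X : ℂ)) U) (hY : IsPFT μ (fun X => (y X : ℂ)) Y)
    {ψ : ℝ → ℝ} (hψ : ContDiff ℝ ∞ ψ) (hψc : HasCompactSupport ψ)
    (hweak : ∀ θ, IsBump univ θ →
      ∫ X, u X * (deriv ψ X.1 * θ X.2) ∂μ.prod volume =
        -∫ X, y X * (ψ X.1 * θ X.2) ∂μ.prod volume)
    {σ : E → ℝ} (hσ : IsBump univ σ) :
    ∫ X, (deriv ψ X.1 * σ X.2) • U X ∂μ.prod volume =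
        -∫ X, (ψ X.1 * σ X.2) • Y X ∂μ.prod volume := by
  have hu : MemLp u 2 (μ.prod volume) := by simpa using hU.memLp.re
  have hy : MemLp y 2 (μ.prod volume) := by simpa using hY.memLp.re
  obtain ⟨S, hS⟩ := hσ.exists_schwartz
  have hL1 : MemLp ψ 2 μ := hψ.continuous.memLp_of_hasCompactSupport hψc
  have hL2 : MemLp (deriv ψ) 2 μ :=
    (hψ.continuous_deriv (by simp)).memLp_of_hasCompactSupport hψc.deriv
  have h1 := weak_time_deriv_schwartz hu hy hL1 hL2 hweak (𝓕 S)
  have h2 := hU.integral_mul_tensor_schwartz hL2 S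
  have h3 := hY.integral_mul_tensor_schwartz hL1 S
  have e : ∀ (χ : ℝ → ℝ) (V : ℝ × E → ℂ) (X : ℝ × E),
      (χ X.1 * σ X.2) • V X = V X * (χ X.1 * S X.2) := fun χ V X => by
    rw [hS, Complex.real_smul, Complex.ofReal_mul]; ring
  simp_rw [e]
  rw [h2, h3, h1]

/-- If `y` is the weak time derivative of `u`, then the partial Fourier transform of `u` is
absolutely continuous in time, with derivative the partial Fourier transform of `y`. -/
theorem pft_weak_time_deriv {J : Set ℝ} (hJ : IsOpen J) (hJ' : ∀ t ∈ J, Iic t ⊆ J)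
    {u y : ℝ × E → ℝ} {U Y : ℝ × E → ℂ}
    (hU : IsPFT (volume.restrict J) (fun X => (u X : ℂ)) U)
    (hY : IsPFT (volume.restrict J) (fun X => (y X : ℂ)) Y)
    (hweak : ∀ ψ θ, IsBump J ψ → IsBump univ θ →
      ∫ X, u X * (deriv ψ X.1 * θ X.2) ∂(volume.restrict J).prod volume =
        -∫ X, y X * (ψ X.1 * θ X.2) ∂(volume.restrict J).prod volume)
    {t₀ : ℝ} (ht₀ : t₀ ∈ J) :
    ∃ c : E → ℂ, ∀ᵐ X ∂(volume.restrict J).prod volume,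
      U X = c X.2 + ∫ τ in t₀..X.1, Y (τ, X.2) := by
  have hJm : MeasurableSet (J ×ˢ (univ : Set E)) := hJ.measurableSet.prod MeasurableSet.univ
  -- a measurable representative, extended by zero
  let Y₁ : ℝ × E → ℂ := (J ×ˢ univ).indicator (hY.memLp'.1.mk Y)
  have hY₁m : StronglyMeasurable Y₁ := hY.memLp'.1.stronglyMeasurable_mk.indicator hJm
  have hY₁e : Y =ᵐ[(volume.restrict J).prod volume] Y₁ := by
    have h1 : ∀ᵐ X ∂(volume.restrict J).prod (volume : Measure E), X ∈ J ×ˢ (univ : Set E) := by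
      rw [prod_restrict_univ]; exact ae_restrict_mem hJm
    filter_upwards [hY.memLp'.1.ae_eq_mk, h1] with X hX hXJ
    rw [hX]; exact (indicator_of_mem hXJ _).symm
  have hY₁L : MemLp Y₁ 2 (volume.prod volume) := by
    rw [memLp_indicator_iff_restrict hJm, ← prod_restrict_univ]
    exact hY.memLp'.ae_eq hY.memLp'.1.ae_eq_mk
  let V : ℝ × E → ℂ := fun X => ∫ τ in t₀..X.1, Y₁ (τ, X.2)
  -- `U` and the primitive `V` of `Y₁` have the same weak time derivative. It remains to see that
  -- their difference is independent of time, which is the du Bois-Reymond lemma with `k` as a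
  -- parameter.
  let D : ℝ × E → ℂ := fun X => U X - V X
  have hUi : ∀ A B, IsCompact A → A ⊆ J → IsCompact B → IntegrableOn U (A ×ˢ B)
      (volume.prod volume) := fun A B hA hAJ hB =>
    integrableOn_of_memLp_restrict hU.memLp' hA hAJ hB
  have hVi : ∀ A B, IsCompact A → A ⊆ J → IsCompact B → IntegrableOn V (A ×ˢ B)
      (volume.prod volume) := fun A B hA _ hB => integrableOn_primitive hY₁m hY₁L t₀ hA hB
  have hY₁i : ∀ A B, IsCompact A → A ⊆ J → IsCompact B → IntegrableOn Y₁ (A ×ˢ B)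
      (volume.prod volume) := fun A B hA hAJ hB =>
    integrableOn_of_memLp_restrict (hY.memLp'.ae_eq hY₁e) hA hAJ hB
  have hDi : ∀ A B, IsCompact A → A ⊆ J → IsCompact B → IntegrableOn D (A ×ˢ B)
      (volume.prod volume) := fun A B hA hAJ hB => (hUi A B hA hAJ hB).sub (hVi A B hA hAJ hB)
  have itest : ∀ {K : ℝ × E → ℂ}, (∀ A B, IsCompact A → A ⊆ J → IsCompact B →
      IntegrableOn K (A ×ˢ B) (volume.prod volume)) → ∀ {ψ σ}, IsBump J ψ → IsBump univ σ →
      Integrable (fun X => (ψ X.1 * σ X.2) • K X) (volume.prod volume) := by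
    intro K hK ψ σ hψ hσ
    obtain ⟨Ca, hCa⟩ := hψ.exists_bound
    obtain ⟨Cb, hCb⟩ := hσ.exists_bound
    exact integrable_prod_bump hK hψ.smooth.continuous.measurable hσ.smooth.continuous.measurable
      hCa hCb hψ.compact hψ.support hσ.compact
      (fun _ hx => image_eq_zero_of_notMem_tsupport hx)
      (fun _ hx => image_eq_zero_of_notMem_tsupport hx)
  have hbd : ∀ {ψ}, IsBump J ψ → IsBump J (deriv ψ) := fun {ψ} hψ =>
    ⟨(contDiff_infty_iff_deriv.1 hψ.smooth).2, hψ.compact.deriv,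
      tsupport_deriv_subset.trans hψ.support⟩
  have hUweak : ∀ ψ σ, IsBump J ψ → IsBump univ σ →
      ∫ X, (deriv ψ X.1 * σ X.2) • U X ∂volume.prod volume =
        -∫ X, (ψ X.1 * σ X.2) • Y₁ X ∂volume.prod volume := by
    intro ψ σ hψ hσ
    have h0 := pft_weak_time_deriv_bump hU hY hψ.smooth hψ.compact (fun θ hθ => hweak ψ θ hψ hθ) hσ
    rw [← integral_restrict_eq_of_support (hbd hψ).support _ (fun X hX => by simp [hX]),
      ← integral_restrict_eq_of_support hψ.support _ (fun X hX => by simp [hX]), h0]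
    congr 1
    refine integral_congr_ae ?_
    filter_upwards [hY₁e] with X hX
    rw [← hX]
  have hVweak : ∀ ψ σ, IsBump J ψ → IsBump univ σ →
      ∫ X, (deriv ψ X.1 * σ X.2) • V X ∂volume.prod volume =
        -∫ X, (ψ X.1 * σ X.2) • Y₁ X ∂volume.prod volume := by
    intro ψ σ hψ hσ
    rw [integral_prod_symm _ (itest hVi (hbd hψ) hσ), integral_prod_symm _ (itest hY₁i hψ hσ),
      ← integral_neg]
    refine integral_congr_ae ?_
    filter_upwards [ae_intervalIntegrable_slice hY₁L] with k hk
    have h1 := integral_deriv_smul_primitive hk ⟨hψ.smooth, hψ.compact, subset_univ _⟩ t₀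
    simp_rw [mul_comm _ (σ k), mul_smul, integral_smul, V, h1, smul_neg]
  have hDweak : ∀ h σ, IsBump J h → ∫ t, h t = 0 → IsBump univ σ →
      ∫ X, (h X.1 * σ X.2) • D X ∂volume.prod volume = 0 := by
    intro h σ hh h0 hσ
    obtain ⟨ψ, hψ, rfl⟩ := hh.exists_deriv_eq hJ' ⟨t₀, ht₀⟩ h0
    simp_rw [D, smul_sub]
    rw [integral_sub (itest hUi hh hσ) (itest hVi hh hσ), hUweak ψ σ hψ hσ, hVweak ψ σ hψ hσ,
      sub_self]
  -- A bump of integral 1. Any `ψ` differs from `(∫ ψ) ψ₀` by a bump of mean zero, hence by the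
  -- derivative of a bump in `J`, so averaging `D` against `ψ₀` gives the candidate for its
  -- time-independent value.
  obtain ⟨ψ₀, hψ₀, hψ₀1⟩ : ∃ ψ₀, IsBump J ψ₀ ∧ ∫ t, ψ₀ t = 1 := by
    obtain ⟨ε, hε, hball⟩ := Metric.isOpen_iff.1 hJ t₀ ht₀
    let b : ContDiffBump t₀ := ⟨ε / 4, ε / 2, by positivity, by linarith⟩
    refine ⟨b.normed volume, ⟨b.contDiff_normed, b.hasCompactSupport_normed, ?_⟩,
      b.integral_normed⟩
    rw [b.tsupport_normed_eq]
    refine (Metric.closedBall_subset_ball ?_).trans hball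
    change ε / 2 < ε
    linarith
  let c : E → ℂ := fun k => ∫ t, ψ₀ t • D (t, k)
  have hci : ∀ B, IsCompact B → IntegrableOn c B := by
    intro B hB
    obtain ⟨Ca, hCa⟩ := hψ₀.exists_bound
    have h1 := integrable_prod_bump hDi hψ₀.smooth.continuous.measurable
      (measurable_one.indicator hB.measurableSet) hCa (abs_indicator_one_le B) hψ₀.compact
      hψ₀.support hB (fun _ hx => image_eq_zero_of_notMem_tsupport hx)
      (fun x hx => indicator_of_notMem hx _)
    rw [← integrable_indicator_iff hB.measurableSet]
    refine h1.integral_prod_right.congr (Eventually.of_forall fun k => ?_)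
    by_cases hk : k ∈ B <;> simp [hk, c]
  have hci' : ∀ A B, IsCompact A → A ⊆ J → IsCompact B →
      IntegrableOn (fun X : ℝ × E => c X.2) (A ×ˢ B) (volume.prod volume) := by
    intro A B hA _ hB
    have : IsFiniteMeasure ((volume : Measure ℝ).restrict A) := ⟨by
      rw [Measure.restrict_apply_univ]; exact hA.measure_lt_top⟩
    rw [IntegrableOn, ← Measure.prod_restrict]
    exact (hci B hB).comp_snd _
  have key : ∀ᵐ X ∂(volume : Measure ℝ).prod (volume : Measure E),
      X.1 ∈ J → D X - c X.2 = 0 := by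
    refine ae_eq_zero_of_integral_prod_bump_eq_zero hJ
      (fun A B hA hAJ hB => (hDi A B hA hAJ hB).sub (hci' A B hA hAJ hB)) fun ψ σ hψ hσ => ?_
    set m := ∫ t, ψ t with hm
    have iψ : Integrable ψ := hψ.smooth.continuous.integrable_of_hasCompactSupport hψ.compact
    have iψ₀ : Integrable ψ₀ := hψ₀.smooth.continuous.integrable_of_hasCompactSupport hψ₀.compact
    have hh : IsBump J (fun t => ψ t - m * ψ₀ t) := by
      refine ⟨hψ.smooth.sub (contDiff_const.mul hψ₀.smooth),
        hψ.compact.sub hψ₀.compact.mul_left, ?_⟩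
      refine (tsupport_sub _ _).trans (union_subset hψ.support ?_)
      exact (closure_mono (Function.support_mul_subset_right _ _)).trans hψ₀.support
    have h0 : ∫ t, (ψ t - m * ψ₀ t) = 0 := by
      rw [integral_sub iψ (iψ₀.const_mul m), integral_const_mul, hψ₀1, mul_one, sub_self]
    have h1 := hDweak _ σ hh h0 hσ
    have h2 : ∫ X, (ψ X.1 * σ X.2) • D X ∂volume.prod volume =
        m • ∫ X, (ψ₀ X.1 * σ X.2) • D X ∂volume.prod volume := by
      have i₀ : Integrable (fun X : ℝ × E => m • (ψ₀ X.1 * σ X.2) • D X) (volume.prod volume) :=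
        (itest hDi hψ₀ hσ).smul m
      rw [← sub_eq_zero, ← integral_smul, ← integral_sub (itest hDi hψ hσ) i₀, ← h1]
      refine integral_congr_ae (Eventually.of_forall fun X => ?_)
      simp only [smul_smul, ← sub_smul]
      congr 1; ring
    have h3 : ∫ X, (ψ₀ X.1 * σ X.2) • D X ∂volume.prod volume = ∫ k, σ k • c k := by
      rw [integral_prod_symm _ (itest hDi hψ₀ hσ)]
      refine integral_congr_ae (Eventually.of_forall fun k => ?_)
      simp only [c, ← integral_smul, smul_smul]
      simp_rw [mul_comm (σ k)]
    have h4 : ∫ X, (ψ X.1 * σ X.2) • c X.2 ∂volume.prod volume = m • ∫ k, σ k • c k := by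
      rw [integral_prod_symm _ (itest hci' hψ hσ), ← integral_smul]
      refine integral_congr_ae (Eventually.of_forall fun k => ?_)
      simp only
      rw [integral_smul_const, integral_mul_const, smul_smul]
    simp_rw [smul_sub]
    rw [integral_sub (itest hDi hψ hσ) (itest hci' hψ hσ), h2, h3, h4, sub_self]
  refine ⟨c, ?_⟩
  have hslice : ∀ᵐ X ∂(volume.restrict J).prod (volume : Measure E),
      ∀ᵐ t ∂volume.restrict J, Y (t, X.2) = Y₁ (t, X.2) := by
    have h1 : ∀ᵐ k : E, ∀ᵐ t ∂volume.restrict J, Y (t, k) = Y₁ (t, k) := by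
      have h2 := (Measure.measurePreserving_swap (μ := (volume : Measure E))
        (ν := volume.restrict J)).quasiMeasurePreserving.ae hY₁e
      exact Measure.ae_ae_of_ae_prod h2
    exact Measure.quasiMeasurePreserving_snd.ae h1
  have hJae : ∀ᵐ X ∂(volume.restrict J).prod (volume : Measure E), X ∈ J ×ˢ (univ : Set E) := by
    rw [prod_restrict_univ]; exact ae_restrict_mem hJm
  have key' : ∀ᵐ X ∂(volume.restrict J).prod (volume : Measure E),
      X.1 ∈ J → D X - c X.2 = 0 := by
    rw [prod_restrict_univ]; exact ae_restrict_of_ae key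
  filter_upwards [hslice, hJae, key'] with X hX hXJ hK
  have h1 : ∫ τ in t₀..X.1, Y (τ, X.2) = V X := by
    refine intervalIntegral.integral_congr_ae ?_
    rw [ae_restrict_iff' hJ.measurableSet] at hX
    filter_upwards [hX] with t ht htI
    refine ht ?_
    rcases le_total t₀ X.1 with h | h
    · rw [uIoc_of_le h] at htI; exact hJ' _ hXJ.1 htI.2
    · rw [uIoc_of_ge h] at htI; exact hJ' _ ht₀ htI.2
  rw [h1]
  have := hK hXJ.1
  simp only [D] at this
  linear_combination this

end TimeDerivative

/-! ### Straightening the transport field -/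

section Shear

variable {d : ℕ}

/-- The Euclidean space of points `w = (x, y, z)`. -/
abbrev Phase (d : ℕ) : Type := WithLp 2 (Vec d × WithLp 2 (Vec d × Vec d))

/-- The point `(x, y, z)`. -/
def Phase.mk (x y z : Vec d) : Phase d := WithLp.toLp 2 (x, WithLp.toLp 2 (y, z))

/-- The flow of the transport field `∂_t - x · ∇_y - y · ∇_z`. -/
def shear (X : ℝ × Phase d) : Pt d :=
  (X.1, X.2.fst, X.2.snd.fst - X.1 • X.2.fst,
    X.2.snd.snd + (-(X.1 • X.2.snd.fst) + (X.1 ^ 2 / 2) • X.2.fst))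

/-- The inverse of `shear`. -/
def unshear (X : Pt d) : ℝ × Phase d :=
  (X.1, Phase.mk X.2.1 (X.2.2.1 + X.1 • X.2.1)
    (X.2.2.2 + X.1 • X.2.2.1 + (X.1 ^ 2 / 2) • X.2.1))

@[simp] theorem shear_fst (X : ℝ × Phase d) : (shear X).1 = X.1 := rfl

theorem unshear_shear (X : ℝ × Phase d) : unshear (shear X) = X := by
  obtain ⟨t, w⟩ := X
  refine Prod.ext rfl ?_
  apply (WithLp.ofLp_injective 2)
  refine Prod.ext rfl ?_
  apply (WithLp.ofLp_injective 2)
  refine Prod.ext ?_ ?_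
  · change w.snd.fst - t • w.fst + t • w.fst = w.snd.fst
    abel
  · change w.snd.snd + (-(t • w.snd.fst) + (t ^ 2 / 2) • w.fst) + t • (w.snd.fst - t • w.fst)
      + (t ^ 2 / 2) • w.fst = w.snd.snd
    module

theorem shear_unshear (X : Pt d) : shear (unshear X) = X := by
  obtain ⟨t, x, y, z⟩ := X
  refine Prod.ext rfl (Prod.ext rfl (Prod.ext ?_ ?_))
  · change y + t • x - t • x = y
    abel
  · change z + t • y + (t ^ 2 / 2) • x + (-(t • (y + t • x)) + (t ^ 2 / 2) • x) = z
    module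

theorem contDiff_withLp_fst {E F : Type*} [NormedAddCommGroup E] [NormedSpace ℝ E]
    [NormedAddCommGroup F] [NormedSpace ℝ F] {n : WithTop ℕ∞} :
    ContDiff ℝ n (fun w : WithLp 2 (E × F) => w.fst) :=
  ((ContinuousLinearMap.fst ℝ E F).comp
    (WithLp.prodContinuousLinearEquiv 2 ℝ E F).toContinuousLinearMap).contDiff

theorem contDiff_withLp_snd {E F : Type*} [NormedAddCommGroup E] [NormedSpace ℝ E]
    [NormedAddCommGroup F] [NormedSpace ℝ F] {n : WithTop ℕ∞} :
    ContDiff ℝ n (fun w : WithLp 2 (E × F) => w.snd) :=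
  ((ContinuousLinearMap.snd ℝ E F).comp
    (WithLp.prodContinuousLinearEquiv 2 ℝ E F).toContinuousLinearMap).contDiff

theorem contDiff_withLp_toLp {E F : Type*} [NormedAddCommGroup E] [NormedSpace ℝ E]
    [NormedAddCommGroup F] [NormedSpace ℝ F] {n : WithTop ℕ∞} :
    ContDiff ℝ n (fun w : E × F => WithLp.toLp 2 w) :=
  (WithLp.prodContinuousLinearEquiv 2 ℝ E F).symm.toContinuousLinearMap.contDiff

theorem contDiff_shear {n : WithTop ℕ∞} : ContDiff ℝ n (shear (d := d)) := by
  have h1 : ContDiff ℝ n fun X : ℝ × Phase d => X.2.fst := contDiff_withLp_fst.comp contDiff_snd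
  have h2 : ContDiff ℝ n fun X : ℝ × Phase d => X.2.snd := contDiff_withLp_snd.comp contDiff_snd
  have h3 : ContDiff ℝ n fun X : ℝ × Phase d => X.2.snd.fst := contDiff_withLp_fst.comp h2
  have h4 : ContDiff ℝ n fun X : ℝ × Phase d => X.2.snd.snd := contDiff_withLp_snd.comp h2
  unfold shear
  fun_prop

theorem contDiff_unshear {n : WithTop ℕ∞} : ContDiff ℝ n (unshear (d := d)) := by
  unfold unshear Phase.mk
  refine contDiff_fst.prodMk (contDiff_withLp_toLp.comp (ContDiff.prodMk (by fun_prop)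
    (contDiff_withLp_toLp.comp (ContDiff.prodMk (by fun_prop) (by fun_prop)))))

/-- `shear` as a homeomorphism. -/
def shearHomeomorph (d : ℕ) : ℝ × Phase d ≃ₜ Pt d where
  toFun := shear
  invFun := unshear
  left_inv := unshear_shear
  right_inv := shear_unshear
  continuous_toFun := (contDiff_shear (n := 0)).continuous
  continuous_invFun := (contDiff_unshear (n := 0)).continuous

theorem measurableEmbedding_shear : MeasurableEmbedding (shear (d := d)) :=
  (shearHomeomorph d).measurableEmbedding

theorem volume_preserving_phase :
    MeasurePreserving (fun w : Phase d => (w.fst, w.snd.fst, w.snd.snd)) volume volume :=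
  ((MeasurePreserving.id (volume : Measure (Vec d))).prod
    (WithLp.volume_preserving_ofLp (Vec d) (Vec d))).comp
    (WithLp.volume_preserving_ofLp (Vec d) (WithLp 2 (Vec d × Vec d)))

/-- The map is triangular: `y` is translated by an amount depending on `(t, x)`, and `z` by one
depending on `(t, x, y)`. -/
theorem volume_preserving_shear :
    MeasurePreserving (shear (d := d)) (volume.prod volume) volume := by
  have h1 : MeasurePreserving (fun X : ℝ × Phase d => (X.1, X.2.fst, X.2.snd.fst, X.2.snd.snd))
      (volume.prod volume) volume :=
    (MeasurePreserving.id (volume : Measure ℝ)).prod (volume_preserving_phase (d := d))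
  have h2 : MeasurePreserving (fun X : Pt d => (X.1, X.2.1, X.2.2.1 - X.1 • X.2.1,
      X.2.2.2 + (-(X.1 • X.2.2.1) + (X.1 ^ 2 / 2) • X.2.1))) volume volume := by
    refine (MeasurePreserving.id (volume : Measure ℝ)).skew_product
      (g := fun (t : ℝ) (q : Vec d × Vec d × Vec d) => (q.1, q.2.1 - t • q.1, q.2.2 + (-(t • q.2.1) + (t ^ 2 / 2) • q.1)))
      (by fun_prop) (Eventually.of_forall fun t => ?_)
    refine MeasurePreserving.map_eq ?_
    refine (MeasurePreserving.id (volume : Measure (Vec d))).skew_product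
      (g := fun (x : Vec d) (q : Vec d × Vec d) => (q.1 - t • x, q.2 + (-(t • q.1) + (t ^ 2 / 2) • x)))
      (by fun_prop) (Eventually.of_forall fun x => ?_)
    refine MeasurePreserving.map_eq ?_
    refine (measurePreserving_sub_right (volume : Measure (Vec d)) (t • x)).skew_product
      (g := fun y (z : Vec d) => z + (-(t • y) + (t ^ 2 / 2) • x))
      (by fun_prop) (Eventually.of_forall fun y => ?_)
    exact (measurePreserving_add_right _ _).map_eq
  exact h2.comp h1

/-- The time interval of the domain. -/
def timeSet (T : EReal) : Set ℝ := {t | (t : EReal) < T}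

theorem isOpen_timeSet (T : EReal) : IsOpen (timeSet T) :=
  isOpen_Iio.preimage continuous_coe_real_ereal

theorem Iic_subset_timeSet {T : EReal} : ∀ t ∈ timeSet T, Iic t ⊆ timeSet T := fun _ ht _ hs =>
  lt_of_le_of_lt (EReal.coe_le_coe_iff.2 hs) ht

theorem timeSet_nonempty {T : EReal} (hT : T ≠ ⊥) : (timeSet T).Nonempty :=
  EReal.lt_iff_exists_real_btwn.1 (bot_lt_iff_ne_bot.2 hT) |>.imp fun _ h => h.2

/-- The measure on straightened space-time. -/
abbrev shearMeasure (d : ℕ) (T : EReal) : Measure (ℝ × Phase d) :=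
  (volume.restrict (timeSet T)).prod volume

theorem measurePreserving_shear (T : EReal) :
    MeasurePreserving (shear (d := d)) (shearMeasure d T) (slabMeasure d T) := by
  have hm : MeasurableSet (slab d T) :=
    (isOpen_timeSet T).measurableSet.preimage measurable_fst
  have h := (volume_preserving_shear (d := d)).restrict_preimage hm
  have e : shear (d := d) ⁻¹' slab d T = timeSet T ×ˢ univ := by
    ext X
    simp [slab, timeSet]
  rw [e, ← prod_restrict_univ] at h
  exact h

theorem integral_slab_eq (T : EReal) (F : Pt d → ℝ) :
    ∫ X in slab d T, F X = ∫ X, F (shear X) ∂shearMeasure d T :=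
  ((measurePreserving_shear T).integral_comp measurableEmbedding_shear F).symm

theorem memLp_comp_shear {T : EReal} {F : Type*} [NormedAddCommGroup F] {f : Pt d → F} {p : ℝ≥0∞}
    (hf : MemLp f p (slabMeasure d T)) : MemLp (fun X => f (shear X)) p (shearMeasure d T) :=
  hf.comp_measurePreserving (measurePreserving_shear T)

theorem eLpNorm_comp_shear (T : EReal) {F : Type*} [NormedAddCommGroup F] (f : Pt d → F)
    (p : ℝ≥0∞) : eLpNorm (fun X => f (shear X)) p (shearMeasure d T) =
      eLpNorm f p (slabMeasure d T) := by
  rw [← (measurePreserving_shear (d := d) T).map_eq,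
    measurableEmbedding_shear.eLpNorm_map_measure]
  rfl

/-- The direction `∂_{x_i}` in straightened coordinates. -/
def eDir (i : Fin d) (t : ℝ) : Phase d :=
  Phase.mk (EuclideanSpace.single i 1) (t • EuclideanSpace.single i 1)
    ((t ^ 2 / 2) • EuclideanSpace.single i 1)

theorem continuous_eDir (i : Fin d) : Continuous (eDir i) := by
  unfold eDir Phase.mk
  have h : ∀ {E F : Type} [NormedAddCommGroup E] [NormedSpace ℝ E] [NormedAddCommGroup F]
      [NormedSpace ℝ F], Continuous (fun w : E × F => WithLp.toLp 2 w) :=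
    (contDiff_withLp_toLp (n := 0)).continuous
  exact h.comp (Continuous.prodMk (by fun_prop)
    (h.comp (Continuous.prodMk (by fun_prop) (by fun_prop))))

/-- This is the origin of the quadratic curve: after straightening, `∂_{x_i}` points in a direction
quadratic in `t`, and its pairing with the frequency is the `i`-th component of `ξ + tη + t²ζ/2`. -/
theorem inner_eDir (k : Phase d) (i : Fin d) (t : ℝ) :
    inner ℝ k (eDir i t) = (curve k.fst k.snd.fst k.snd.snd t) i := by
  have h : ∀ v : Vec d, inner ℝ v (EuclideanSpace.single i (1 : ℝ)) = v i := fun v => by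
    rw [real_inner_comm, EuclideanSpace.inner_single_left]
    simp
  rw [WithLp.prod_inner_apply, WithLp.prod_inner_apply]
  change inner ℝ k.fst (EuclideanSpace.single i (1 : ℝ)) +
    (inner ℝ k.snd.fst (t • EuclideanSpace.single i (1 : ℝ)) +
      inner ℝ k.snd.snd ((t ^ 2 / 2) • EuclideanSpace.single i (1 : ℝ))) = _
  rw [inner_smul_right, inner_smul_right, h, h, h]
  simp [curve, add_assoc]

theorem shear_add_eDir (i : Fin d) (t s : ℝ) (w : Phase d) :
    shear (t, w + s • eDir i t) = shear (t, w) + s • (0, EuclideanSpace.single i 1, 0, 0) := by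
  refine Prod.ext ?_ (Prod.ext ?_ (Prod.ext ?_ ?_))
  · change t = t + s • 0
    simp
  · rfl
  · change w.snd.fst + s • t • EuclideanSpace.single i 1 - t • (w.fst + s • EuclideanSpace.single i 1)
      = w.snd.fst - t • w.fst + s • 0
    module
  · change w.snd.snd + s • (t ^ 2 / 2) • EuclideanSpace.single i 1 +
      (-(t • (w.snd.fst + s • t • EuclideanSpace.single i 1)) +
      (t ^ 2 / 2) • (w.fst + s • EuclideanSpace.single i 1)) =
      w.snd.snd + (-(t • w.snd.fst) + (t ^ 2 / 2) • w.fst) + s • 0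
    module

theorem dx_shear {φ : Pt d → ℝ} (hφ : Differentiable ℝ φ) (i : Fin d) (t : ℝ) (w : Phase d) :
    dx i φ (shear (t, w)) = fderiv ℝ (fun w => φ (shear (t, w))) w (eDir i t) := by
  have hs : Differentiable ℝ fun w : Phase d => φ (shear (t, w)) :=
    hφ.comp ((contDiff_shear (n := 1)).differentiable (by simp) |>.comp (by fun_prop))
  have e1 := (hs w).lineDeriv_eq_fderiv (v := eDir i t)
  have e2 := (hφ (shear (t, w))).lineDeriv_eq_fderiv
    (v := ((0 : ℝ), EuclideanSpace.single i (1 : ℝ), (0 : Vec d), (0 : Vec d)))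
  rw [dx, ← e1, ← e2]
  simp only [lineDeriv, shear_add_eDir]

/-- For fixed `w`, the curve `τ ↦ shear (τ, w)` is an integral curve of the field `(1, 0, -x, -y)`.
-/
theorem transport_shear {φ : Pt d → ℝ} (hφ : Differentiable ℝ φ) (t : ℝ) (w : Phase d) :
    transport φ (shear (t, w)) = deriv (fun τ => φ (shear (τ, w))) t := by
  have h1 : HasDerivAt (fun τ : ℝ => shear (τ, w))
      (1, 0, -(shear (t, w)).2.1, -(shear (t, w)).2.2.1) t := by
    refine (hasDerivAt_id t).prodMk ((hasDerivAt_const t w.fst).prodMk (HasDerivAt.prodMk ?_ ?_))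
    · change HasDerivAt (fun τ : ℝ => w.snd.fst - τ • w.fst) (-w.fst) t
      simpa using ((hasDerivAt_id t).smul_const w.fst).const_sub w.snd.fst
    · have a1 : HasDerivAt (fun τ : ℝ => -(τ • w.snd.fst)) (-w.snd.fst) t := by
        simpa using ((hasDerivAt_id t).smul_const w.snd.fst).fun_neg
      have a2 : HasDerivAt (fun τ : ℝ => (τ ^ 2 / 2) • w.fst) (t • w.fst) t := by
        have := (((hasDerivAt_id t).pow 2).div_const 2).smul_const w.fst
        simpa using this
      have a3 := (a1.add a2).const_add w.snd.snd
      rw [show -w.snd.fst + t • w.fst = -(w.snd.fst - t • w.fst) by abel] at a3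
      exact a3
  exact (((hφ _).hasFDerivAt.comp_hasDerivAt t h1).deriv).symm

/-- A product test function in straightened coordinates. -/
def tensorTest (ψ : ℝ → ℝ) (θ : Phase d → ℝ) (X : Pt d) : ℝ := ψ X.1 * θ (unshear X).2

theorem tensorTest_shear (ψ : ℝ → ℝ) (θ : Phase d → ℝ) (X : ℝ × Phase d) :
    tensorTest ψ θ (shear X) = ψ X.1 * θ X.2 := by
  rw [tensorTest, unshear_shear, shear_fst]

theorem isTest_tensorTest {T : EReal} {ψ : ℝ → ℝ} {θ : Phase d → ℝ} (hψ : IsBump (timeSet T) ψ)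
    (hθ : IsBump univ θ) : IsTest T (tensorTest ψ θ) := by
  have hK : IsCompact (shear (d := d) '' (tsupport ψ ×ˢ tsupport θ)) :=
    (hψ.compact.isCompact.prod hθ.compact.isCompact).image (contDiff_shear (n := 0)).continuous
  have hsub : tsupport (tensorTest ψ θ) ⊆ shear (d := d) '' (tsupport ψ ×ˢ tsupport θ) := by
    refine closure_minimal (fun X hX => ?_) hK.isClosed
    refine ⟨unshear X, ⟨subset_tsupport _ ?_, subset_tsupport _ ?_⟩, shear_unshear X⟩
    · exact left_ne_zero_of_mul hX
    · exact right_ne_zero_of_mul hX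
  refine ⟨?_, hK.of_isClosed_subset (isClosed_tsupport _) hsub, fun X hX => ?_⟩
  · exact (hψ.smooth.comp contDiff_fst).mul
      (hθ.smooth.comp (contDiff_snd.comp contDiff_unshear))
  · obtain ⟨Z, hZ, rfl⟩ := hsub hX
    exact hψ.support hZ.1

theorem IsTest.differentiable {T : EReal} {φ : Pt d → ℝ} (hφ : IsTest T φ) :
    Differentiable ℝ φ := hφ.smooth.differentiable (by simp)

theorem IsTest.dx {T : EReal} {φ : Pt d → ℝ} (hφ : IsTest T φ) (i : Fin d) :
    IsTest T (dx i φ) := by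
  have hs : tsupport (KFP.dx i φ) ⊆ tsupport φ := by
    refine closure_minimal (fun X hX => ?_) (isClosed_tsupport _)
    by_contra h
    refine hX ?_
    have : fderiv ℝ φ X = 0 := by
      by_contra h'
      exact h (support_fderiv_subset ℝ h')
    simp [KFP.dx, this]
  refine ⟨?_, hφ.compact.isCompact.of_isClosed_subset (isClosed_tsupport _) hs,
    hs.trans hφ.support⟩
  exact (hφ.smooth.fderiv_right (m := ∞) (by simp)).clm_apply contDiff_const

theorem dx_tensorTest_shear {ψ : ℝ → ℝ} {θ : Phase d → ℝ} {T : EReal} (hψ : IsBump (timeSet T) ψ)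
    (hθ : IsBump univ θ) (i : Fin d) (X : ℝ × Phase d) :
    dx i (tensorTest ψ θ) (shear X) = ψ X.1 * fderiv ℝ θ X.2 (eDir i X.1) := by
  rw [dx_shear (isTest_tensorTest hψ hθ).differentiable]
  simp_rw [tensorTest_shear]
  rw [fderiv_const_mul ((hθ.smooth.differentiable (by simp)) _)]
  rfl

theorem transport_tensorTest_shear {ψ : ℝ → ℝ} {θ : Phase d → ℝ} {T : EReal}
    (hψ : IsBump (timeSet T) ψ) (hθ : IsBump univ θ) (X : ℝ × Phase d) :
    transport (tensorTest ψ θ) (shear X) = deriv ψ X.1 * θ X.2 := by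
  rw [transport_shear (isTest_tensorTest hψ hθ).differentiable]
  simp_rw [tensorTest_shear]
  rw [deriv_mul_const ((hψ.smooth.differentiable (by simp)) _)]

/-- The weak derivative along `∂_{x_i}` in Fourier variables. -/
theorem pft_gradX {T : EReal} {u g : Pt d → ℝ} {U G : ℝ × Phase d → ℂ} (i : Fin d)
    (hU : IsPFT (volume.restrict (timeSet T)) (fun X => (u (shear X) : ℂ)) U)
    (hG : IsPFT (volume.restrict (timeSet T)) (fun X => (g (shear X) : ℂ)) G)
    (h : ∀ φ, IsTest T φ → ∫ X in slab d T, u X * -dx i φ X = ∫ X in slab d T, g X * φ X) :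
    ∀ᵐ X ∂shearMeasure d T,
      G X = 2 * Real.pi * Complex.I * ((curve X.2.fst X.2.snd.fst X.2.snd.snd X.1) i : ℝ) * U X := by
  have := pft_weak_deriv (isOpen_timeSet T) hU hG (continuous_eDir i) (fun ψ θ hψ hθ => by
    have h1 := h _ (isTest_tensorTest hψ hθ)
    rw [integral_slab_eq, integral_slab_eq] at h1
    simp_rw [dx_tensorTest_shear hψ hθ, tensorTest_shear, mul_neg] at h1
    rw [integral_neg] at h1
    rw [← h1, neg_neg])
  simpa only [inner_eDir] using this

/-- Using `∂_{x_j} φ` as a test function for the gradient shows that the Hessian entry `(i, j)` is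
the weak `x_j`-derivative of the gradient component `i`; so the first order result applies once
more. -/
theorem pft_hessX {T : EReal} {u : Pt d → ℝ} {G : Pt d → Vec d}
    {H : Pt d → EuclideanSpace ℝ (Fin d × Fin d)} (hG : IsGradX T u G) (hH : IsHessX T u H)
    {Gi Hij : ℝ × Phase d → ℂ} {i j : Fin d}
    (hGi : IsPFT (volume.restrict (timeSet T)) (fun X => (G (shear X) i : ℂ)) Gi)
    (hHij : IsPFT (volume.restrict (timeSet T)) (fun X => (H (shear X) (i, j) : ℂ)) Hij) :
    ∀ᵐ X ∂shearMeasure d T,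
      Hij X = 2 * Real.pi * Complex.I * ((curve X.2.fst X.2.snd.fst X.2.snd.snd X.1) j : ℝ) * Gi X := by
  refine pft_gradX (u := fun X => G X i) (g := fun X => H X (i, j)) j hGi hHij fun φ hφ => ?_
  have h1 := (hG i).2 _ (hφ.dx j)
  have h2 := (hH i j).2 φ hφ
  simp_rw [mul_neg, integral_neg] at h1 ⊢
  rw [← h1, neg_neg, h2]

theorem pft_transport {T : EReal} {u y : Pt d → ℝ} {U Y : ℝ × Phase d → ℂ}
    (hU : IsPFT (volume.restrict (timeSet T)) (fun X => (u (shear X) : ℂ)) U)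
    (hY : IsPFT (volume.restrict (timeSet T)) (fun X => (y (shear X) : ℂ)) Y)
    (h : IsTransport T u y) {t₀ : ℝ} (ht₀ : t₀ ∈ timeSet T) :
    ∃ c : Phase d → ℂ, ∀ᵐ X ∂shearMeasure d T, U X = c X.2 + ∫ τ in t₀..X.1, Y (τ, X.2) := by
  refine pft_weak_time_deriv (isOpen_timeSet T) Iic_subset_timeSet hU hY (fun ψ θ hψ hθ => ?_) ht₀
  have h1 := h.2 _ (isTest_tensorTest hψ hθ)
  rw [integral_slab_eq, integral_slab_eq] at h1
  simp_rw [transport_tensorTest_shear hψ hθ, tensorTest_shear, mul_neg] at h1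
  rw [integral_neg] at h1
  rw [← h1, neg_neg]

end Shear

/-! ### Singular integrals of difference quotients -/

section DifferenceQuotient

variable {V : Type*} [NormedAddCommGroup V] [InnerProductSpace ℝ V]

/-- The kernel that dominates difference quotients of order `2s`. -/
def domKernel (V : Type*) [NormedAddCommGroup V] [InnerProductSpace ℝ V] (s : ℝ) (h : V) : ℝ :=
  min 1 ‖h‖ / ‖h‖ ^ ((Module.finrank ℝ V : ℝ) + 2 * s)

theorem domKernel_nonneg (s : ℝ) (h : V) : 0 ≤ domKernel V s h := by
  unfold domKernel; positivity

theorem exists_abs_sub_le_min {P : Type*} [NormedAddCommGroup P] [NormedSpace ℝ P] {f : P → ℝ}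
    (hf : ContDiff ℝ 1 f) (hc : HasCompactSupport f)
    (τ : V →L[ℝ] P) : ∃ C : ℝ, 0 ≤ C ∧ ∀ X h, |f X - f (X - τ h)| ≤ C * min 1 ‖h‖ := by
  obtain ⟨K, hK⟩ := hf.lipschitzWith_of_hasCompactSupport hc (by simp)
  obtain ⟨B, hB⟩ := hc.exists_bound_of_continuous hf.continuous
  have hB0 : 0 ≤ B := (norm_nonneg _).trans (hB 0)
  refine ⟨2 * B + K * ‖τ‖, by positivity, fun X h => ?_⟩
  rw [mul_min_of_nonneg _ _ (by positivity)]
  refine le_min ?_ ?_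
  · have h1 := hB X
    have h2 := hB (X - τ h)
    have h3 : 0 ≤ K * ‖τ‖ := by positivity
    calc |f X - f (X - τ h)| ≤ |f X| + |f (X - τ h)| := abs_sub _ _
      _ ≤ _ := by rw [← Real.norm_eq_abs, ← Real.norm_eq_abs]; linarith
  · have h1 := hK.dist_le_mul X (X - τ h)
    rw [Real.dist_eq, dist_eq_norm, sub_sub_cancel] at h1
    calc |f X - f (X - τ h)| ≤ K * ‖τ h‖ := h1
      _ ≤ K * (‖τ‖ * ‖h‖) := by gcongr; exact τ.le_opNorm h
      _ = K * ‖τ‖ * ‖h‖ := by ring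
      _ ≤ _ := by gcongr; linarith

theorem abs_sub_div_le {P : Type*} [NormedAddCommGroup P] [NormedSpace ℝ P] {f : P → ℝ}
    {τ : V →L[ℝ] P} {C : ℝ}
    (hC : ∀ X h, |f X - f (X - τ h)| ≤ C * min 1 ‖h‖) (s : ℝ) (X : P) (h : V) :
    ‖(f X - f (X - τ h)) / ‖h‖ ^ ((Module.finrank ℝ V : ℝ) + 2 * s)‖ ≤ C * domKernel V s h := by
  rw [norm_div, Real.norm_eq_abs, Real.norm_of_nonneg (Real.rpow_nonneg (norm_nonneg h) _),
    domKernel, ← mul_div_assoc]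
  gcongr
  exact hC X h

variable [FiniteDimensional ℝ V] [MeasurableSpace V] [BorelSpace V]

/-- In polar coordinates the integrand is `min(1, y) y^{-1-2s}`. Integrability at zero uses `s <
1/2`, at infinity `s > 0`. -/
theorem integrable_domKernel [Nontrivial V] {s : ℝ} (hs : 0 < s) (hs' : s < 1 / 2) :
    Integrable (domKernel V s) := by
  have h0 := (integrable_fun_norm_addHaar (volume : Measure V)
    (f := fun ρ : ℝ => min 1 ρ / ρ ^ ((Module.finrank ℝ V : ℝ) + 2 * s))).2 ?_
  · exact h0
  have hpos : 1 ≤ Module.finrank ℝ V := Module.finrank_pos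
  have e : ∀ y ∈ Ioi (0 : ℝ), y ^ (Module.finrank ℝ V - 1) •
      (min 1 y / y ^ ((Module.finrank ℝ V : ℝ) + 2 * s)) = min 1 y * y ^ (-1 - 2 * s) := by
    intro y hy
    have hy' : 0 < y := hy
    rw [smul_eq_mul, ← Real.rpow_natCast, Nat.cast_sub hpos, mul_div_left_comm,
      ← Real.rpow_sub hy']
    congr 2
    push_cast; ring
  rw [integrableOn_congr_fun e measurableSet_Ioi, ← Ioo_union_Ici_eq_Ioi (zero_lt_one' ℝ)]
  refine IntegrableOn.union ?_ ?_
  · have h1 : IntegrableOn (fun y : ℝ => y ^ (-(2 * s))) (Ioo 0 1) :=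
      (intervalIntegral.integrableOn_Ioo_rpow_iff zero_lt_one).2 (by linarith)
    refine h1.congr_fun (fun y hy => ?_) measurableSet_Ioo
    simp only
    rw [min_eq_right hy.2.le, show -(2 * s) = 1 + (-1 - 2 * s) by ring, Real.rpow_add hy.1,
      Real.rpow_one]
  · rw [integrableOn_Ici_iff_integrableOn_Ioi]
    have h1 : IntegrableOn (fun y : ℝ => y ^ (-1 - 2 * s)) (Ioi 1) :=
      integrableOn_Ioi_rpow_of_lt (by linarith) zero_lt_one
    refine h1.congr_fun (fun y hy => ?_) measurableSet_Ioi
    simp only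
    rw [min_eq_left (le_of_lt hy), one_mul]

/-- The substitution `h ↦ ρ h` produces the power `ρ^{2s}`; this is how the order `2s` of the
fractional Laplacian enters the estimate of its symbol. -/
theorem integral_scaled_domKernel (s : ℝ) {ρ : ℝ} (hρ : 0 < ρ) :
    ∫ h : V, min 1 (ρ * ‖h‖) / ‖h‖ ^ ((Module.finrank ℝ V : ℝ) + 2 * s) =
      ρ ^ (2 * s) * ∫ h, domKernel V s h := by
  have h1 := Measure.integral_comp_smul (volume : Measure V) (domKernel V s) ρ
  have e : ∀ h : V, min 1 (ρ * ‖h‖) / ‖h‖ ^ ((Module.finrank ℝ V : ℝ) + 2 * s) =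
      ρ ^ ((Module.finrank ℝ V : ℝ) + 2 * s) * domKernel V s (ρ • h) := by
    intro h
    rw [domKernel, norm_smul, Real.norm_of_nonneg hρ.le, Real.mul_rpow hρ.le (norm_nonneg _)]
    have : ρ ^ ((Module.finrank ℝ V : ℝ) + 2 * s) ≠ 0 := (Real.rpow_pos_of_pos hρ _).ne'
    rw [← div_div, mul_div_assoc', mul_div_cancel₀ _ this]
  simp_rw [e]
  rw [integral_const_mul, h1, abs_of_nonneg (by positivity), smul_eq_mul, ← mul_assoc,
    Real.rpow_add hρ, Real.rpow_natCast]
  congr 1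
  field_simp

variable {P : Type*} [NormedAddCommGroup P] [NormedSpace ℝ P] [MeasurableSpace P] [BorelSpace P]

/-- The integral of the difference quotients of order `2s` of `f` in the directions `τ h`. -/
def diffQuot (s : ℝ) (τ : V →L[ℝ] P) (f : P → ℝ) (X : P) : ℝ :=
  ∫ h : V, (f X - f (X - τ h)) / ‖h‖ ^ ((Module.finrank ℝ V : ℝ) + 2 * s)

variable [FiniteDimensional ℝ P] (μ : Measure P) [μ.IsAddHaarMeasure]

/-- For fixed `h` the numerator lives on the support of `f` and its translate, sets of equal finite
measure, and is at most `C min(1, ‖h‖)`. Its integral in `X` is therefore bounded by a multiple of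
`domKernel`. -/
theorem integrable_diffQuot_prod [Nontrivial V] {s : ℝ} (hs : 0 < s) (hs' : s < 1 / 2)
    {f : P → ℝ} (hf : ContDiff ℝ 1 f) (hc : HasCompactSupport f) (τ : V →L[ℝ] P) :
    Integrable (fun Z : P × V =>
      (f Z.1 - f (Z.1 - τ Z.2)) / ‖Z.2‖ ^ ((Module.finrank ℝ V : ℝ) + 2 * s))
      (μ.prod volume) := by
  obtain ⟨C, hC0, hC⟩ := exists_abs_sub_le_min hf hc τ
  have hfc := hf.continuous
  have hm : AEStronglyMeasurable (fun Z : P × V =>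
      (f Z.1 - f (Z.1 - τ Z.2)) / ‖Z.2‖ ^ ((Module.finrank ℝ V : ℝ) + 2 * s)) (μ.prod volume) := by
    refine Measurable.aestronglyMeasurable (Measurable.div ?_ (by fun_prop))
    exact (by fun_prop : Continuous fun Z : P × V => f Z.1 - f (Z.1 - τ Z.2)).measurable
  have hfi : Integrable f μ := hfc.integrable_of_hasCompactSupport hc
  have hfi' : ∀ v : P, Integrable (fun X => f (X - v)) μ := fun v => hfi.comp_sub_right v
  rw [integrable_prod_iff' hm]
  have hd : ∀ h, Integrable (fun X => (f X - f (X - τ h)) /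
      ‖h‖ ^ ((Module.finrank ℝ V : ℝ) + 2 * s)) μ := fun h => (hfi.sub (hfi' (τ h))).div_const _
  refine ⟨Eventually.of_forall hd, ?_⟩
  set S := tsupport f with hS
  have hSm : MeasurableSet S := (isClosed_tsupport f).measurableSet
  have hSf : μ S ≠ ⊤ := hc.isCompact.measure_lt_top.ne
  have iS : Integrable (S.indicator (1 : P → ℝ)) μ :=
    (integrable_indicator_iff hSm).2 (integrableOn_const hSf)
  refine ((integrable_domKernel (V := V) hs hs').const_mul
    (2 * C * ∫ X, S.indicator (1 : P → ℝ) X ∂μ)).mono' hm.norm.prod_swap.integral_prod_right' ?_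
  refine Eventually.of_forall fun h => ?_
  rw [Real.norm_of_nonneg (integral_nonneg fun _ => norm_nonneg _)]
  have i2 : Integrable (fun X => S.indicator (1 : P → ℝ) (X - τ h)) μ := iS.comp_sub_right _
  calc ∫ X, ‖(f X - f (X - τ h)) / ‖h‖ ^ ((Module.finrank ℝ V : ℝ) + 2 * s)‖ ∂μ
      ≤ ∫ X, (C * domKernel V s h) * (S.indicator (1 : P → ℝ) X +
          S.indicator (1 : P → ℝ) (X - τ h)) ∂μ := by
        refine integral_mono (hd h).norm
          ((iS.add i2).const_mul _) fun X => ?_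
        have h0 : 0 ≤ C * domKernel V s h := mul_nonneg hC0 (domKernel_nonneg s h)
        by_cases h1 : X ∈ S
        · refine (abs_sub_div_le hC s X h).trans (le_mul_of_one_le_right h0 ?_)
          rw [indicator_of_mem h1, Pi.one_apply]
          have : 0 ≤ S.indicator (1 : P → ℝ) (X - τ h) := indicator_nonneg (by simp) _
          linarith
        by_cases h2 : X - τ h ∈ S
        · refine (abs_sub_div_le hC s X h).trans (le_mul_of_one_le_right h0 ?_)
          simp only [indicator_of_mem h2, Pi.one_apply]
          have : 0 ≤ S.indicator (1 : P → ℝ) X := indicator_nonneg (by simp) _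
          linarith
        · rw [image_eq_zero_of_notMem_tsupport h1, image_eq_zero_of_notMem_tsupport h2]
          simp [indicator_of_notMem h1, indicator_of_notMem h2]
    _ = _ := by
        rw [integral_const_mul, integral_add iS i2,
          integral_sub_right_eq_self (fun X => S.indicator (1 : P → ℝ) X)]
        ring

theorem integrable_diffQuot [Nontrivial V] {s : ℝ} (hs : 0 < s) (hs' : s < 1 / 2)
    {f : P → ℝ} (hf : ContDiff ℝ 1 f) (hc : HasCompactSupport f) (τ : V →L[ℝ] P) :
    Integrable (diffQuot s τ f) μ :=
  (integrable_diffQuot_prod μ hs hs' hf hc τ).integral_prod_left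

/-- A bounded integrable function is square integrable. -/
theorem memLp_diffQuot [Nontrivial V] {s : ℝ} (hs : 0 < s) (hs' : s < 1 / 2)
    {f : P → ℝ} (hf : ContDiff ℝ 1 f) (hc : HasCompactSupport f) (τ : V →L[ℝ] P) :
    MemLp (diffQuot s τ f) 2 μ := by
  have hi := integrable_diffQuot μ hs hs' hf hc τ
  obtain ⟨C, hC0, hC⟩ := exists_abs_sub_le_min hf hc τ
  rw [memLp_two_iff_integrable_sq hi.1]
  have hb : ∀ X, ‖diffQuot s τ f X‖ ≤ ∫ h : V, C * domKernel V s h := fun X =>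
    norm_integral_le_of_norm_le ((integrable_domKernel hs hs').const_mul C)
      (Eventually.of_forall fun h => abs_sub_div_le hC s X h)
  refine (hi.norm.const_mul (∫ h : V, C * domKernel V s h)).mono' (hi.1.pow 2)
    (Eventually.of_forall fun X => ?_)
  rw [norm_pow, sq]
  exact mul_le_mul_of_nonneg_right (hb X) (norm_nonneg _)

end DifferenceQuotient

/-! ### The Fourier multiplier of the singular integral and its upper bound. -/

section Symbol

variable {V : Type*} [NormedAddCommGroup V] [InnerProductSpace ℝ V] [FiniteDimensional ℝ V]
  [MeasurableSpace V] [BorelSpace V]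
variable {E : Type*} [NormedAddCommGroup E] [InnerProductSpace ℝ E]

/-- The Fourier multiplier of `diffQuot`. -/
def diffSymbol (s : ℝ) (τ : V →L[ℝ] E) (k : E) : ℂ :=
  ∫ h : V, (1 - (Real.fourierChar (-inner ℝ (τ h) k) : ℂ)) /
    ((‖h‖ ^ ((Module.finrank ℝ V : ℝ) + 2 * s) : ℝ) : ℂ)

theorem norm_one_sub_fourierChar_le (x : ℝ) :
    ‖1 - (Real.fourierChar x : ℂ)‖ ≤ 2 * Real.pi * min 1 |x| := by
  rw [mul_min_of_nonneg _ _ (by positivity)]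
  refine le_min ?_ ?_
  · calc ‖1 - (Real.fourierChar x : ℂ)‖ ≤ ‖(1 : ℂ)‖ + ‖(Real.fourierChar x : ℂ)‖ := norm_sub_le _ _
      _ = 2 := by rw [norm_one, Circle.norm_coe]; norm_num
      _ ≤ 2 * Real.pi * 1 := by nlinarith [Real.pi_gt_three]
  · rw [norm_sub_rev, Real.fourierChar_apply, mul_comm]
    refine Real.norm_exp_I_mul_ofReal_sub_one_le.trans (le_of_eq ?_)
    rw [Real.norm_eq_abs, abs_mul, abs_of_nonneg (by positivity)]

/-- The bound `|1 - e^{2πix}| ≤ 2π min(1, |x|)` with `|x| ≤ ‖q‖‖h‖`, followed by the scaling of the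
kernel, yields `‖q‖^{2s}`. Here `q` is the adjoint of `τ` applied to `k`. Only this inequality is
used later, never the value of the symbol or of `fracConst`. -/
theorem norm_diffSymbol_le [Nontrivial V] {s : ℝ} (hs : 0 < s) (hs' : s < 1 / 2)
    (τ : V →L[ℝ] E) (k : E) (q : V) (hq : ∀ h, inner ℝ (τ h) k = inner ℝ h q) :
    ‖diffSymbol s τ k‖ ≤ 2 * Real.pi * (∫ h, domKernel V s h) * ‖q‖ ^ (2 * s) := by
  rcases eq_or_ne q 0 with rfl | hq0
  · have : diffSymbol s τ k = 0 := by
      simp [diffSymbol, hq]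
    rw [this, norm_zero]
    have : 0 ≤ ∫ h, domKernel V s h := integral_nonneg (domKernel_nonneg s)
    positivity
  have hq' : 0 < ‖q‖ := norm_pos_iff.2 hq0
  rw [mul_assoc, mul_comm _ (‖q‖ ^ (2 * s)), ← integral_scaled_domKernel s hq', ← integral_const_mul]
  have hint : Integrable fun h : V =>
      2 * Real.pi * (min 1 (‖q‖ * ‖h‖) / ‖h‖ ^ ((Module.finrank ℝ V : ℝ) + 2 * s)) := by
    refine (((integrable_domKernel (V := V) hs hs').const_mul (max 1 ‖q‖)).mono'
      (Measurable.aestronglyMeasurable (by fun_prop)) (Eventually.of_forall fun h => ?_)).const_mul _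
    rw [Real.norm_of_nonneg (by positivity), domKernel, ← mul_div_assoc]
    gcongr
    rw [mul_min_of_nonneg _ _ (by positivity)]
    refine min_le_min ?_ ?_
    · simp
    · gcongr; exact le_max_right _ _
  refine norm_integral_le_of_norm_le hint (Eventually.of_forall fun h => ?_)
  rw [norm_div, Complex.norm_real, Real.norm_of_nonneg (Real.rpow_nonneg (norm_nonneg h) _),
    ← mul_div_assoc]
  gcongr
  refine (norm_one_sub_fourierChar_le _).trans ?_
  gcongr
  rw [abs_neg, hq, mul_comm]
  exact abs_real_inner_le_norm h q

variable [FiniteDimensional ℝ E] [MeasurableSpace E] [BorelSpace E]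

theorem fourier_comp_sub (f : E → ℂ) (v k : E) :
    𝓕 (fun x => f (x - v)) k = (Real.fourierChar (-inner ℝ v k) : ℂ) * 𝓕 f k := by
  rw [Real.fourier_eq, Real.fourier_eq, ← integral_const_mul,
    ← integral_sub_right_eq_self (fun x => (Real.fourierChar (-inner ℝ v k) : ℂ) *
      (Real.fourierChar (-inner ℝ x k) • f x)) v]
  refine integral_congr_ae (Eventually.of_forall fun x => ?_)
  simp only [Circle.smul_def, smul_eq_mul]
  rw [← mul_assoc, ← Circle.coe_mul, ← AddChar.map_add_eq_mul]
  congr 3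
  rw [inner_sub_left]; ring

/-- Fubini moves the transform inside the integral over `h`, where a translation becomes
multiplication by a character. -/
theorem fourier_diffQuot [Nontrivial V] {s : ℝ} (hs : 0 < s) (hs' : s < 1 / 2)
    {f : E → ℝ} (hf : ContDiff ℝ 1 f) (hc : HasCompactSupport f) (τ : V →L[ℝ] E) (k : E) :
    𝓕 (fun x => (diffQuot s τ f x : ℂ)) k = diffSymbol s τ k * 𝓕 (fun x => (f x : ℂ)) k := by
  have hfi : Integrable (fun x => (f x : ℂ)) :=
    (hf.continuous.integrable_of_hasCompactSupport hc).ofReal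
  have hprod := (integrable_diffQuot_prod (volume : Measure E) hs hs' hf hc τ).ofReal (𝕜 := ℂ)
  have hprod' : Integrable (Function.uncurry fun (x : E) (h : V) =>
      Real.fourierChar (-inner ℝ x k) •
      (((f x - f (x - τ h)) / ‖h‖ ^ ((Module.finrank ℝ V : ℝ) + 2 * s) : ℝ) : ℂ))
      (volume.prod volume) := by
    refine hprod.mono ?_ (Eventually.of_forall fun Z => ?_)
    · refine AEStronglyMeasurable.smul (Continuous.aestronglyMeasurable ?_) hprod.1
      exact continuous_subtype_val.comp <| Real.continuous_fourierChar.comp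
        (by fun_prop : Continuous fun Z : E × V => -inner ℝ Z.1 k)
    · simp [Function.uncurry, Circle.norm_smul]
  rw [Real.fourier_eq]
  have e1 : ∀ x, Real.fourierChar (-inner ℝ x k) • (diffQuot s τ f x : ℂ) =
      ∫ h : V, Real.fourierChar (-inner ℝ x k) •
      (((f x - f (x - τ h)) / ‖h‖ ^ ((Module.finrank ℝ V : ℝ) + 2 * s) : ℝ) : ℂ) := by
    intro x
    simp only [Circle.smul_def]
    rw [integral_smul, diffQuot, integral_complex_ofReal]
  simp_rw [e1]
  rw [integral_integral_swap hprod', diffSymbol, ← integral_mul_const]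
  refine integral_congr_ae (Eventually.of_forall fun h => ?_)
  have h1 : 𝓕 (fun x => (f x : ℂ) - f (x - τ h)) k =
      (1 - (Real.fourierChar (-inner ℝ (τ h) k) : ℂ)) * 𝓕 (fun x => (f x : ℂ)) k := by
    have h2 := fourier_comp_sub (fun x => (f x : ℂ)) (τ h) k
    rw [sub_mul, one_mul, ← h2]
    simp only [Real.fourier_eq, smul_sub]
    refine integral_sub ?_ ?_
    · exact (Real.fourierIntegral_convergent_iff k).2 hfi
    · exact (Real.fourierIntegral_convergent_iff k).2 (hfi.comp_sub_right (τ h))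
  simp only
  rw [div_mul_eq_mul_div, ← h1, Real.fourier_eq, ← integral_div]
  refine integral_congr_ae (Eventually.of_forall fun x => ?_)
  simp only [Circle.smul_def, smul_eq_mul]
  push_cast
  rw [mul_div_assoc]

end Symbol

/-! ### Representation of fractional derivatives -/

section Riesz

variable {d : ℕ} {T : EReal}

theorem IsTest.memLp {φ : Pt d → ℝ} (hφ : IsTest T φ) (p : ℝ≥0∞) : MemLp φ p (slabMeasure d T) :=
  (hφ.smooth.continuous.memLp_of_hasCompactSupport hφ.compact).restrict _

theorem IsTest.add {φ φ' : Pt d → ℝ} (h : IsTest T φ) (h' : IsTest T φ') : IsTest T (φ + φ') :=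
  ⟨h.smooth.add h'.smooth, h.compact.add h'.compact,
    (tsupport_add _ _).trans (union_subset h.support h'.support)⟩

theorem IsTest.const_smul {φ : Pt d → ℝ} (h : IsTest T φ) (c : ℝ) : IsTest T (c • φ) :=
  ⟨contDiff_const.smul h.smooth, h.compact.smul_left (f := fun _ => c),
    (tsupport_smul_subset_right (fun _ => c) φ).trans h.support⟩

theorem isTest_zero : IsTest T (0 : Pt d → ℝ) :=
  ⟨contDiff_const, HasCompactSupport.zero, by simp [tsupport]⟩

/-- The space of test functions. -/
def testSubmodule (d : ℕ) (T : EReal) : Submodule ℝ (Pt d → ℝ) where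
  carrier := {φ | IsTest T φ}
  add_mem' h h' := h.add h'
  zero_mem' := isTest_zero
  smul_mem' c _ h := h.const_smul c

/-- The inclusion of test functions in `L²`. -/
def testToLp (d : ℕ) (T : EReal) : testSubmodule d T →ₗ[ℝ] Lp ℝ 2 (slabMeasure d T) where
  toFun φ := (φ.2.memLp 2).toLp φ
  map_add' φ φ' := MemLp.toLp_add (φ.2.memLp 2) (φ'.2.memLp 2)
  map_smul' c φ := MemLp.toLp_const_smul c (φ.2.memLp 2)

/-- A linear functional on test functions that is bounded in the norm of `L²` is represented by a
function in `L²`. -/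
theorem exists_memLp_of_bounded {D : (Pt d → ℝ) → ℝ}
    (hadd : ∀ φ φ', IsTest T φ → IsTest T φ' → D (φ + φ') = D φ + D φ')
    (hsmul : ∀ (c : ℝ) φ, IsTest T φ → D (c • φ) = c * D φ) {C : ℝ≥0∞} (hC : C ≠ ⊤)
    (hD : ∀ φ, IsTest T φ → ‖D φ‖ₑ ≤ C * eLpNorm φ 2 (slabMeasure d T)) :
    ∃ g, MemLp g 2 (slabMeasure d T) ∧ eLpNorm g 2 (slabMeasure d T) ≤ C ∧
      ∀ φ, IsTest T φ → D φ = ∫ X in slab d T, g X * φ X := by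
  let D' : testSubmodule d T →ₗ[ℝ] ℝ :=
    { toFun := fun φ => D φ
      map_add' := fun φ φ' => hadd _ _ φ.2 φ'.2
      map_smul' := fun c φ => hsmul c _ φ.2 }
  have hbound : ∀ φ : testSubmodule d T, ‖D' φ‖ ≤ C.toReal * ‖testToLp d T φ‖ := by
    intro φ
    have h1 := ENNReal.toReal_mono (ENNReal.mul_ne_top hC (φ.2.memLp 2).2.ne) (hD φ φ.2)
    rw [ENNReal.toReal_mul, toReal_enorm] at h1
    have h2 : ‖testToLp d T φ‖ = (eLpNorm (φ : Pt d → ℝ) 2 (slabMeasure d T)).toReal :=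
      Lp.norm_toLp _ (φ.2.memLp 2)
    rw [h2]
    exact h1
  -- By boundedness the functional vanishes on test functions that are zero in `L²`, so it descends
  -- to their image there; a norm-preserving extension and Riesz representation then give `g` with
  -- norm at most `C`.
  have hker : LinearMap.ker (testToLp d T) ≤ LinearMap.ker D' := by
    intro φ hφ
    have h := hbound φ
    rw [LinearMap.mem_ker] at hφ ⊢
    rw [hφ, norm_zero, mul_zero] at h
    exact norm_le_zero_iff.1 h
  let f₀ : LinearMap.range (testToLp d T) →ₗ[ℝ] ℝ :=
    ((LinearMap.ker (testToLp d T)).liftQ D' hker).comp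
      (testToLp d T).quotKerEquivRange.symm.toLinearMap
  have hf₀ : ∀ φ : testSubmodule d T, f₀ ⟨testToLp d T φ, LinearMap.mem_range_self _ _⟩ = D' φ := by
    intro φ
    have : (testToLp d T).quotKerEquivRange.symm ⟨testToLp d T φ, LinearMap.mem_range_self _ _⟩ =
        (LinearMap.ker (testToLp d T)).mkQ φ :=
      (testToLp d T).quotKerEquivRange_symm_apply_image φ _
    change ((LinearMap.ker (testToLp d T)).liftQ D' hker)
      ((testToLp d T).quotKerEquivRange.symm _) = _
    rw [this]
    rfl
  have hf₀b : ∀ x : LinearMap.range (testToLp d T), ‖f₀ x‖ ≤ C.toReal * ‖x‖ := by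
    rintro ⟨_, φ, rfl⟩
    rw [hf₀]
    exact hbound φ
  obtain ⟨F, hF, hFn⟩ := exists_extension_norm_eq _ (f₀.mkContinuous C.toReal hf₀b)
  let g := (InnerProductSpace.toDual ℝ (Lp ℝ 2 (slabMeasure d T))).symm F
  refine ⟨g, Lp.memLp g, ?_, fun φ hφ => ?_⟩
  · have h1 : ‖g‖ ≤ C.toReal := by
      rw [LinearIsometryEquiv.norm_map, hFn]
      exact LinearMap.mkContinuous_norm_le _ ENNReal.toReal_nonneg _
    rw [Lp.norm_def] at h1
    exact (ENNReal.toReal_le_toReal (Lp.memLp g).2.ne hC).1 h1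
  · have h1 : inner ℝ g (testToLp d T ⟨φ, hφ⟩) = F (testToLp d T ⟨φ, hφ⟩) :=
      InnerProductSpace.toDual_symm_apply
    have h2 : F (testToLp d T ⟨φ, hφ⟩) = D φ := by
      have := hF ⟨testToLp d T ⟨φ, hφ⟩, LinearMap.mem_range_self _ _⟩
      rw [this]
      exact hf₀ ⟨φ, hφ⟩
    rw [← h2, ← h1, L2.inner_def]
    refine integral_congr_ae ?_
    have h3 : (testToLp d T ⟨φ, hφ⟩ : Pt d → ℝ) =ᵐ[slabMeasure d T] φ :=
      MemLp.coeFn_toLp (hφ.memLp 2)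
    filter_upwards [h3] with X hX
    rw [hX]
    simp [mul_comm]

end Riesz

/-! ### Fractional derivatives of a function whose Fourier transform decays. -/

section Fractional

variable {d : ℕ} {T : EReal}

instance isAddHaarMeasure_volume_pt (d : ℕ) : (volume : Measure (Pt d)).IsAddHaarMeasure := by
  have h1 : (volume : Measure (Vec d × Vec d)).IsAddHaarMeasure :=
    Measure.prod.instIsAddHaarMeasure volume volume
  have h2 : (volume : Measure (Vec d × Vec d × Vec d)).IsAddHaarMeasure :=
    Measure.prod.instIsAddHaarMeasure volume volume
  exact Measure.prod.instIsAddHaarMeasure volume volume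

theorem hasCompactSupport_slice {φ : Pt d → ℝ} (hφ : HasCompactSupport φ) (t : ℝ) :
    HasCompactSupport fun w : Phase d => φ (shear (t, w)) := by
  have h : IsClosedEmbedding (Prod.mk t : Phase d → ℝ × Phase d) := by
    refine ⟨isEmbedding_prodMkRight t, ?_⟩
    have e : range (Prod.mk t : Phase d → ℝ × Phase d) = Prod.fst ⁻¹' {t} := by
      ext X
      exact ⟨fun ⟨w, hw⟩ => hw ▸ rfl, fun hX => ⟨X.2, Prod.ext hX.symm rfl⟩⟩
    rw [e]
    exact isClosed_singleton.preimage continuous_fst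
  exact hφ.comp_isClosedEmbedding ((shearHomeomorph d).isClosedEmbedding.comp h)

theorem contDiff_slice {φ : Pt d → ℝ} {n : WithTop ℕ∞} (hφ : ContDiff ℝ n φ) (t : ℝ) :
    ContDiff ℝ n fun w : Phase d => φ (shear (t, w)) :=
  hφ.comp (contDiff_shear.comp (contDiff_prodMk_right t))

theorem eLpNorm_pft_test {φ : Pt d → ℝ} {Φ : ℝ × Phase d → ℂ}
    (hΦ : IsPFT (volume.restrict (timeSet T)) (fun X => (φ (shear X) : ℂ)) Φ) :
    eLpNorm Φ 2 (shearMeasure d T) = eLpNorm φ 2 (slabMeasure d T) := by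
  rw [hΦ.eLpNorm_eq, ← eLpNorm_comp_shear]
  exact eLpNorm_congr_norm_ae (Eventually.of_forall fun X => Complex.norm_real _)

theorem exists_pft {f : Pt d → ℝ} (hf : MemLp f 2 (slabMeasure d T)) :
    ∃ F, IsPFT (volume.restrict (timeSet T)) (fun X => (f (shear X) : ℂ)) F :=
  IsPFT.exists_of_memLp (memLp_ofReal (memLp_comp_shear hf))

/-- The constant in the bound of the multiplier of `diffQuot`. -/
def symbolConst (d : ℕ) (s : ℝ) : ℝ := 2 * Real.pi * ∫ h, domKernel (Vec d) s h

theorem symbolConst_nonneg (d : ℕ) (s : ℝ) : 0 ≤ symbolConst d s :=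
  mul_nonneg (by positivity) (integral_nonneg (domKernel_nonneg s))

/-- Translation by `σ h` in the original variables is translation by `τ t h` in the straightened
ones, within the same time slice. Hence the difference operator acts slice by slice as a multiplier,
and Plancherel moves the pairing to the Fourier side, where the symbol is bounded. -/
theorem enorm_integral_mul_diffQuot_le [Nontrivial (Vec d)] {s : ℝ} (hs : 0 < s) (hs' : s < 1 / 2)
    {σ : Vec d →L[ℝ] Pt d} {τ : ℝ → Vec d →L[ℝ] Phase d} {q : ℝ → Phase d → Vec d}
    (hστ : ∀ t w h, shear (t, w) - σ h = shear (t, w - τ t h))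
    (hq : ∀ t h k, inner ℝ (τ t h) k = inner ℝ h (q t k)) (hqc : Continuous (Function.uncurry q))
    {u : Pt d → ℝ} {U : ℝ × Phase d → ℂ}
    (hU : IsPFT (volume.restrict (timeSet T)) (fun X => (u (shear X) : ℂ)) U)
    {φ : Pt d → ℝ} (hφ : IsTest T φ) {Φ : ℝ × Phase d → ℂ}
    (hΦ : IsPFT (volume.restrict (timeSet T)) (fun X => (φ (shear X) : ℂ)) Φ) :
    ‖∫ X in slab d T, u X * diffQuot s σ φ X‖ₑ ≤ ∫⁻ X, ‖U X‖ₑ *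
      (ENNReal.ofReal (symbolConst d s * ‖q X.1 X.2‖ ^ (2 * s)) * ‖Φ X‖ₑ) ∂shearMeasure d T := by
  have hφ1 : ContDiff ℝ 1 φ := hφ.smooth.of_le (by simp)
  have hL : MemLp (diffQuot s σ φ) 2 (slabMeasure d T) :=
    (memLp_diffQuot volume hs hs' hφ1 hφ.compact σ).restrict _
  obtain ⟨Λ, hΛ⟩ := exists_pft hL
  have hslice : ∀ᵐ t ∂volume.restrict (timeSet T), ∀ᵐ k : Phase d,
      ‖Λ (t, k)‖ₑ ≤ ENNReal.ofReal (symbolConst d s * ‖q t k‖ ^ (2 * s)) * ‖Φ (t, k)‖ₑ := by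
    filter_upwards [hΛ.slice, hΦ.slice] with t h1 h2
    have hc := hasCompactSupport_slice hφ.compact t
    have hd := contDiff_slice hφ1 t
    have e : ∀ w, diffQuot s σ φ (shear (t, w)) =
        diffQuot s (τ t) (fun w => φ (shear (t, w))) w := fun w => by
      simp only [diffQuot, hστ]
    simp only [e] at h1
    have g1 := h1.unique (IsFT.of_integrable
      (integrable_diffQuot volume hs hs' hd hc (τ t)).ofReal
      (memLp_ofReal (memLp_diffQuot volume hs hs' hd hc (τ t))))
    have g2 := h2.unique (IsFT.of_integrable
      (hd.continuous.integrable_of_hasCompactSupport hc).ofReal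
      (memLp_ofReal (hd.continuous.memLp_of_hasCompactSupport hc)))
    filter_upwards [g1, g2] with k hk1 hk2
    rw [hk1, hk2, fourier_diffQuot hs hs' hd hc, enorm_mul]
    gcongr
    rw [← ofReal_norm]
    exact ENNReal.ofReal_le_ofReal (norm_diffSymbol_le hs hs' (τ t) k (q t k) fun h => hq t h k)
  have h1 := hU.integral_conj_mul hΛ
  have h2 : ((∫ X in slab d T, u X * diffQuot s σ φ X : ℝ) : ℂ) =
      ∫ X, (starRingEnd ℂ) (U X) * Λ X ∂shearMeasure d T := by
    rw [h1, integral_slab_eq, ← integral_complex_ofReal]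
    simp
  have h3 : ‖∫ X in slab d T, u X * diffQuot s σ φ X‖ₑ =
      ‖((∫ X in slab d T, u X * diffQuot s σ φ X : ℝ) : ℂ)‖ₑ := by
    rw [← ofReal_norm, ← ofReal_norm, Complex.norm_real]
  rw [h3, h2]
  have m1 : AEMeasurable (fun X => ‖U X‖ₑ * ‖Λ X‖ₑ) (shearMeasure d T) :=
    hU.memLp'.1.enorm.mul hΛ.memLp'.1.enorm
  have m2 : AEMeasurable (fun X => ‖U X‖ₑ * (ENNReal.ofReal
      (symbolConst d s * ‖q X.1 X.2‖ ^ (2 * s)) * ‖Φ X‖ₑ)) (shearMeasure d T) := by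
    refine hU.memLp'.1.enorm.mul (AEMeasurable.mul ?_ hΦ.memLp'.1.enorm)
    have : Measurable fun X : ℝ × Phase d => q X.1 X.2 := hqc.measurable
    exact Measurable.aemeasurable (by fun_prop)
  calc ‖∫ X, (starRingEnd ℂ) (U X) * Λ X ∂shearMeasure d T‖ₑ
      ≤ ∫⁻ X, ‖(starRingEnd ℂ) (U X) * Λ X‖ₑ ∂shearMeasure d T := enorm_integral_le_lintegral_enorm _
    _ = ∫⁻ X, ‖U X‖ₑ * ‖Λ X‖ₑ ∂shearMeasure d T := by
        refine lintegral_congr fun X => ?_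
        rw [enorm_mul, ← ofReal_norm (_ : ℂ), RCLike.norm_conj, ofReal_norm]
    _ ≤ _ := by
        rw [lintegral_prod _ m1, lintegral_prod _ m2]
        refine lintegral_mono_ae ?_
        filter_upwards [hslice] with t ht
        refine lintegral_mono_ae ?_
        filter_upwards [ht] with k hk
        gcongr

theorem lintegral_enorm_mul_le {α : Type*} [MeasurableSpace α] {μ : Measure α} {f g : α → ℂ}
    {w : α → ℝ≥0∞} (hfw : AEMeasurable (fun x => ‖f x‖ₑ * w x) μ)
    (hg : AEStronglyMeasurable g μ) {b : α → ℝ} (hb : ∀ x, ‖f x‖ₑ * w x = ‖b x‖ₑ) :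
    ∫⁻ x, ‖f x‖ₑ * (w x * ‖g x‖ₑ) ∂μ ≤ eLpNorm b 2 μ * eLpNorm g 2 μ := by
  have h := ENNReal.lintegral_mul_le_Lp_mul_Lq μ Real.HolderConjugate.two_two hfw hg.enorm
  have e : ∀ {F : Type} [NormedAddCommGroup F] (v : α → F),
      eLpNorm v 2 μ = (∫⁻ x, ‖v x‖ₑ ^ (2 : ℝ) ∂μ) ^ (1 / (2 : ℝ)) := fun v => by
    rw [eLpNorm_eq_lintegral_rpow_enorm_toReal (by norm_num) (by norm_num)]
    simp
  rw [e, e]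
  simp_rw [← hb]
  refine le_trans (le_of_eq ?_) h
  refine lintegral_congr fun x => ?_
  simp [mul_assoc]

theorem integrable_diffQuot_slice [Nontrivial (Vec d)] {s : ℝ} (hs : 0 < s) (hs' : s < 1 / 2)
    (σ : Vec d →L[ℝ] Pt d) {φ : Pt d → ℝ} (hφ : IsTest T φ) (X : Pt d) :
    Integrable fun h : Vec d =>
      (φ X - φ (X - σ h)) / ‖h‖ ^ ((Module.finrank ℝ (Vec d) : ℝ) + 2 * s) := by
  obtain ⟨C, hC0, hC⟩ := exists_abs_sub_le_min (hφ.smooth.of_le (by simp)) hφ.compact σ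
  refine ((integrable_domKernel hs hs').const_mul C).mono' ?_
    (Eventually.of_forall fun h => abs_sub_div_le hC s X h)
  have := hφ.smooth.continuous
  refine Measurable.aestronglyMeasurable (Measurable.div ?_ (by fun_prop))
  exact (by fun_prop : Continuous fun h => φ X - φ (X - σ h)).measurable

theorem diffQuot_add [Nontrivial (Vec d)] {s : ℝ} (hs : 0 < s) (hs' : s < 1 / 2)
    (σ : Vec d →L[ℝ] Pt d) {φ φ' : Pt d → ℝ} (hφ : IsTest T φ) (hφ' : IsTest T φ') (X : Pt d) :
    diffQuot s σ (φ + φ') X = diffQuot s σ φ X + diffQuot s σ φ' X := by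
  rw [diffQuot, diffQuot, diffQuot, ← integral_add (integrable_diffQuot_slice hs hs' σ hφ X)
    (integrable_diffQuot_slice hs hs' σ hφ' X)]
  refine integral_congr_ae (Eventually.of_forall fun h => ?_)
  simp only [Pi.add_apply]
  ring

theorem diffQuot_const_smul (s : ℝ) (σ : Vec d →L[ℝ] Pt d) (c : ℝ) (φ : Pt d → ℝ) (X : Pt d) :
    diffQuot s σ (c • φ) X = c * diffQuot s σ φ X := by
  rw [diffQuot, diffQuot, ← integral_const_mul]
  refine integral_congr_ae (Eventually.of_forall fun h => ?_)
  simp only [Pi.smul_apply, smul_eq_mul]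
  ring

/-- If `M` is an operator on test functions with Fourier multiplier `b`, then the distribution
`u ↦ (u, c · diffQuot (M φ))` is a function in `L²`, provided that the Fourier transform of `u`
has the necessary decay. -/
theorem exists_represents_diffQuot [Nontrivial (Vec d)] {s : ℝ} (hs : 0 < s) (hs' : s < 1 / 2)
    {σ : Vec d →L[ℝ] Pt d} {τ : ℝ → Vec d →L[ℝ] Phase d} {q : ℝ → Phase d → Vec d}
    (hστ : ∀ t w h, shear (t, w) - σ h = shear (t, w - τ t h))
    (hq : ∀ t h k, inner ℝ (τ t h) k = inner ℝ h (q t k)) (hqc : Continuous (Function.uncurry q))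
    {u : Pt d → ℝ} (hu : MemLp u 2 (slabMeasure d T)) {U : ℝ × Phase d → ℂ}
    (hU : IsPFT (volume.restrict (timeSet T)) (fun X => (u (shear X) : ℂ)) U)
    (c : ℝ) {M : (Pt d → ℝ) → Pt d → ℝ} (hM : ∀ φ, IsTest T φ → IsTest T (M φ))
    (hMadd : ∀ φ φ', IsTest T φ → IsTest T φ' → M (φ + φ') = M φ + M φ')
    (hMsmul : ∀ (r : ℝ) φ, IsTest T φ → M (r • φ) = r • M φ)
    {b : ℝ × Phase d → ℂ} (hbc : Continuous b)
    (hMb : ∀ φ Φ, IsTest T φ →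
      IsPFT (volume.restrict (timeSet T)) (fun X => (φ (shear X) : ℂ)) Φ →
      IsPFT (volume.restrict (timeSet T)) (fun X => (M φ (shear X) : ℂ)) (fun X => b X * Φ X))
    (hfin : eLpNorm (fun X => |c| * symbolConst d s * (‖q X.1 X.2‖ ^ (2 * s) * ‖b X‖) * ‖U X‖) 2
      (shearMeasure d T) ≠ ⊤) :
    ∃ g, MemLp g 2 (slabMeasure d T) ∧
      eLpNorm g 2 (slabMeasure d T) ≤
        eLpNorm (fun X => |c| * symbolConst d s * (‖q X.1 X.2‖ ^ (2 * s) * ‖b X‖) * ‖U X‖) 2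
          (shearMeasure d T) ∧
      Represents T (fun φ X => c * diffQuot s σ (M φ) X) u g := by
  have hi : ∀ φ, IsTest T φ →
      Integrable (fun X => u X * (c * diffQuot s σ φ X)) (slabMeasure d T) := fun φ hφ =>
    hu.integrable_mul (((memLp_diffQuot volume hs hs' (hφ.smooth.of_le (by simp))
      hφ.compact σ).restrict _).const_mul c)
  obtain ⟨g, hg, hgn, hgr⟩ := exists_memLp_of_bounded (T := T)
    (D := fun φ => ∫ X in slab d T, u X * (c * diffQuot s σ (M φ) X))
    (fun φ φ' hφ hφ' => by
      rw [← integral_add (hi _ (hM φ hφ)) (hi _ (hM φ' hφ')), hMadd φ φ' hφ hφ']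
      refine integral_congr_ae (Eventually.of_forall fun X => ?_)
      simp only [diffQuot_add hs hs' σ (hM φ hφ) (hM φ' hφ')]
      ring)
    (fun r φ hφ => by
      rw [← integral_const_mul, hMsmul r φ hφ]
      refine integral_congr_ae (Eventually.of_forall fun X => ?_)
      simp only [diffQuot_const_smul]
      ring) hfin
    (fun φ hφ => by
      obtain ⟨Φ, hΦ⟩ := exists_pft (hφ.memLp 2)
      -- Boundedness of the functional: the powers of the frequency and the multiplier `b` are
      -- shifted from `Φ` onto `U`, and Cauchy-Schwarz leaves the norm of `φ` times the weighted
      -- norm of `U` assumed finite.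
      have h1 := enorm_integral_mul_diffQuot_le hs hs' hστ hq hqc hU (hM φ hφ) (hMb φ Φ hφ hΦ)
      have e1 : ∫ X in slab d T, u X * (c * diffQuot s σ (M φ) X) =
          c * ∫ X in slab d T, u X * diffQuot s σ (M φ) X := by
        rw [← integral_const_mul]
        refine integral_congr_ae (Eventually.of_forall fun X => ?_)
        simp only; ring
      rw [e1, enorm_mul, ← eLpNorm_pft_test hΦ]
      have hqm : Measurable fun X : ℝ × Phase d => q X.1 X.2 := hqc.measurable
      have hbm : Measurable b := hbc.measurable
      have hw : Measurable fun X : ℝ × Phase d => ENNReal.ofReal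
          (|c| * symbolConst d s * (‖q X.1 X.2‖ ^ (2 * s) * ‖b X‖)) := by fun_prop
      refine le_trans ?_ (lintegral_enorm_mul_le (hU.memLp'.1.enorm.mul hw.aemeasurable)
        hΦ.memLp'.1 (b := fun X => |c| * symbolConst d s * (‖q X.1 X.2‖ ^ (2 * s) * ‖b X‖) * ‖U X‖)
        fun X => ?_)
      · refine (mul_le_mul_right h1 _).trans (le_of_eq ?_)
        rw [← lintegral_const_mul' _ _ enorm_ne_top]
        refine lintegral_congr fun X => ?_
        rw [enorm_mul, ENNReal.ofReal_mul (mul_nonneg (abs_nonneg _) (symbolConst_nonneg d s)),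
          ENNReal.ofReal_mul (abs_nonneg _), ENNReal.ofReal_mul (symbolConst_nonneg d s),
          ENNReal.ofReal_mul (by positivity), ofReal_norm, ← Real.norm_eq_abs, ofReal_norm]
        ring
      · have : 0 ≤ |c| * symbolConst d s * (‖q X.1 X.2‖ ^ (2 * s) * ‖b X‖) :=
          mul_nonneg (mul_nonneg (abs_nonneg _) (symbolConst_nonneg d s)) (by positivity)
        rw [enorm_mul, enorm_norm, mul_comm, Real.enorm_of_nonneg this])
  refine ⟨g, hg, hgn, ?_, hgr⟩
  exact locallyIntegrableOn_of_locallyIntegrable_restrict (hg.locallyIntegrable (by norm_num))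

end Fractional

/-! ### The estimate in Fourier variables -/

section SliceEstimate

theorem enorm_sq_eq_re_add_im (z : ℂ) :
    ‖z‖ₑ ^ 2 = ENNReal.ofReal (z.re ^ 2) + ENNReal.ofReal (z.im ^ 2) := by
  rw [← ENNReal.ofReal_add (sq_nonneg _) (sq_nonneg _), ← ofReal_norm,
    ← ENNReal.ofReal_pow (norm_nonneg _), Complex.sq_norm, Complex.normSq_apply]
  congr 1; ring

theorem intervalIntegrable_of_memLp_restrict {J : Set ℝ} (hJ : ∀ t ∈ J, Iic t ⊆ J) {Y : ℝ → ℂ}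
    (hY : MemLp Y 2 (volume.restrict J)) : ∀ s ∈ J, ∀ t ∈ J, IntervalIntegrable Y volume s t := by
  intro s hs t ht
  have hsub : uIcc s t ⊆ J := fun x hx => by
    rcases le_total s t with h | h
    · rw [uIcc_of_le h] at hx; exact hJ t ht hx.2
    · rw [uIcc_of_ge h] at hx; exact hJ s hs hx.2
  have h1 : MemLp Y 2 (volume.restrict (uIcc s t)) := hY.mono_measure (Measure.restrict_mono_set _ hsub)
  have : IsFiniteMeasure (volume.restrict (uIcc s t)) := ⟨by
    rw [Measure.restrict_apply_univ]; exact isCompact_uIcc.measure_lt_top⟩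
  exact IntegrableOn.intervalIntegrable (h1.integrable (by norm_num))

/-- An estimate for real solutions of a linear ordinary differential equation carries over to
complex solutions. -/
theorem complex_ode_estimate {J : Set ℝ} (hJo : IsOpen J) (hJ : ∀ t ∈ J, Iic t ⊆ J)
    {w b : ℝ → ℝ} (hw : Continuous w) {C : ℝ≥0∞}
    (hest : ∀ v F f : ℝ → ℝ, (∀ s ∈ J, ∀ t ∈ J, IntervalIntegrable F volume s t) →
      (∀ s ∈ J, ∀ t ∈ J, v t = v s + ∫ τ in s..t, F τ) → ContinuousOn v J →
      IntegrableOn (fun t => v t ^ 2) J → IntegrableOn (fun t => f t ^ 2) J →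
      (∀ᵐ t, t ∈ J → F t = f t - b t * v t) →
      ∫⁻ t in J, ENNReal.ofReal ((w t * v t) ^ 2) ≤ C * ∫⁻ t in J, ENNReal.ofReal (f t ^ 2))
    {V Y F : ℝ → ℂ} {c : ℂ} {t₀ : ℝ} (ht₀ : t₀ ∈ J) (hV : MemLp V 2 (volume.restrict J))
    (hY : MemLp Y 2 (volume.restrict J)) (hF : MemLp F 2 (volume.restrict J))
    (hVY : ∀ᵐ t ∂volume.restrict J, V t = c + ∫ τ in t₀..t, Y τ)
    (heq : ∀ᵐ t ∂volume.restrict J, F t = Y t + b t * V t) :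
    ∫⁻ t in J, ‖w t * V t‖ₑ ^ 2 ≤ C * ∫⁻ t in J, ‖F t‖ₑ ^ 2 := by
  have hYi := intervalIntegrable_of_memLp_restrict hJ hY
  -- The absolutely continuous representative of `V`. Since `b` and `w` are real, its real and
  -- imaginary parts solve the equation separately.
  obtain ⟨v, hv⟩ : ∃ v : ℝ → ℂ, ∀ t, v t = c + ∫ τ in t₀..t, Y τ := ⟨_, fun _ => rfl⟩
  have hVv : V =ᵐ[volume.restrict J] v := by
    filter_upwards [hVY] with t ht
    rw [ht, hv]
  have hvst : ∀ s ∈ J, ∀ t ∈ J, v t = v s + ∫ τ in s..t, Y τ := fun s hs t ht => by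
    rw [hv, hv, add_assoc, intervalIntegral.integral_add_adjacent_intervals (hYi _ ht₀ _ hs)
      (hYi _ hs _ ht)]
  have hvc : ContinuousOn v J := by
    intro t ht
    obtain ⟨ε, hε, hball⟩ := Metric.isOpen_iff.1 hJo t ht
    have hb : t + ε / 2 ∈ J := hball (by
      rw [Metric.mem_ball, Real.dist_eq, add_sub_cancel_left, abs_of_pos (by positivity)]; linarith)
    have ha : t - 1 ∈ J := hJ t ht (by simp)
    have h1 : ContinuousOn (fun x => ∫ τ in (t - 1)..x, Y τ) (uIcc (t - 1) (t + ε / 2)) :=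
      intervalIntegral.continuousOn_primitive_interval
        ((intervalIntegrable_iff' enorm_ne_top).1 (hYi _ ha _ hb))
    have hn : uIcc (t - 1) (t + ε / 2) ∈ 𝓝 t := by
      rw [uIcc_of_le (by linarith)]
      exact Icc_mem_nhds (by linarith) (by linarith)
    have h2 : ContinuousAt (fun x => v (t - 1) + ∫ τ in (t - 1)..x, Y τ) t :=
      continuousAt_const.add (h1.continuousAt hn)
    refine (h2.congr ?_).continuousWithinAt
    filter_upwards [hJo.mem_nhds ht] with x hx
    exact (hvst _ ha _ hx).symm
  have hvL : MemLp v 2 (volume.restrict J) := hV.ae_eq hVv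
  have heq' : ∀ᵐ t, t ∈ J → Y t = F t - b t * v t := by
    rw [← ae_restrict_iff' hJo.measurableSet]
    filter_upwards [heq, hVv] with t h1 h2
    rw [h1, h2]; ring
  have sq : ∀ {g : ℝ → ℝ}, MemLp g 2 (volume.restrict J) → IntegrableOn (fun t => g t ^ 2) J :=
    fun hg => hg.integrable_sq
  have hre := hest (fun t => (v t).re) (fun t => (Y t).re) (fun t => (F t).re)
    (fun s hs t ht => ⟨(hYi s hs t ht).1.re, (hYi s hs t ht).2.re⟩)
    (fun s hs t ht => by
      have := congrArg Complex.re (hvst s hs t ht)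
      rw [Complex.add_re] at this
      rw [this]
      congr 1
      exact (Complex.reCLM.intervalIntegral_comp_comm (hYi s hs t ht)).symm)
    (Complex.continuous_re.comp_continuousOn hvc) (sq hvL.re) (sq hF.re) (by
      filter_upwards [heq'] with t ht htJ
      rw [ht htJ]; simp)
  have him := hest (fun t => (v t).im) (fun t => (Y t).im) (fun t => (F t).im)
    (fun s hs t ht => ⟨(hYi s hs t ht).1.im, (hYi s hs t ht).2.im⟩)
    (fun s hs t ht => by
      have := congrArg Complex.im (hvst s hs t ht)
      rw [Complex.add_im] at this
      rw [this]
      congr 1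
      exact (Complex.imCLM.intervalIntegral_comp_comm (hYi s hs t ht)).symm)
    (Complex.continuous_im.comp_continuousOn hvc) (sq hvL.im) (sq hF.im) (by
      filter_upwards [heq'] with t ht htJ
      rw [ht htJ]; simp)
  have hvm : AEMeasurable (fun t => (v t).re) (volume.restrict J) :=
    hvL.re.1.aemeasurable
  have m1 : AEMeasurable (fun t => ENNReal.ofReal ((w t * (v t).re) ^ 2)) (volume.restrict J) :=
    ((hw.measurable.aemeasurable.mul hvm).pow_const 2).ennreal_ofReal
  have hFm : AEMeasurable (fun t => (F t).re) (volume.restrict J) := hF.re.1.aemeasurable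
  have m2 : AEMeasurable (fun t => ENNReal.ofReal ((F t).re ^ 2)) (volume.restrict J) :=
    (hFm.pow_const 2).ennreal_ofReal
  have e1 : ∫⁻ t in J, ‖w t * V t‖ₑ ^ 2 = ∫⁻ t in J, (ENNReal.ofReal ((w t * (v t).re) ^ 2) +
      ENNReal.ofReal ((w t * (v t).im) ^ 2)) := by
    refine lintegral_congr_ae ?_
    filter_upwards [hVv] with t ht
    rw [ht, enorm_sq_eq_re_add_im, Complex.re_ofReal_mul, Complex.im_ofReal_mul]
  rw [e1, lintegral_add_left' m1]
  simp_rw [enorm_sq_eq_re_add_im]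
  rw [lintegral_add_left' m2, mul_add]
  exact add_le_add hre him

end SliceEstimate

/-! ### The frequencies along the flow and the powers of them that the weight dominates. -/

section PhaseEstimate

variable {d : ℕ} {T : EReal}

/-- The weight in Fourier variables. -/
def fourierWeight (X : ℝ × Phase d) : ℝ :=
  curveWeight X.2.fst X.2.snd.fst X.2.snd.snd X.1

/-- The frequency dual to `x` along the flow. -/
def freq (X : ℝ × Phase d) : Vec d := curve X.2.fst X.2.snd.fst X.2.snd.snd X.1

/-- The frequency dual to `y` along the flow. -/
def freqY (t : ℝ) (k : Phase d) : Vec d := velocity k.snd.fst k.snd.snd t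

/-- The frequency dual to `z` along the flow. -/
def freqZ (_ : ℝ) (k : Phase d) : Vec d := k.snd.snd

theorem continuous_phase_fst : Continuous fun X : ℝ × Phase d => X.2.fst :=
  (contDiff_withLp_fst (n := 0)).continuous.comp continuous_snd

theorem continuous_phase_snd_fst : Continuous fun X : ℝ × Phase d => X.2.snd.fst :=
  (contDiff_withLp_fst (n := 0)).continuous.comp
    ((contDiff_withLp_snd (n := 0)).continuous.comp continuous_snd)

theorem continuous_phase_snd_snd : Continuous fun X : ℝ × Phase d => X.2.snd.snd :=
  (contDiff_withLp_snd (n := 0)).continuous.comp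
    ((contDiff_withLp_snd (n := 0)).continuous.comp continuous_snd)

theorem continuous_freq : Continuous (freq (d := d)) := by
  have h1 := continuous_phase_fst (d := d)
  have h2 := continuous_phase_snd_fst (d := d)
  have h3 := continuous_phase_snd_snd (d := d)
  unfold freq curve
  fun_prop

theorem continuous_freqY : Continuous (Function.uncurry (freqY (d := d))) := by
  have h2 := continuous_phase_snd_fst (d := d)
  have h3 := continuous_phase_snd_snd (d := d)
  unfold freqY velocity Function.uncurry
  fun_prop

theorem continuous_freqZ : Continuous (Function.uncurry (freqZ (d := d))) :=
  continuous_phase_snd_snd (d := d)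

theorem fourierWeight_eq (X : ℝ × Phase d) : fourierWeight X = ‖freq X‖ ^ 2 +
    (‖freqY X.1 X.2‖ ^ 2 + (‖freqZ X.1 X.2‖ ^ (1 / 5 : ℝ)) ^ 6) ^ (1 / 3 : ℝ) := rfl

theorem continuous_fourierWeight : Continuous (fourierWeight (d := d)) := by
  have h1 := continuous_freq (d := d)
  have h2 : Continuous fun X : ℝ × Phase d => freqY X.1 X.2 := continuous_freqY
  have h3 : Continuous fun X : ℝ × Phase d => freqZ X.1 X.2 := continuous_freqZ
  have h4 : Continuous fun X : ℝ × Phase d => ‖freqZ X.1 X.2‖ ^ (1 / 5 : ℝ) :=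
    h3.norm.rpow_const fun _ => Or.inr (by norm_num)
  have h5 : Continuous fun X : ℝ × Phase d =>
      (‖freqY X.1 X.2‖ ^ 2 + (‖freqZ X.1 X.2‖ ^ (1 / 5 : ℝ)) ^ 6) ^ (1 / 3 : ℝ) :=
    ((h2.norm.pow 2).add (h4.pow 6)).rpow_const fun _ => Or.inr (by norm_num)
  exact (h1.norm.pow 2).add h5

theorem fourierWeight_nonneg (X : ℝ × Phase d) : 0 ≤ fourierWeight X := by
  rw [fourierWeight_eq]; positivity

theorem freq_sq_le_weight (X : ℝ × Phase d) : ‖freq X‖ ^ 2 ≤ fourierWeight X := by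
  rw [fourierWeight_eq]
  exact le_add_of_nonneg_right (by positivity)

theorem freqY_rpow_le_rho (X : ℝ × Phase d) : ‖freqY X.1 X.2‖ ^ (2 / 3 : ℝ) ≤
    (‖freqY X.1 X.2‖ ^ 2 + (‖freqZ X.1 X.2‖ ^ (1 / 5 : ℝ)) ^ 6) ^ (1 / 3 : ℝ) := by
  calc ‖freqY X.1 X.2‖ ^ (2 / 3 : ℝ) = (‖freqY X.1 X.2‖ ^ 2) ^ (1 / 3 : ℝ) := by
        rw [← Real.rpow_natCast, ← Real.rpow_mul (norm_nonneg _)]; norm_num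
    _ ≤ _ := by
        gcongr
        exact le_add_of_nonneg_right (by positivity)

theorem freqY_rpow_le_weight (X : ℝ × Phase d) :
    ‖freqY X.1 X.2‖ ^ (2 / 3 : ℝ) ≤ fourierWeight X := by
  rw [fourierWeight_eq]
  exact (freqY_rpow_le_rho X).trans (le_add_of_nonneg_left (by positivity))

theorem freqZ_rpow_le_weight (X : ℝ × Phase d) :
    ‖freqZ X.1 X.2‖ ^ (2 / 5 : ℝ) ≤ fourierWeight X := by
  rw [fourierWeight_eq]
  calc ‖freqZ X.1 X.2‖ ^ (2 / 5 : ℝ) = ((‖freqZ X.1 X.2‖ ^ (1 / 5 : ℝ)) ^ 6) ^ (1 / 3 : ℝ) := by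
        rw [← Real.rpow_natCast (_ ^ (1 / 5 : ℝ)), ← Real.rpow_mul (norm_nonneg _),
          ← Real.rpow_mul (norm_nonneg _)]; norm_num
    _ ≤ (‖freqY X.1 X.2‖ ^ 2 + (‖freqZ X.1 X.2‖ ^ (1 / 5 : ℝ)) ^ 6) ^ (1 / 3 : ℝ) := by
        gcongr
        exact le_add_of_nonneg_left (by positivity)
    _ ≤ _ := le_add_of_nonneg_left (by positivity)

/-- The mixed term lies between the two others: `ab ≤ a² + b²` with `a = |p'|^{1/3}` and `b = |p|`.
-/
theorem freqY_mul_freq_le_weight (X : ℝ × Phase d) :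
    ‖freqY X.1 X.2‖ ^ (1 / 3 : ℝ) * ‖freq X‖ ≤ fourierWeight X := by
  have h1 := freqY_rpow_le_rho X
  have h2 : ‖freqY X.1 X.2‖ ^ (2 / 3 : ℝ) = (‖freqY X.1 X.2‖ ^ (1 / 3 : ℝ)) ^ 2 := by
    rw [← Real.rpow_natCast (_ ^ (1 / 3 : ℝ)), ← Real.rpow_mul (norm_nonneg _)]; norm_num
  rw [h2] at h1
  rw [fourierWeight_eq]
  nlinarith [sq_nonneg (‖freqY X.1 X.2‖ ^ (1 / 3 : ℝ) - ‖freq X‖),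
    sq_nonneg (‖freqY X.1 X.2‖ ^ (1 / 3 : ℝ)), sq_nonneg ‖freq X‖]

theorem abs_freq_apply_le (X : ℝ × Phase d) (i : Fin d) : |freq X i| ≤ ‖freq X‖ := by
  have := PiLp.norm_apply_le (freq X) i
  rwa [Real.norm_eq_abs] at this

/-- The multipliers divide by powers of `|p''| = |ζ|`, so the frequencies with `ζ = 0` must be
discarded. They form a proper subspace because `d > 0`. -/
theorem ae_freqZ_ne_zero (hd : 0 < d) : ∀ᵐ k : Phase d, k.snd.snd ≠ 0 := by
  let L : Phase d →ₗ[ℝ] Vec d :=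
    { toFun := fun k => k.snd.snd
      map_add' := fun _ _ => rfl
      map_smul' := fun _ _ => rfl }
  have hL : LinearMap.ker L ≠ ⊤ := by
    intro h
    have h1 : Phase.mk 0 0 (EuclideanSpace.single ⟨0, hd⟩ 1) ∈ LinearMap.ker L := h ▸ trivial
    have h2 : (EuclideanSpace.single ⟨0, hd⟩ 1 : Vec d) = 0 := h1
    have h3 := congrArg (fun v : Vec d => v ⟨0, hd⟩) h2
    simp at h3
  have h := Measure.addHaar_submodule (volume : Measure (Phase d)) _ hL
  rw [ae_iff]
  have e : {k : Phase d | ¬k.snd.snd ≠ 0} = (LinearMap.ker L : Set (Phase d)) := by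
    ext k
    exact not_not
  rw [e, h]

end PhaseEstimate

/-! ### From the ODE estimates at fixed frequency to estimates in `L²`. -/

section FourierEstimate

theorem ae_ae_of_ae_prod_symm {α β : Type*} [MeasurableSpace α] [MeasurableSpace β]
    {μ : Measure α} {ν : Measure β} [SFinite μ] [SFinite ν] {p : α × β → Prop}
    (h : ∀ᵐ X ∂μ.prod ν, p X) : ∀ᵐ k ∂ν, ∀ᵐ t ∂μ, p (t, k) :=
  Measure.ae_ae_of_ae_prod
    ((Measure.measurePreserving_swap (μ := ν) (ν := μ)).quasiMeasurePreserving.ae h)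

theorem ae_memLp_slice_symm {α β F : Type*} [MeasurableSpace α] [MeasurableSpace β]
    [NormedAddCommGroup F] {μ : Measure α} {ν : Measure β} [SFinite μ] [SFinite ν] {f : α × β → F}
    (hf : MemLp f 2 (μ.prod ν)) : ∀ᵐ k ∂ν, MemLp (fun t => f (t, k)) 2 μ :=
  ae_memLp_slice (hf.comp_measurePreserving (Measure.measurePreserving_swap (μ := ν) (ν := μ)))

/-- Tonelli with the time integral inside: for almost every frequency all the almost everywhere
statements hold along the time line, and the one-dimensional estimate applies with a constant
independent of the frequency. -/
theorem integrated_ode_estimate {E : Type*} [NormedAddCommGroup E] [MeasurableSpace E]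
    [BorelSpace E] [SecondCountableTopology E] {ν : Measure E} [SFinite ν] {J : Set ℝ}
    (hJo : IsOpen J) (hJ : ∀ t ∈ J, Iic t ⊆ J) {w b : ℝ × E → ℝ} (hw : Continuous w) {C : ℝ≥0∞}
    (hC : C ≠ ⊤)
    (hest : ∀ᵐ k ∂ν, ∀ v F f : ℝ → ℝ, (∀ s ∈ J, ∀ t ∈ J, IntervalIntegrable F volume s t) →
      (∀ s ∈ J, ∀ t ∈ J, v t = v s + ∫ τ in s..t, F τ) → ContinuousOn v J →
      IntegrableOn (fun t => v t ^ 2) J → IntegrableOn (fun t => f t ^ 2) J →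
      (∀ᵐ t, t ∈ J → F t = f t - b (t, k) * v t) →
      ∫⁻ t in J, ENNReal.ofReal ((w (t, k) * v t) ^ 2) ≤ C * ∫⁻ t in J, ENNReal.ofReal (f t ^ 2))
    {U Y F : ℝ × E → ℂ} {c : E → ℂ} {t₀ : ℝ} (ht₀ : t₀ ∈ J)
    (hU : MemLp U 2 ((volume.restrict J).prod ν)) (hY : MemLp Y 2 ((volume.restrict J).prod ν))
    (hF : MemLp F 2 ((volume.restrict J).prod ν))
    (hUY : ∀ᵐ X ∂(volume.restrict J).prod ν, U X = c X.2 + ∫ τ in t₀..X.1, Y (τ, X.2))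
    (heq : ∀ᵐ X ∂(volume.restrict J).prod ν, F X = Y X + b X * U X) :
    eLpNorm (fun X => w X * U X) 2 ((volume.restrict J).prod ν) ^ 2 ≤
      C * eLpNorm F 2 ((volume.restrict J).prod ν) ^ 2 := by
  have hwm : AEStronglyMeasurable (fun X => (w X : ℂ) * U X) ((volume.restrict J).prod ν) :=
    (Complex.continuous_ofReal.comp hw).aestronglyMeasurable.mul hU.1
  rw [eLpNorm_two_sq, eLpNorm_two_sq, lintegral_prod_symm _ (hwm.enorm.pow_const 2),
    lintegral_prod_symm _ (hF.1.enorm.pow_const 2), ← lintegral_const_mul' _ _ hC]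
  refine lintegral_mono_ae ?_
  filter_upwards [hest, ae_memLp_slice_symm hU, ae_memLp_slice_symm hY, ae_memLp_slice_symm hF,
    ae_ae_of_ae_prod_symm hUY, ae_ae_of_ae_prod_symm heq] with k h1 h2 h3 h4 h5 h6
  exact complex_ode_estimate hJo hJ (w := fun t => w (t, k)) (b := fun t => b (t, k))
    (by fun_prop) h1 ht₀ h2 h3 h4 h5 h6

variable {d : ℕ} {T : EReal} {δ lam : ℝ}

/-- The symbol of `-∑ a^{ij} ∂_{x_i x_j} + λ`. -/
def coeffSymbol (a : ℝ → Matrix (Fin d) (Fin d) ℝ) (lam : ℝ) (X : ℝ × Phase d) : ℝ :=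
  4 * Real.pi ^ 2 * (∑ i, ∑ j, a X.1 i j * freq X i * freq X j) + lam

theorem coeffSymbol_lower {a : ℝ → Matrix (Fin d) (Fin d) ℝ} (ha : IsCoeff δ a) (hδ : 0 < δ)
    (X : ℝ × Phase d) : δ * ‖freq X‖ ^ 2 + lam ≤ coeffSymbol a lam X := by
  have h1 := ha.lower X.1 (freq X)
  have h2 : (1 : ℝ) ≤ 4 * Real.pi ^ 2 := by nlinarith [Real.pi_gt_three]
  have h3 : 0 ≤ δ * ‖freq X‖ ^ 2 := by positivity
  unfold coeffSymbol
  nlinarith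

theorem abs_coeffSymbol_le {a : ℝ → Matrix (Fin d) (Fin d) ℝ} (ha : IsCoeff δ a) (hδ : 0 < δ)
    (hlam : 0 ≤ lam) (X : ℝ × Phase d) :
    |coeffSymbol a lam X| ≤ 4 * Real.pi ^ 2 * δ⁻¹ * fourierWeight X + lam := by
  have h1 := ha.upper X.1 (freq X)
  have h2 := coeffSymbol_lower ha hδ (lam := lam) X
  have h3 : 0 ≤ δ * ‖freq X‖ ^ 2 := by positivity
  have h4 : δ⁻¹ * ‖freq X‖ ^ 2 ≤ δ⁻¹ * fourierWeight X := by
    gcongr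
    exact freq_sq_le_weight X
  rw [abs_of_nonneg (by linarith), coeffSymbol, mul_assoc (4 * Real.pi ^ 2)]
  exact add_le_add_left (mul_le_mul_of_nonneg_left (h1.trans h4) (by positivity)) lam

theorem memLp_apply {α ι : Type*} [Fintype ι] [MeasurableSpace α] {μ : Measure α} {p : ℝ≥0∞}
    {f : α → EuclideanSpace ℝ ι} (hf : MemLp f p μ) (i : ι) : MemLp (fun x => f x i) p μ :=
  (EuclideanSpace.proj i : EuclideanSpace ℝ ι →L[ℝ] ℝ).comp_memLp' hf

theorem eLpNorm_le_sum {α ι : Type*} [Fintype ι] [MeasurableSpace α] {μ : Measure α}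
    {f : α → EuclideanSpace ℝ ι} (hf : ∀ i, AEStronglyMeasurable (fun x => f x i) μ) :
    eLpNorm f 2 μ ≤ ∑ i, eLpNorm (fun x => f x i) 2 μ := by
  classical
  have h1 : eLpNorm f 2 μ ≤ eLpNorm (∑ i, fun x => |f x i|) 2 μ := by
    refine eLpNorm_mono_real fun x => ?_
    have h2 : f x = ∑ i, EuclideanSpace.single i (f x i) := by
      ext j
      simp
    calc ‖f x‖ = ‖∑ i, EuclideanSpace.single i (f x i)‖ := by rw [← h2]
      _ ≤ ∑ i, ‖EuclideanSpace.single i (f x i)‖ := norm_sum_le _ _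
      _ = (∑ i, fun x => |f x i|) x := by simp
  refine h1.trans ((eLpNorm_sum_le (fun i _ => (hf i).norm) (by norm_num)).trans (le_of_eq ?_))
  refine Finset.sum_congr rfl fun i _ => ?_
  exact eLpNorm_norm _

/-- Every ingredient of the equation is expressed through `U` and the transform of `Y`. The last
part is the differential equation: as `Yh` will be the time derivative of `U`, it reads `U' +
coeffSymbol · U = F` with `F` the transform of the right-hand side. -/
theorem pft_of_memS {a : ℝ → Matrix (Fin d) (Fin d) ℝ} (ha : IsCoeff δ a)
    {u : Pt d → ℝ} {G : Pt d → Vec d} {H : Pt d → EuclideanSpace ℝ (Fin d × Fin d)} {Y : Pt d → ℝ}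
    (hS : MemS 2 T u G H Y) {U : ℝ × Phase d → ℂ}
    (hU : IsPFT (volume.restrict (timeSet T)) (fun X => (u (shear X) : ℂ)) U) :
    (∀ i, IsPFT (volume.restrict (timeSet T)) (fun X => (G (shear X) i : ℂ))
      (fun X => 2 * Real.pi * Complex.I * (freq X i : ℝ) * U X)) ∧
    (∀ i j, IsPFT (volume.restrict (timeSet T)) (fun X => (H (shear X) (i, j) : ℂ))
      (fun X => -(4 * Real.pi ^ 2 * (freq X i * freq X j) : ℝ) * U X)) ∧
    (∀ Yh, IsPFT (volume.restrict (timeSet T)) (fun X => (Y (shear X) : ℂ)) Yh →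
      IsPFT (volume.restrict (timeSet T))
        (fun X => ((P₀ a H Y (shear X) + lam * u (shear X) : ℝ) : ℂ))
        (fun X => Yh X + coeffSymbol a lam X * U X)) := by
  have hG : ∀ i, IsPFT (volume.restrict (timeSet T)) (fun X => (G (shear X) i : ℂ))
      (fun X => 2 * Real.pi * Complex.I * (freq X i : ℝ) * U X) := fun i => by
    obtain ⟨Gi, hGi⟩ := exists_pft (memLp_apply hS.memLp_gradX i)
    exact hGi.congr ae_eq_rfl (pft_gradX i hU hGi (hS.isGradX i).2)
  have hH : ∀ i j, IsPFT (volume.restrict (timeSet T)) (fun X => (H (shear X) (i, j) : ℂ))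
      (fun X => -(4 * Real.pi ^ 2 * (freq X i * freq X j) : ℝ) * U X) := fun i j => by
    obtain ⟨Hij, hHij⟩ := exists_pft (memLp_apply hS.memLp_hessX (i, j))
    refine hHij.congr ae_eq_rfl ?_
    filter_upwards [pft_hessX hS.isGradX hS.isHessX (hG i) hHij] with X hX
    rw [hX]
    change 2 * Real.pi * Complex.I * (freq X j : ℝ) *
      (2 * Real.pi * Complex.I * (freq X i : ℝ) * U X) = _
    push_cast
    linear_combination (4 * Real.pi ^ 2 * (freq X i : ℂ) * freq X j * U X) * Complex.I_sq
  refine ⟨hG, hH, fun Yh hYh => ?_⟩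
  obtain ⟨K, hK⟩ := ha.bounded
  have hsum := IsPFT.sum Finset.univ fun i _ => IsPFT.sum Finset.univ fun j _ =>
    (hH i j).mul_left (a := fun t => ((a t i j : ℝ) : ℂ)) (K := K)
      ((ha.measurable i j).restrict.complex_ofReal.aestronglyMeasurable)
      (fun t => by rw [Complex.norm_real]; exact hK t i j)
  have hlamU := hU.mul_left (a := fun _ => (lam : ℂ)) (K := |lam|) aestronglyMeasurable_const
    (fun t => by rw [Complex.norm_real, Real.norm_eq_abs])
  refine ((hYh.sub hsum).add hlamU).congr (Eventually.of_forall fun X => ?_)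
    (Eventually.of_forall fun X => ?_)
  · simp [P₀, Finset.sum_apply]
  · simp only [Pi.add_apply, Pi.sub_apply, Finset.sum_apply, coeffSymbol]
    push_cast
    rw [add_mul, Finset.mul_sum, Finset.sum_mul, sub_eq_add_neg, ← Finset.sum_neg_distrib, add_assoc]
    congr 2
    refine Finset.sum_congr rfl fun i _ => ?_
    rw [Finset.mul_sum, Finset.sum_mul, ← Finset.sum_neg_distrib]
    refine Finset.sum_congr rfl fun j _ => ?_
    ring

theorem eLpNorm_le_sqrt_mul {x y : ℝ≥0∞} {C : ℝ} (h : x ^ 2 ≤ ENNReal.ofReal C * y ^ 2) :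
    x ≤ ENNReal.ofReal (Real.sqrt C) * y := by
  rw [← ENNReal.pow_le_pow_left_iff two_ne_zero, mul_pow, ← ENNReal.ofReal_pow (Real.sqrt_nonneg _)]
  rcases le_total 0 C with hC | hC
  · rwa [Real.sq_sqrt hC]
  · rw [ENNReal.ofReal_of_nonpos hC] at h
    exact h.trans (by simp)

/-- The basic estimates for the Fourier transform of a solution. -/
theorem fourier_estimates (hd : 0 < d) (hδ : 0 < δ) (hδ' : δ < 1) (hT : T ≠ ⊥)
    {a : ℝ → Matrix (Fin d) (Fin d) ℝ} (ha : IsCoeff δ a) (hlam : 0 ≤ lam)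
    {u : Pt d → ℝ} {G : Pt d → Vec d} {H : Pt d → EuclideanSpace ℝ (Fin d × Fin d)} {Y : Pt d → ℝ}
    (hS : MemS 2 T u G H Y) {U Yh : ℝ × Phase d → ℂ}
    (hU : IsPFT (volume.restrict (timeSet T)) (fun X => (u (shear X) : ℂ)) U)
    (hYh : IsPFT (volume.restrict (timeSet T)) (fun X => (Y (shear X) : ℂ)) Yh) :
    eLpNorm (fun X => fourierWeight X * U X) 2 (shearMeasure d T) ≤
      ENNReal.ofReal (Real.sqrt (odeConst δ)) *
        norm2 T (fun X => P₀ a H Y X + lam * u X) ∧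
    eLpNorm (fun X => lam * U X) 2 (shearMeasure d T) ≤
      norm2 T (fun X => P₀ a H Y X + lam * u X) := by
  obtain ⟨t₀, ht₀⟩ := timeSet_nonempty hT
  obtain ⟨c, hc⟩ := pft_transport hU hYh hS.isTransport ht₀
  have hF := (pft_of_memS (lam := lam) ha hS hU).2.2 Yh hYh
  have hFn : eLpNorm (fun X => Yh X + coeffSymbol a lam X * U X) 2 (shearMeasure d T) =
      norm2 T (fun X => P₀ a H Y X + lam * u X) :=
    eLpNorm_pft_test (φ := fun X => P₀ a H Y X + lam * u X) hF
  have hb1 : ∀ X : ℝ × Phase d, δ * ‖freq X‖ ^ 2 ≤ coeffSymbol a lam X := fun X => by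
    linarith [coeffSymbol_lower ha hδ (lam := lam) X]
  have hb2 : ∀ X : ℝ × Phase d, lam ≤ coeffSymbol a lam X := fun X => by
    have : 0 ≤ δ * ‖freq X‖ ^ 2 := by positivity
    linarith [coeffSymbol_lower ha hδ (lam := lam) X]
  constructor
  · refine eLpNorm_le_sqrt_mul ?_
    rw [← hFn]
    refine integrated_ode_estimate (isOpen_timeSet T) Iic_subset_timeSet
      (b := coeffSymbol a lam) continuous_fourierWeight ENNReal.ofReal_ne_top ?_ ht₀ hU.memLp'
      hYh.memLp' hF.memLp' hc (Eventually.of_forall fun X => rfl)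
    filter_upwards [ae_freqZ_ne_zero hd] with k hk v F f h1 h2 h3 h4 h5 h6
    exact ode_weighted_estimate hδ hδ' k.fst k.snd.fst hk (isOpen_timeSet T) Iic_subset_timeSet
      h1 h2 h3 h4 h5 (fun t _ => hb1 (t, k)) h6
  · have h := integrated_ode_estimate (isOpen_timeSet T) Iic_subset_timeSet
      (b := coeffSymbol a lam) (w := fun _ => lam) (C := 1) (ν := (volume : Measure (Phase d)))
      continuous_const ENNReal.one_ne_top
      (Eventually.of_forall fun k v F f h1 h2 h3 h4 h5 h6 => by
        rw [one_mul]
        exact ode_zero_order_estimate hlam (isOpen_timeSet T) Iic_subset_timeSet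
          h1 h2 h3 h4 h5 (fun t _ => hb2 (t, k)) h6) ht₀ hU.memLp'
      hYh.memLp' hF.memLp' hc (Eventually.of_forall fun X => rfl)
    rw [one_mul, hFn] at h
    exact (ENNReal.pow_le_pow_left_iff two_ne_zero).1 h

end FourierEstimate

/-! ### Translations in straightened coordinates and the bound of each single term. -/

section Conclusion

variable {d : ℕ} {T : EReal}

/-- Translations in `y`. -/
def transY (d : ℕ) : Vec d →L[ℝ] Pt d :=
  (ContinuousLinearMap.inr ℝ ℝ (Vec d × Vec d × Vec d)).comp
    ((ContinuousLinearMap.inr ℝ (Vec d) (Vec d × Vec d)).comp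
      (ContinuousLinearMap.inl ℝ (Vec d) (Vec d)))

/-- Translations in `z`. -/
def transZ (d : ℕ) : Vec d →L[ℝ] Pt d :=
  (ContinuousLinearMap.inr ℝ ℝ (Vec d × Vec d × Vec d)).comp
    ((ContinuousLinearMap.inr ℝ (Vec d) (Vec d × Vec d)).comp
      (ContinuousLinearMap.inr ℝ (Vec d) (Vec d)))

/-- Translations in `y` in straightened coordinates. -/
def shearTransY (t : ℝ) : Vec d →L[ℝ] Phase d :=
  (WithLp.prodContinuousLinearEquiv 2 ℝ (Vec d) (WithLp 2 (Vec d × Vec d))).symm.toContinuousLinearMap.comp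
    ((ContinuousLinearMap.inr ℝ (Vec d) (WithLp 2 (Vec d × Vec d))).comp
      ((WithLp.prodContinuousLinearEquiv 2 ℝ (Vec d) (Vec d)).symm.toContinuousLinearMap.comp
        ((ContinuousLinearMap.id ℝ (Vec d)).prod (t • ContinuousLinearMap.id ℝ (Vec d)))))

/-- Translations in `z` in straightened coordinates. -/
def shearTransZ (_ : ℝ) : Vec d →L[ℝ] Phase d :=
  (WithLp.prodContinuousLinearEquiv 2 ℝ (Vec d) (WithLp 2 (Vec d × Vec d))).symm.toContinuousLinearMap.comp
    ((ContinuousLinearMap.inr ℝ (Vec d) (WithLp 2 (Vec d × Vec d))).comp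
      ((WithLp.prodContinuousLinearEquiv 2 ℝ (Vec d) (Vec d)).symm.toContinuousLinearMap.comp
        (ContinuousLinearMap.inr ℝ (Vec d) (Vec d))))

theorem shearTransY_apply (t : ℝ) (h : Vec d) : shearTransY t h = Phase.mk 0 h (t • h) := rfl

theorem shearTransZ_apply (t : ℝ) (h : Vec d) : shearTransZ t h = Phase.mk 0 0 h := rfl

theorem sub_transY (X : Pt d) (h : Vec d) :
    X - transY d h = (X.1, X.2.1, X.2.2.1 - h, X.2.2.2) :=
  Prod.ext (sub_zero _) (Prod.ext (sub_zero _) (Prod.ext rfl (sub_zero _)))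

theorem sub_transZ (X : Pt d) (h : Vec d) :
    X - transZ d h = (X.1, X.2.1, X.2.2.1, X.2.2.2 - h) :=
  Prod.ext (sub_zero _) (Prod.ext (sub_zero _) (Prod.ext (sub_zero _) rfl))

/-- A shift of `y` alone moves the straightened `z`-coordinate `z + ty + t²x/2` by `t` times as
much, hence the direction `(0, h, t h)`. Pairing it with the frequency gives `η + tζ`, the velocity
of the curve. -/
theorem shear_sub_transY (t : ℝ) (w : Phase d) (h : Vec d) :
    shear (t, w) - transY d h = shear (t, w - shearTransY t h) := by
  rw [sub_transY, shearTransY_apply]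
  refine Prod.ext rfl (Prod.ext ?_ (Prod.ext ?_ ?_))
  · change w.fst = w.fst - 0
    rw [sub_zero]
  · change w.snd.fst - t • w.fst - h = w.snd.fst - h - t • (w.fst - 0)
    module
  · change w.snd.snd + (-(t • w.snd.fst) + (t ^ 2 / 2) • w.fst) =
      w.snd.snd - t • h + (-(t • (w.snd.fst - h)) + (t ^ 2 / 2) • (w.fst - 0))
    module

theorem shear_sub_transZ (t : ℝ) (w : Phase d) (h : Vec d) :
    shear (t, w) - transZ d h = shear (t, w - shearTransZ t h) := by
  rw [sub_transZ, shearTransZ_apply]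
  refine Prod.ext rfl (Prod.ext ?_ (Prod.ext ?_ ?_))
  · change w.fst = w.fst - 0
    rw [sub_zero]
  · change w.snd.fst - t • w.fst = w.snd.fst - 0 - t • (w.fst - 0)
    module
  · change w.snd.snd + (-(t • w.snd.fst) + (t ^ 2 / 2) • w.fst) - h =
      w.snd.snd - h + (-(t • (w.snd.fst - 0)) + (t ^ 2 / 2) • (w.fst - 0))
    module

theorem inner_shearTransY (t : ℝ) (h : Vec d) (k : Phase d) :
    inner ℝ (shearTransY t h) k = inner ℝ h (freqY t k) := by
  rw [shearTransY_apply, WithLp.prod_inner_apply, WithLp.prod_inner_apply]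
  change inner ℝ (0 : Vec d) k.fst + (inner ℝ h k.snd.fst + inner ℝ (t • h) k.snd.snd) =
    inner ℝ h (k.snd.fst + t • k.snd.snd)
  rw [inner_zero_left, zero_add, inner_add_right, real_inner_smul_left, real_inner_smul_right]

theorem inner_shearTransZ (t : ℝ) (h : Vec d) (k : Phase d) :
    inner ℝ (shearTransZ t h) k = inner ℝ h (freqZ t k) := by
  rw [shearTransZ_apply, WithLp.prod_inner_apply, WithLp.prod_inner_apply]
  change inner ℝ (0 : Vec d) k.fst + (inner ℝ (0 : Vec d) k.snd.fst + inner ℝ h k.snd.snd) =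
    inner ℝ h k.snd.snd
  rw [inner_zero_left, inner_zero_left, zero_add, zero_add]

theorem fracLapY_eq (s : ℝ) (φ : Pt d → ℝ) (X : Pt d) :
    fracLapY s φ X = fracConst d s * diffQuot s (transY d) φ X := by
  simp only [fracLapY, fracLap, diffQuot, sub_transY, finrank_euclideanSpace_fin]

theorem fracLapZ_eq (s : ℝ) (φ : Pt d → ℝ) (X : Pt d) :
    fracLapZ s φ X = fracConst d s * diffQuot s (transZ d) φ X := by
  simp only [fracLapZ, fracLap, diffQuot, sub_transZ, finrank_euclideanSpace_fin]

theorem dx_add {φ φ' : Pt d → ℝ} (h : IsTest T φ) (h' : IsTest T φ') (i : Fin d) :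
    dx i (φ + φ') = dx i φ + dx i φ' := by
  ext X
  simp only [dx, Pi.add_apply]
  rw [fderiv_add (h.differentiable X) (h'.differentiable X)]
  rfl

theorem dx_const_smul {φ : Pt d → ℝ} (h : IsTest T φ) (c : ℝ) (i : Fin d) :
    dx i (c • φ) = c • dx i φ := by
  ext X
  simp only [dx, Pi.smul_apply]
  rw [fderiv_const_smul (h.differentiable X)]
  rfl

/-- States that the classical derivative of a test function is also its weak derivative on the slab,
so that the multiplier rule for weak derivatives covers test functions. -/
theorem integral_mul_dx {φ χ : Pt d → ℝ} (hφ : IsTest T φ) (hχ : IsTest T χ) (i : Fin d) :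
    ∫ X in slab d T, φ X * -dx i χ X = ∫ X in slab d T, dx i φ X * χ X := by
  have hz : ∀ {χ : Pt d → ℝ}, IsTest T χ → ∀ X, X ∉ slab d T → χ X = 0 := fun hχ X hX =>
    image_eq_zero_of_notMem_tsupport fun h => hX (hχ.support h)
  have hi : ∀ {f g : Pt d → ℝ}, IsTest T f → IsTest T g → Integrable (fun X => f X * g X) :=
    fun hf hg => (hf.smooth.continuous.mul hg.smooth.continuous).integrable_of_hasCompactSupport
      hf.compact.mul_right
  rw [setIntegral_eq_integral_of_forall_compl_eq_zero fun X hX => by rw [hz hφ X hX, zero_mul],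
    setIntegral_eq_integral_of_forall_compl_eq_zero fun X hX => by rw [hz hχ X hX, mul_zero]]
  simp_rw [mul_neg]
  rw [integral_neg]
  have h := integral_mul_fderiv_eq_neg_fderiv_mul_of_integrable (μ := (volume : Measure (Pt d)))
    (f := φ) (g := χ) (v := (0, EuclideanSpace.single i 1, 0, 0)) (hi (hφ.dx i) hχ)
    (hi hφ (hχ.dx i)) (hi hφ hχ) (fun X _ => hφ.differentiable X) (fun X _ => hχ.differentiable X)
  change -(∫ X, φ X * fderiv ℝ χ X _) = _
  rw [h, neg_neg]
  rfl

/-- The Fourier multiplier of `∂_{x_i}`. -/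
def gradSymbol (i : Fin d) (X : ℝ × Phase d) : ℂ := 2 * Real.pi * Complex.I * (freq X i : ℝ)

theorem continuous_gradSymbol (i : Fin d) : Continuous (gradSymbol i) := by
  have h1 : Continuous fun X : ℝ × Phase d => freq X i :=
    (EuclideanSpace.proj i : Vec d →L[ℝ] ℝ).continuous.comp continuous_freq
  exact continuous_const.mul (Complex.continuous_ofReal.comp h1)

theorem norm_gradSymbol (i : Fin d) (X : ℝ × Phase d) :
    ‖gradSymbol i X‖ = 2 * Real.pi * |freq X i| := by
  simp [gradSymbol, abs_of_pos Real.pi_pos]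

theorem pft_dx {φ : Pt d → ℝ} (hφ : IsTest T φ) (i : Fin d) {Φ : ℝ × Phase d → ℂ}
    (hΦ : IsPFT (volume.restrict (timeSet T)) (fun X => (φ (shear X) : ℂ)) Φ) :
    IsPFT (volume.restrict (timeSet T)) (fun X => (dx i φ (shear X) : ℂ))
      (fun X => gradSymbol i X * Φ X) := by
  obtain ⟨Φi, hΦi⟩ := exists_pft ((hφ.dx i).memLp 2)
  exact hΦi.congr ae_eq_rfl (pft_gradX i hΦ hΦi fun χ hχ => integral_mul_dx hφ hχ i)

/-- The function that dominates all terms of the estimate in Fourier variables. -/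
def majorant (lam : ℝ) (U : ℝ × Phase d → ℂ) (X : ℝ × Phase d) : ℝ :=
  (lam + fourierWeight X) * ‖U X‖

theorem majorant_nonneg {lam : ℝ} (hlam : 0 ≤ lam) (U : ℝ × Phase d → ℂ) (X : ℝ × Phase d) :
    0 ≤ majorant lam U X :=
  mul_nonneg (add_nonneg hlam (fourierWeight_nonneg X)) (norm_nonneg _)

theorem eLpNorm_le_majorant {lam C : ℝ} {F : Type*} [NormedAddCommGroup F]
    {U : ℝ × Phase d → ℂ} {V : ℝ × Phase d → F} (hlam : 0 ≤ lam)
    (h : ∀ X, ‖V X‖ ≤ C * majorant lam U X) :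
    eLpNorm V 2 (shearMeasure d T) ≤
      ENNReal.ofReal C * eLpNorm (majorant lam U) 2 (shearMeasure d T) :=
  eLpNorm_le_mul_eLpNorm_of_ae_le_mul (Eventually.of_forall fun X => by
    rw [Real.norm_of_nonneg (majorant_nonneg hlam U X)]; exact h X) 2

theorem norm_le_majorant {lam C m : ℝ} {X : ℝ × Phase d} (hlam : 0 ≤ lam) (hC : 0 ≤ C)
    (hm : m ≤ fourierWeight X) (U : ℝ × Phase d → ℂ) :
    C * m * ‖U X‖ ≤ C * majorant lam U X := by
  rw [mul_assoc, majorant]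
  gcongr
  linarith

theorem eLpNorm_majorant_le {lam : ℝ} (hlam : 0 ≤ lam) {U : ℝ × Phase d → ℂ}
    (hU : AEStronglyMeasurable U (shearMeasure d T)) :
    eLpNorm (majorant lam U) 2 (shearMeasure d T) ≤
      eLpNorm (fun X => lam * U X) 2 (shearMeasure d T) +
        eLpNorm (fun X => fourierWeight X * U X) 2 (shearMeasure d T) := by
  have m1 : AEStronglyMeasurable (fun X => (lam : ℂ) * U X) (shearMeasure d T) := hU.const_mul _
  have m2 : AEStronglyMeasurable (fun X => (fourierWeight X : ℂ) * U X) (shearMeasure d T) :=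
    (Complex.continuous_ofReal.comp continuous_fourierWeight).aestronglyMeasurable.mul hU
  have e : majorant lam U = (fun X => ‖(lam : ℂ) * U X‖) + fun X => ‖(fourierWeight X : ℂ) * U X‖ := by
    ext X
    simp only [majorant, Pi.add_apply, norm_mul, Complex.norm_real,
      Real.norm_of_nonneg hlam, Real.norm_of_nonneg (fourierWeight_nonneg X)]
    ring
  rw [e]
  refine (eLpNorm_add_le m1.norm m2.norm (by norm_num)).trans (le_of_eq ?_)
  rw [eLpNorm_norm, eLpNorm_norm]

/-- The constants in the bounds for the fractional derivatives. -/
def fracBound (d : ℕ) (s : ℝ) : ℝ := |fracConst d s| * symbolConst d s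

theorem fracBound_nonneg (s : ℝ) : 0 ≤ fracBound d s :=
  mul_nonneg (abs_nonneg _) (symbolConst_nonneg d s)

variable {lam : ℝ} {u : Pt d → ℝ} {U : ℝ × Phase d → ℂ}

/-- The order `2s = 2/3` is matched to `|p'|^{2/3} ≤ fourierWeight`; no further operator acts on the
test function, so the extra multiplier is 1. -/
theorem exists_fracLapY [Nontrivial (Vec d)] (hlam : 0 ≤ lam) (hu : MemLp u 2 (slabMeasure d T))
    (hU : IsPFT (volume.restrict (timeSet T)) (fun X => (u (shear X) : ℂ)) U)
    (hfin : eLpNorm (majorant lam U) 2 (shearMeasure d T) ≠ ⊤) :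
    ∃ B, MemLp B 2 (slabMeasure d T) ∧ IsFracLapY T (1 / 3) u B ∧
      norm2 T B ≤ ENNReal.ofReal (fracBound d (1 / 3)) *
        eLpNorm (majorant lam U) 2 (shearMeasure d T) := by
  have hle : eLpNorm (fun X => |fracConst d (1 / 3)| * symbolConst d (1 / 3) *
      (‖freqY X.1 X.2‖ ^ (2 * (1 / 3) : ℝ) * ‖(1 : ℂ)‖) * ‖U X‖) 2 (shearMeasure d T) ≤
      ENNReal.ofReal (fracBound d (1 / 3)) * eLpNorm (majorant lam U) 2 (shearMeasure d T) := by
    refine eLpNorm_le_majorant hlam fun X => ?_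
    have h0 := fracBound_nonneg (d := d) (1 / 3)
    rw [norm_one, mul_one, show (2 * (1 / 3) : ℝ) = 2 / 3 by norm_num, ← fracBound,
      Real.norm_of_nonneg (by positivity)]
    exact norm_le_majorant hlam h0 (freqY_rpow_le_weight X) U
  obtain ⟨B, hB, hBn, hBr⟩ := exists_represents_diffQuot (s := 1 / 3) (by norm_num) (by norm_num)
    shear_sub_transY inner_shearTransY continuous_freqY hu hU (fracConst d (1 / 3)) (M := id)
    (fun _ h => h) (fun _ _ _ _ => rfl) (fun _ _ _ => rfl) (b := fun _ => 1) continuous_const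
    (fun φ Φ _ hΦ => by simpa using hΦ)
    (ne_top_of_le_ne_top (ENNReal.mul_ne_top ENNReal.ofReal_ne_top hfin) hle)
  refine ⟨B, hB, ⟨hBr.1, fun φ hφ => ?_⟩, hBn.trans hle⟩
  simpa only [fracLapY_eq, id_eq] using hBr.2 φ hφ

/-- The order `2s = 2/5` is matched to `|p''|^{2/5} ≤ fourierWeight`. -/
theorem exists_fracLapZ [Nontrivial (Vec d)] (hlam : 0 ≤ lam) (hu : MemLp u 2 (slabMeasure d T))
    (hU : IsPFT (volume.restrict (timeSet T)) (fun X => (u (shear X) : ℂ)) U)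
    (hfin : eLpNorm (majorant lam U) 2 (shearMeasure d T) ≠ ⊤) :
    ∃ C, MemLp C 2 (slabMeasure d T) ∧ IsFracLapZ T (1 / 5) u C ∧
      norm2 T C ≤ ENNReal.ofReal (fracBound d (1 / 5)) *
        eLpNorm (majorant lam U) 2 (shearMeasure d T) := by
  have hle : eLpNorm (fun X => |fracConst d (1 / 5)| * symbolConst d (1 / 5) *
      (‖freqZ X.1 X.2‖ ^ (2 * (1 / 5) : ℝ) * ‖(1 : ℂ)‖) * ‖U X‖) 2 (shearMeasure d T) ≤
      ENNReal.ofReal (fracBound d (1 / 5)) * eLpNorm (majorant lam U) 2 (shearMeasure d T) := by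
    refine eLpNorm_le_majorant hlam fun X => ?_
    have h0 := fracBound_nonneg (d := d) (1 / 5)
    rw [norm_one, mul_one, show (2 * (1 / 5) : ℝ) = 2 / 5 by norm_num, ← fracBound,
      Real.norm_of_nonneg (by positivity)]
    exact norm_le_majorant hlam h0 (freqZ_rpow_le_weight X) U
  obtain ⟨C, hC, hCn, hCr⟩ := exists_represents_diffQuot (s := 1 / 5) (by norm_num) (by norm_num)
    shear_sub_transZ inner_shearTransZ continuous_freqZ hu hU (fracConst d (1 / 5)) (M := id)
    (fun _ h => h) (fun _ _ _ _ => rfl) (fun _ _ _ => rfl) (b := fun _ => 1) continuous_const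
    (fun φ Φ _ hΦ => by simpa using hΦ)
    (ne_top_of_le_ne_top (ENNReal.mul_ne_top ENNReal.ofReal_ne_top hfin) hle)
  refine ⟨C, hC, ⟨hCr.1, fun φ hφ => ?_⟩, hCn.trans hle⟩
  simpa only [fracLapZ_eq, id_eq] using hCr.2 φ hφ

theorem eLpNorm_freqY_gradSymbol_le (hlam : 0 ≤ lam) (i : Fin d) :
    eLpNorm (fun X => |-fracConst d (1 / 6)| * symbolConst d (1 / 6) *
      (‖freqY X.1 X.2‖ ^ (2 * (1 / 6) : ℝ) * ‖gradSymbol i X‖) * ‖U X‖) 2 (shearMeasure d T) ≤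
      ENNReal.ofReal (fracBound d (1 / 6) * (2 * Real.pi)) *
        eLpNorm (majorant lam U) 2 (shearMeasure d T) := by
  refine eLpNorm_le_majorant hlam fun X => ?_
  have h0 := fracBound_nonneg (d := d) (1 / 6)
  have h2 : ‖freqY X.1 X.2‖ ^ (1 / 3 : ℝ) * |freq X i| ≤ fourierWeight X :=
    (mul_le_mul_of_nonneg_left (abs_freq_apply_le X i) (by positivity)).trans
      (freqY_mul_freq_le_weight X)
  rw [norm_gradSymbol, abs_neg, show (2 * (1 / 6) : ℝ) = 1 / 3 by norm_num, ← fracBound,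
    Real.norm_of_nonneg (by positivity)]
  refine le_trans (le_of_eq ?_) (norm_le_majorant hlam (C := fracBound d (1 / 6) * (2 * Real.pi))
    (by positivity) h2 U)
  ring

theorem exists_dx_fracLapY [Nontrivial (Vec d)] (hlam : 0 ≤ lam) (hu : MemLp u 2 (slabMeasure d T))
    (hU : IsPFT (volume.restrict (timeSet T)) (fun X => (u (shear X) : ℂ)) U)
    (hfin : eLpNorm (majorant lam U) 2 (shearMeasure d T) ≠ ⊤) (i : Fin d) :
    ∃ A, MemLp A 2 (slabMeasure d T) ∧
      Represents T (fun φ X => -fracLapY (1 / 6) (dx i φ) X) u A ∧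
      norm2 T A ≤ ENNReal.ofReal (fracBound d (1 / 6) * (2 * Real.pi)) *
        eLpNorm (majorant lam U) 2 (shearMeasure d T) := by
  have hle := eLpNorm_freqY_gradSymbol_le (T := T) (U := U) hlam i
  -- The derivative is put on the test function through `M = dx i`, and the sign from integrating by
  -- parts is carried by the constant `-fracConst`.
  obtain ⟨A, hA, hAn, hAr⟩ := exists_represents_diffQuot (s := 1 / 6) (by norm_num) (by norm_num)
    shear_sub_transY inner_shearTransY continuous_freqY hu hU (-fracConst d (1 / 6)) (M := dx i)
    (fun _ h => h.dx i) (fun _ _ h h' => dx_add h h' i) (fun c _ h => dx_const_smul h c i)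
    (b := gradSymbol i) (continuous_gradSymbol i) (fun φ Φ hφ hΦ => pft_dx hφ i hΦ)
    (ne_top_of_le_ne_top (ENNReal.mul_ne_top ENNReal.ofReal_ne_top hfin) hle)
  refine ⟨A, hA, ⟨hAr.1, fun φ hφ => ?_⟩, hAn.trans hle⟩
  simpa only [fracLapY_eq, neg_mul] using hAr.2 φ hφ

theorem mul_eLpNorm_le_majorant {g : Pt d → ℝ} {V : ℝ × Phase d → ℂ} {r C : ℝ} (hr : 0 ≤ r)
    (hlam : 0 ≤ lam)
    (hg : IsPFT (volume.restrict (timeSet T)) (fun X => (g (shear X) : ℂ)) V)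
    (h : ∀ X, r * ‖V X‖ ≤ C * majorant lam U X) :
    ENNReal.ofReal r * eLpNorm g 2 (slabMeasure d T) ≤
      ENNReal.ofReal C * eLpNorm (majorant lam U) 2 (shearMeasure d T) := by
  rw [← eLpNorm_pft_test hg]
  refine le_trans (le_of_eq ?_) (eLpNorm_le_majorant (V := (r : ℂ) • V) hlam fun X => ?_)
  · rw [eLpNorm_const_smul, ← ofReal_norm (r : ℂ), Complex.norm_real, Real.norm_of_nonneg hr]
  · rw [Pi.smul_apply, norm_smul, Complex.norm_real, Real.norm_of_nonneg hr]
    exact h X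

/-- Interpolation between the zero order and the second order term: `2√λ |p_i| ≤ λ + |p_i|²`. -/
theorem sqrt_mul_freq_le (hlam : 0 ≤ lam) (X : ℝ × Phase d) (i : Fin d) :
    Real.sqrt lam * |freq X i| ≤ lam + fourierWeight X := by
  have h1 := abs_freq_apply_le X i
  have h2 := freq_sq_le_weight X
  have h3 := Real.sq_sqrt hlam
  have h4 : |freq X i| ^ 2 ≤ ‖freq X‖ ^ 2 := by gcongr
  nlinarith [sq_nonneg (Real.sqrt lam - |freq X i|), sq_nonneg (Real.sqrt lam),
    sq_nonneg (|freq X i|)]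

theorem norm2_gradX_le (hlam : 0 ≤ lam) {G : Pt d → Vec d} (hGL : MemLp G 2 (slabMeasure d T))
    (hG : ∀ i, IsPFT (volume.restrict (timeSet T)) (fun X => (G (shear X) i : ℂ))
      (fun X => gradSymbol i X * U X)) :
    ENNReal.ofReal (Real.sqrt lam) * norm2 T G ≤
      d * ENNReal.ofReal (2 * Real.pi) * eLpNorm (majorant lam U) 2 (shearMeasure d T) := by
  have h1 : norm2 T G ≤ ∑ i, eLpNorm (fun X => G X i) 2 (slabMeasure d T) :=
    eLpNorm_le_sum fun i => (memLp_apply hGL i).1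
  refine (mul_le_mul_right h1 _).trans ?_
  rw [Finset.mul_sum]
  refine (Finset.sum_le_card_nsmul _ _ _ fun i _ =>
    mul_eLpNorm_le_majorant (U := U) (C := 2 * Real.pi) (Real.sqrt_nonneg lam) hlam (hG i) fun X => ?_).trans
    (le_of_eq ?_)
  · rw [norm_mul, norm_gradSymbol, majorant]
    have := mul_le_mul_of_nonneg_right (sqrt_mul_freq_le hlam X i) (norm_nonneg (U X))
    have hpi := Real.pi_pos
    calc Real.sqrt lam * (2 * Real.pi * |freq X i| * ‖U X‖)
        = 2 * Real.pi * (Real.sqrt lam * |freq X i| * ‖U X‖) := by ring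
      _ ≤ _ := by gcongr
  · simp [mul_assoc]

theorem norm2_hessX_le (hlam : 0 ≤ lam) {H : Pt d → EuclideanSpace ℝ (Fin d × Fin d)}
    (hHL : MemLp H 2 (slabMeasure d T))
    (hH : ∀ i j, IsPFT (volume.restrict (timeSet T)) (fun X => (H (shear X) (i, j) : ℂ))
      (fun X => -(4 * Real.pi ^ 2 * (freq X i * freq X j) : ℝ) * U X)) :
    norm2 T H ≤ (d * d) * ENNReal.ofReal (4 * Real.pi ^ 2) *
      eLpNorm (majorant lam U) 2 (shearMeasure d T) := by
  have h1 : norm2 T H ≤ ∑ p, eLpNorm (fun X => H X p) 2 (slabMeasure d T) :=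
    eLpNorm_le_sum fun p => (memLp_apply hHL p).1
  refine h1.trans ((Finset.sum_le_card_nsmul _ _ (ENNReal.ofReal (4 * Real.pi ^ 2) *
    eLpNorm (majorant lam U) 2 (shearMeasure d T)) fun p _ => ?_).trans (le_of_eq ?_))
  · have h2 := mul_eLpNorm_le_majorant (g := fun X => H X p) (U := U) (C := 4 * Real.pi ^ 2) zero_le_one hlam
      (hH p.1 p.2) fun X => ?_
    · rwa [ENNReal.ofReal_one, one_mul] at h2
    · have h3 : |freq X p.1 * freq X p.2| ≤ fourierWeight X := by
        rw [abs_mul]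
        refine le_trans ?_ (freq_sq_le_weight X)
        rw [sq]
        exact mul_le_mul (abs_freq_apply_le X _) (abs_freq_apply_le X _) (abs_nonneg _)
          (norm_nonneg _)
      rw [one_mul, norm_mul, norm_neg, Complex.norm_real, Real.norm_eq_abs, abs_mul,
        abs_of_nonneg (by positivity : 0 ≤ 4 * Real.pi ^ 2)]
      exact norm_le_majorant hlam (by positivity) h3 U
  · simp [mul_assoc]

/-- The transport term is recovered from the equation: its transform is that of the right-hand side
minus `coeffSymbol · U`, and the upper ellipticity bound controls the latter by the majorant. -/
theorem norm2_transport_le {δ : ℝ} (hδ : 0 < δ) (hlam : 0 ≤ lam)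
    {a : ℝ → Matrix (Fin d) (Fin d) ℝ} (ha : IsCoeff δ a) {Y f : Pt d → ℝ} {Yh : ℝ × Phase d → ℂ}
    (hY : IsPFT (volume.restrict (timeSet T)) (fun X => (Y (shear X) : ℂ)) Yh)
    (hF : IsPFT (volume.restrict (timeSet T)) (fun X => (f (shear X) : ℂ))
      (fun X => Yh X + coeffSymbol a lam X * U X)) :
    norm2 T Y ≤ norm2 T f + ENNReal.ofReal (4 * Real.pi ^ 2 * δ⁻¹ + 1) *
      eLpNorm (majorant lam U) 2 (shearMeasure d T) := by
  rw [norm2, norm2, ← eLpNorm_pft_test hY, ← eLpNorm_pft_test hF]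
  have e : Yh = (fun X => Yh X + coeffSymbol a lam X * U X) -
      fun X => (coeffSymbol a lam X : ℂ) * U X := by
    ext X; simp
  have hm : AEStronglyMeasurable (fun X => (coeffSymbol a lam X : ℂ) * U X) (shearMeasure d T) := by
    have := hF.memLp'.1.sub hY.memLp'.1
    refine this.congr (Eventually.of_forall fun X => ?_)
    simp
  conv_lhs => rw [e]
  refine (eLpNorm_sub_le hF.memLp'.1 hm (by norm_num)).trans (add_le_add_right ?_ _)
  refine eLpNorm_le_majorant hlam fun X => ?_
  have h1 := abs_coeffSymbol_le ha hδ hlam X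
  have h2 := fourierWeight_nonneg X
  have h3 : 0 ≤ 4 * Real.pi ^ 2 * δ⁻¹ := by positivity
  rw [norm_mul, Complex.norm_real, Real.norm_eq_abs, majorant, ← mul_assoc]
  refine mul_le_mul_of_nonneg_right (h1.trans ?_) (norm_nonneg _)
  nlinarith [mul_nonneg h3 hlam]

end Conclusion

/-! ### Assembling the terms. -/

section MainEstimate

variable {d : ℕ} {T : EReal} {lam : ℝ} {u : Pt d → ℝ} {U : ℝ × Phase d → ℂ}

theorem exists_gradX_fracLapY [Nontrivial (Vec d)] (hlam : 0 ≤ lam)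
    (hu : MemLp u 2 (slabMeasure d T))
    (hU : IsPFT (volume.restrict (timeSet T)) (fun X => (u (shear X) : ℂ)) U)
    (hfin : eLpNorm (majorant lam U) 2 (shearMeasure d T) ≠ ⊤) :
    ∃ A : Pt d → Vec d, MemLp A 2 (slabMeasure d T) ∧ IsGradXFracLapY T (1 / 6) u A ∧
      norm2 T A ≤ d * ENNReal.ofReal (fracBound d (1 / 6) * (2 * Real.pi)) *
        eLpNorm (majorant lam U) 2 (shearMeasure d T) := by
  choose A hA hAr hAn using exists_dx_fracLapY hlam hu hU hfin
  have hsum : eLpNorm (fun X => (WithLp.toLp 2 (fun i => A i X) : Vec d)) 2 (slabMeasure d T) ≤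
      ∑ i, eLpNorm (A i) 2 (slabMeasure d T) :=
    eLpNorm_le_sum (f := fun X => (WithLp.toLp 2 (fun i => A i X) : Vec d)) fun i => (hA i).1
  have hm : AEStronglyMeasurable (fun X => (WithLp.toLp 2 (fun i => A i X) : Vec d))
      (slabMeasure d T) :=
    ((PiLp.continuous_toLp 2 (fun _ : Fin d => ℝ)).measurable.comp_aemeasurable
      (aemeasurable_pi_lambda _ fun i => (hA i).1.aemeasurable)).aestronglyMeasurable
  refine ⟨fun X => WithLp.toLp 2 fun i => A i X, ⟨hm, hsum.trans_lt ?_⟩, hAr, ?_⟩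
  · exact ENNReal.sum_lt_top.2 fun i _ => (hA i).2
  · refine hsum.trans ((Finset.sum_le_card_nsmul _ _ _ fun i _ => hAn i).trans (le_of_eq ?_))
    simp [mul_assoc]

/-- The sum of the constants in the bounds for the single terms. -/
def termConst (d : ℕ) (δ : ℝ) : ℝ≥0∞ :=
  1 + d * ENNReal.ofReal (2 * Real.pi) +
    d * ENNReal.ofReal (fracBound d (1 / 6) * (2 * Real.pi)) +
    (d * d) * ENNReal.ofReal (4 * Real.pi ^ 2) + ENNReal.ofReal (fracBound d (1 / 3)) +
    ENNReal.ofReal (fracBound d (1 / 5)) + ENNReal.ofReal (4 * Real.pi ^ 2 * δ⁻¹ + 1)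

theorem termConst_ne_top (d : ℕ) (δ : ℝ) : termConst d δ ≠ ⊤ := by
  unfold termConst
  finiteness

theorem main_estimate (hd : 0 < d) {δ : ℝ} (hδ : 0 < δ) (hδ' : δ < 1) (hT : T ≠ ⊥)
    {a : ℝ → Matrix (Fin d) (Fin d) ℝ} (ha : IsCoeff δ a) (hlam : 0 ≤ lam)
    {G : Pt d → Vec d} {H : Pt d → EuclideanSpace ℝ (Fin d × Fin d)} {Y : Pt d → ℝ}
    (hS : MemS 2 T u G H Y) :
    ∃ (A : Pt d → Vec d) (B C : Pt d → ℝ),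
      MemLp A 2 (slabMeasure d T) ∧ IsGradXFracLapY T (1 / 6) u A ∧
      MemLp B 2 (slabMeasure d T) ∧ IsFracLapY T (1 / 3) u B ∧
      MemLp C 2 (slabMeasure d T) ∧ IsFracLapZ T (1 / 5) u C ∧
      ENNReal.ofReal lam * norm2 T u + ENNReal.ofReal (Real.sqrt lam) * norm2 T G
          + norm2 T A + norm2 T H + norm2 T B + norm2 T C + norm2 T Y
        ≤ (termConst d δ * (1 + ENNReal.ofReal (Real.sqrt (odeConst δ))) + 1) *
          norm2 T (fun X => P₀ a H Y X + lam * u X) := by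
  have : Nonempty (Fin d) := ⟨⟨0, hd⟩⟩
  have : Nontrivial (Vec d) := inferInstance
  obtain ⟨U, hU⟩ := exists_pft hS.memLp
  obtain ⟨Yh, hYh⟩ := exists_pft hS.memLp_transport
  obtain ⟨hG, hH, hF'⟩ := pft_of_memS (lam := lam) ha hS hU
  have hF := hF' Yh hYh
  obtain ⟨e1, e2⟩ := fourier_estimates hd hδ hδ' hT ha hlam hS hU hYh
  set K := norm2 T (fun X => P₀ a H Y X + lam * u X) with hK
  -- Finiteness of the right-hand side makes the majorant square integrable, without which the
  -- fractional derivatives could not be represented by functions.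
  have hKfin : K ≠ ⊤ := by
    have h1 : eLpNorm (fun X => Yh X + coeffSymbol a lam X * U X) 2 (shearMeasure d T) = K :=
      eLpNorm_pft_test (φ := fun X => P₀ a H Y X + lam * u X) hF
    rw [← h1]
    exact hF.memLp'.2.ne
  set S := eLpNorm (majorant lam U) 2 (shearMeasure d T) with hSdef
  -- The summand 1 comes from the zero order estimate of `λ U`, the square root from the weighted
  -- ODE estimate.
  have hSK : S ≤ (1 + ENNReal.ofReal (Real.sqrt (odeConst δ))) * K := by
    refine (eLpNorm_majorant_le hlam hU.memLp'.1).trans ?_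
    rw [add_mul, one_mul]
    exact add_le_add e2 e1
  have hfin : S ≠ ⊤ := ne_top_of_le_ne_top (by finiteness) hSK
  obtain ⟨A, hA, hAr, hAn⟩ := exists_gradX_fracLapY hlam hS.memLp hU hfin
  obtain ⟨B, hB, hBr, hBn⟩ := exists_fracLapY hlam hS.memLp hU hfin
  obtain ⟨C, hC, hCr, hCn⟩ := exists_fracLapZ hlam hS.memLp hU hfin
  refine ⟨A, B, C, hA, hAr, hB, hBr, hC, hCr, ?_⟩
  have b1 : ENNReal.ofReal lam * norm2 T u ≤ S := by
    have h := mul_eLpNorm_le_majorant (U := U) (C := 1) hlam hlam hU fun X => by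
      rw [one_mul, majorant]
      gcongr
      linarith [fourierWeight_nonneg X]
    rwa [ENNReal.ofReal_one, one_mul] at h
  have b2 := norm2_gradX_le hlam hS.memLp_gradX hG
  have b4 := norm2_hessX_le hlam hS.memLp_hessX hH
  have b7 := norm2_transport_le (f := fun X => P₀ a H Y X + lam * u X) hδ hlam ha hYh hF
  rw [← hSdef] at b2 b4 b7 hAn hBn hCn
  -- Every term is a constant times `S`, except that the transport term contributes `K` itself; this
  -- is the final `+ 1` in the constant.
  calc _ ≤ S + d * ENNReal.ofReal (2 * Real.pi) * S +
        d * ENNReal.ofReal (fracBound d (1 / 6) * (2 * Real.pi)) * S +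
        (d * d) * ENNReal.ofReal (4 * Real.pi ^ 2) * S + ENNReal.ofReal (fracBound d (1 / 3)) * S +
        ENNReal.ofReal (fracBound d (1 / 5)) * S +
        (K + ENNReal.ofReal (4 * Real.pi ^ 2 * δ⁻¹ + 1) * S) := by gcongr
    _ = termConst d δ * S + K := by
        unfold termConst
        ring
    _ ≤ termConst d δ * ((1 + ENNReal.ofReal (Real.sqrt (odeConst δ))) * K) + K := by gcongr
    _ = _ := by ring

end MainEstimate

end

end KFP

theorem theorem2p1 (d : ℕ) (hd : 0 < d) (δ : ℝ) (hδ : 0 < δ) (hδ' : δ < 1) :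
    ∃ N : ℝ≥0, ∀ (T : EReal), T ≠ ⊥ →
      ∀ (a : ℝ → Matrix (Fin d) (Fin d) ℝ), KFP.IsCoeff δ a →
      ∀ (lam : ℝ), 0 ≤ lam →
      ∀ (u : KFP.Pt d → ℝ) (G : KFP.Pt d → KFP.Vec d)
        (H : KFP.Pt d → EuclideanSpace ℝ (Fin d × Fin d)) (Y : KFP.Pt d → ℝ),
        KFP.MemS 2 T u G H Y →
      ∃ (A : KFP.Pt d → KFP.Vec d) (B C : KFP.Pt d → ℝ),
        MemLp A 2 (KFP.slabMeasure d T) ∧ KFP.IsGradXFracLapY T (1 / 6) u A ∧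
        MemLp B 2 (KFP.slabMeasure d T) ∧ KFP.IsFracLapY T (1 / 3) u B ∧
        MemLp C 2 (KFP.slabMeasure d T) ∧ KFP.IsFracLapZ T (1 / 5) u C ∧
        ENNReal.ofReal lam * KFP.norm2 T u + ENNReal.ofReal (Real.sqrt lam) * KFP.norm2 T G
            + KFP.norm2 T A + KFP.norm2 T H + KFP.norm2 T B + KFP.norm2 T C + KFP.norm2 T Y
          ≤ (N : ℝ≥0∞) * KFP.norm2 T (fun X => KFP.P₀ a H Y X + lam * u X) := by
  have hN : KFP.termConst d δ * (1 + ENNReal.ofReal (Real.sqrt (KFP.odeConst δ))) + 1 ≠ ⊤ :=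
    ENNReal.add_ne_top.2 ⟨ENNReal.mul_ne_top (KFP.termConst_ne_top d δ) (by finiteness), by simp⟩
  refine ⟨(KFP.termConst d δ * (1 + ENNReal.ofReal (Real.sqrt (KFP.odeConst δ))) + 1).toNNReal,
    fun T hT a ha lam hlam u G H Y hS => ?_⟩
  rw [ENNReal.coe_toNNReal hN]
  exact KFP.main_estimate hd hδ hδ' hT ha hlam hS
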